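/- A ribbon graph $\mathbb{G}$ is a compact surface with boundary that is the union of finitely many discs, called vertices and edges, such that the vertices and edges intersect in disjoint line segments, each of these segments lies on the boundary of exactly one vertex and exactly one edge, and every edge contains exactly two of them. A coloured ribbon graph is a ribbon graph together with a partition $\mathcal{V}$ of its set of vertices and a partition $\mathcal{B}$ of its set of boundary components into colour classes. Coloured ribbon graphs are considered up to homeomorphisms that preserve vertices, edges and both partitions. Deleting an edge $e$ removes its disc; vertex colours are unchanged, the colour classes of the boundary components touching $e$ are merged, and the new boundary components belong to the resulting class. Contracting $e$, with end vertices $u,v$, means gluing a new vertex disc along each boundary curve of $e\cup u\cup v$ and then removing $e,u,v$; boundary colours are unchanged, the colour classes of $u$ and $v$ are merged, and the new vertices belong to the resulting class. The results are denoted $\mathbb{G}\backslash e$ and $\mathbb{G}/e$. The dual $\mathbb{G}^*$ has as vertices the discs that cap off the boundary components of $\mathbb{G}$, and has the same edge discs. An edge is a loop of $\mathbb{G}$ if it is incident with exactly one vertex; a loop is non-orientable if it forms a Möbius band with that vertex, and orientable otherwise. An edge is an (orientable, non-orientable) doop of $\mathbb{G}$ if it is an (orientable, non-orientable) loop of $\mathbb{G}^*$.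 Let $\mathbb{G}/\mathcal{V}$ be the abstract graph whose vertices are the vertex colour classes and in which each edge of $\mathbb{G}$ joins the classes of its end vertices. Let $\mathbb{G}^*/\mathcal{B}$ be the abstract graph whose vertices are the boundary colour classes and in which each edge of $\mathbb{G}$ joins the classes of the boundary components touching it. A bridge of a graph is an edge whose deletion increases the number of components. Consider the connected coloured ribbon graphs with one edge: $\mathrm{bs}$ and $\mathrm{bp}$ (a non-loop edge whose two vertices have different colours, respectively the same colour), $\mathrm{olc}$ and $\mathrm{olh}$ (an orientable loop whose two boundary components have different colours, respectively the same colour), and $\mathrm{nl}$ (a non-orientable loop). An edge $e$ of $\mathbb{G}$ has type $(i,j)$ if, after removing isolated vertices, contracting all edges other than $e$ gives $i$ and deleting all edges other than $e$ gives $j$. Let $$R=\mathbb{Z}[\alpha,\beta,\gamma,a_{\mathrm{bs}},a_{\mathrm{bp}}^{1/2},a_{\mathrm{olc}},a_{\mathrm{olh}}^{1/2},b_{\mathrm{bs}},b_{\mathrm{bp}}^{1/2},b_{\mathrm{olc}},b_{\mathrm{olh}}^{1/2}],\qquad a_{\mathrm{nl}}=a_{\mathrm{bp}}^{1/2}a_{\mathrm{olh}}^{1/2},\qquad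 b_{\mathrm{nl}}=b_{\mathrm{bp}}^{1/2}b_{\mathrm{olh}}^{1/2}.$$ **Theorem.** There is a unique function $U$ from coloured ribbon graphs to $R$ such that $U(\mathbb{G})=a_iU(\mathbb{G}\backslash e)+b_jU(\mathbb{G}/e)$ for every coloured ribbon graph $\mathbb{G}$ and every edge $e$ of $\mathbb{G}$ of type $(i,j)$, and $$U(\mathbb{G})=\alpha^n\beta^m\gamma^v\ \text{ if $\mathbb{G}$ is edgeless with $v$ vertices, $n$ vertex colour classes and $m$ boundary colour classes.}\tag{1}$$ The same function $U$ is also the unique function from coloured ribbon graphs to $R$ that satisfies (1) and, for every coloured ribbon graph $\mathbb{G}$ and every edge $e$ of $\mathbb{G}$, $$U(\mathbb{G})=f(e)\,U(\mathbb{G}\backslash e)+g(e)\,U(\mathbb{G}/e),$$ where $$f(e)=\begin{cases}a_{\mathrm{bs}}&\text{if $e$ is an orientable doop in $\mathbb{G}$ and a bridge in $\mathbb{G}/\mathcal{V}$,}\\ a_{\mathrm{bp}}&\text{if $e$ is an orientable doop in $\mathbb{G}$ and not a bridge in $\mathbb{G}/\mathcal{V}$,}\\ a_{\mathrm{olc}}&\text{if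 $e$ is not a loop in $\mathbb{G}^*/\mathcal{B}$ and not a doop in $\mathbb{G}$,}\\ a_{\mathrm{olh}}&\text{if $e$ is a loop in $\mathbb{G}^*/\mathcal{B}$ and not a doop in $\mathbb{G}$,}\\ a_{\mathrm{bp}}^{1/2}a_{\mathrm{olh}}^{1/2}&\text{if $e$ is a non-orientable doop in $\mathbb{G}$,}\end{cases}$$ $$g(e)=\begin{cases}b_{\mathrm{bs}}&\text{if $e$ is not a loop in $\mathbb{G}$ and not a loop in $\mathbb{G}/\mathcal{V}$,}\\ b_{\mathrm{bp}}&\text{if $e$ is not a loop in $\mathbb{G}$ and a loop in $\mathbb{G}/\mathcal{V}$,}\\ b_{\mathrm{olc}}&\text{if $e$ is a bridge in $\mathbb{G}^*/\mathcal{B}$ and an orientable loop in $\mathbb{G}$,}\\ b_{\mathrm{olh}}&\text{if $e$ is not a bridge in $\mathbb{G}^*/\mathcal{B}$ and an orientable loop in $\mathbb{G}$,}\\ b_{\mathrm{bp}}^{1/2}b_{\mathrm{olh}}^{1/2}&\text{if $e$ is a non-orientable loop in $\mathbb{G}$.}\end{cases}$$ -/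

import Mathlib

namespace RibbonTutte

noncomputable section

/-! ## Ribbon graphs

A ribbon graph is recorded by the finite set of marked points ("flags") on the boundary circles of
its vertex discs. The flags cut each vertex boundary circle into arcs which are alternately

* attaching arcs, each joining a flag `x` to `endInv x`, and
* gaps, each joining a flag `x` to `arcInv x`.

An edge disc is a rectangle `x, endInv x, sideInv (endInv x), sideInv x` (in cyclic order): two
opposite sides of it are attaching arcs, along which it is glued to vertex discs, and the other two
sides, which join each corner `x` to `sideInv x`, are free. An attaching arc which carries no edge
disc is simply a piece of the boundary of the surface, and then `sideInv x = endInv x`.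
Every vertex carries at least one attaching arc, and an isolated vertex carries only arcs without
edge discs. Such unused arcs carry no information and are forgotten by the notion of equivalence
below. -/

/-- A ribbon graph, with finitely many marked arcs on the boundaries of its vertices. -/
structure RibbonGraph where
  Flag : Type
  finite : Finite Flag
  endInv : Flag → Flag
  sideInv : Flag → Flag
  arcInv : Flag → Flag
  endInv_invol : ∀ x, endInv (endInv x) = x
  sideInv_invol : ∀ x, sideInv (sideInv x) = x
  arcInv_invol : ∀ x, arcInv (arcInv x) = x
  endInv_ne : ∀ x, endInv x ≠ x
  sideInv_ne : ∀ x, sideInv x ≠ x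
  arcInv_ne : ∀ x, arcInv x ≠ x
  comm : ∀ x, endInv (sideInv x) = sideInv (endInv x)

attribute [instance] RibbonGraph.finite

namespace RibbonGraph

variable (G : RibbonGraph)

/-- The four corners of the edge disc at `x`. -/
def corners (x : G.Flag) : Set G.Flag :=
  {x, G.endInv x, G.sideInv x, G.endInv (G.sideInv x)}

/-- The edges, each one given as the set of corners of its edge disc. -/
def Edge : Type :=
  {S : Set G.Flag // ∃ x, G.endInv x ≠ G.sideInv x ∧ S = G.corners x}

/-- The corners of the edges in a set of edges. -/
def cornersOf (A : Set G.Edge) : Set G.Flag := {x | ∃ e ∈ A, x ∈ e.1}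

/-- Two flags are related if they lie on the same vertex boundary circle; the classes of this
relation are the vertices of the ribbon graph. -/
def vertexRel : Setoid G.Flag :=
  Relation.EqvGen.setoid fun x y => y = G.endInv x ∨ y = G.arcInv x

/-- Two flags are related if they lie on the same boundary component of the surface; the classes of
this relation are the boundary components of the ribbon graph. -/
def boundaryRel : Setoid G.Flag :=
  Relation.EqvGen.setoid fun x y => y = G.sideInv x ∨ y = G.arcInv x

/-- The set of vertices. -/
abbrev Vertex : Type := Quotient G.vertexRel

/-- The set of boundary components. -/
abbrev Boundary : Type := Quotient G.boundaryRel

/-- The number of vertices. -/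
def numVertices : ℕ := Nat.card G.Vertex

/-- An edge is a loop if it is incident with exactly one vertex. -/
def IsLoop (e : G.Edge) : Prop := ∃ x ∈ e.1, G.vertexRel x (G.sideInv x)

/-- A loop is non-orientable if the edge disc together with its vertex is a Möbius band: when one
traverses the boundary of the vertex, entering the attaching arcs of the edge for the first time at
the corner `x`, one enters them for the second time at the corner `sideInv x` which is joined to `x`
by a free side of the edge (in an annulus it would be the diagonally opposite corner). -/
def IsNonorientableLoop (e : G.Edge) : Prop :=
  ∃ x ∈ e.1, ∃ n : ℕ, (fun y => G.arcInv (G.endInv y))^[n] x = G.sideInv x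

/-- A loop which is not non-orientable. -/
def IsOrientableLoop (e : G.Edge) : Prop := G.IsLoop e ∧ ¬ G.IsNonorientableLoop e

/-- The geometric dual: the discs capping off the boundary components become the vertices, so that
the two kinds of sides of the edge discs are exchanged. -/
def dual : RibbonGraph where
  Flag := G.Flag
  finite := G.finite
  endInv := G.sideInv
  sideInv := G.endInv
  arcInv := G.arcInv
  endInv_invol := G.sideInv_invol
  sideInv_invol := G.endInv_invol
  arcInv_invol := G.arcInv_invol
  endInv_ne := G.sideInv_ne
  sideInv_ne := G.endInv_ne
  arcInv_ne := G.arcInv_ne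
  comm := fun x => (G.comm x).symm

variable {G} in
/-- The edge of the dual that corresponds to an edge. -/
def Edge.dual (e : G.Edge) : G.dual.Edge :=
  ⟨e.1, by
    obtain ⟨S, x, hx, rfl⟩ := e
    refine ⟨x, hx.symm, ?_⟩
    have h := G.comm x
    ext y
    change (y = x ∨ y = G.endInv x ∨ y = G.sideInv x ∨ y = G.endInv (G.sideInv x)) ↔
      (y = x ∨ y = G.sideInv x ∨ y = G.endInv x ∨ y = G.sideInv (G.endInv x))
    rw [h]
    tauto⟩

/-- A doop is an edge whose dual edge is a loop. -/
def IsDoop (e : G.Edge) : Prop := G.dual.IsLoop e.dual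

def IsNonorientableDoop (e : G.Edge) : Prop := G.dual.IsNonorientableLoop e.dual

def IsOrientableDoop (e : G.Edge) : Prop := G.dual.IsOrientableLoop e.dual

variable {G} in
lemma cornersOf_endInv {A : Set G.Edge} {x : G.Flag} (hx : x ∈ G.cornersOf A) :
    G.endInv x ∈ G.cornersOf A := by
  obtain ⟨⟨S, z, hz, rfl⟩, he, hx⟩ := hx
  refine ⟨_, he, ?_⟩
  simp only [corners, Set.mem_insert_iff, Set.mem_singleton_iff] at hx ⊢
  rcases hx with rfl | rfl | rfl | rfl <;> simp [G.endInv_invol]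

variable {G} in
lemma cornersOf_sideInv {A : Set G.Edge} {x : G.Flag} (hx : x ∈ G.cornersOf A) :
    G.sideInv x ∈ G.cornersOf A := by
  obtain ⟨⟨S, z, hz, rfl⟩, he, hx⟩ := hx
  refine ⟨_, he, ?_⟩
  simp only [corners, Set.mem_insert_iff, Set.mem_singleton_iff] at hx ⊢
  rcases hx with rfl | rfl | rfl | rfl <;> simp [G.sideInv_invol, G.comm]

open Classical in
/-- Deletion of a set of edges: the edge discs are removed, and the arcs along which they were
attached become parts of the boundary of the surface. -/
def delete (A : Set G.Edge) : RibbonGraph where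
  Flag := G.Flag
  finite := G.finite
  endInv := G.endInv
  sideInv x := if x ∈ G.cornersOf A then G.endInv x else G.sideInv x
  arcInv := G.arcInv
  endInv_invol := G.endInv_invol
  sideInv_invol x := by
    by_cases h : x ∈ G.cornersOf A
    · simp [h, cornersOf_endInv h, G.endInv_invol]
    · have h' : G.sideInv x ∉ G.cornersOf A := fun h' =>
        h (by simpa [G.sideInv_invol] using cornersOf_sideInv h')
      simp [h, h', G.sideInv_invol]
  arcInv_invol := G.arcInv_invol
  endInv_ne := G.endInv_ne
  sideInv_ne x := by
    by_cases h : x ∈ G.cornersOf A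
    · simpa [h] using G.endInv_ne x
    · simpa [h] using G.sideInv_ne x
  arcInv_ne := G.arcInv_ne
  comm x := by
    by_cases h : x ∈ G.cornersOf A
    · simp [h, cornersOf_endInv h]
    · have h' : G.endInv x ∉ G.cornersOf A := fun h' =>
        h (by simpa [G.endInv_invol] using cornersOf_endInv h')
      simp [h, h', G.comm]

open Classical in
/-- Contraction of a set of edges: new vertex discs are glued in along the boundary curves of the
union of the edge discs and the vertices incident with them, and these old discs are removed. So a
boundary curve of a new vertex runs along the free sides of the contracted edge discs. -/
def contract (A : Set G.Edge) : RibbonGraph where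
  Flag := G.Flag
  finite := G.finite
  endInv x := if x ∈ G.cornersOf A then G.sideInv x else G.endInv x
  sideInv := G.sideInv
  arcInv := G.arcInv
  endInv_invol x := by
    by_cases h : x ∈ G.cornersOf A
    · simp [h, cornersOf_sideInv h, G.sideInv_invol]
    · have h' : G.endInv x ∉ G.cornersOf A := fun h' =>
        h (by simpa [G.endInv_invol] using cornersOf_endInv h')
      simp [h, h', G.endInv_invol]
  sideInv_invol := G.sideInv_invol
  arcInv_invol := G.arcInv_invol
  endInv_ne x := by
    by_cases h : x ∈ G.cornersOf A
    · simpa [h] using G.sideInv_ne x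
    · simpa [h] using G.endInv_ne x
  sideInv_ne := G.sideInv_ne
  arcInv_ne := G.arcInv_ne
  comm x := by
    by_cases h : x ∈ G.cornersOf A
    · simp [h, cornersOf_sideInv h]
    · have h' : G.sideInv x ∉ G.cornersOf A := fun h' =>
        h (by simpa [G.sideInv_invol] using cornersOf_sideInv h')
      simp [h, h', G.comm]

end RibbonGraph

/-! ## Abstract multigraphs -/

/-- The number of connected components of a multigraph. -/
def numComponents {α β : Type} (H : Graph α β) : ℕ :=
  Nat.card (Quotient (Relation.EqvGen.setoid fun u v : H.vertexSet => H.Adj u.1 v.1))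

/-- An edge of a multigraph is a bridge if its deletion increases the number of components. -/
def IsBridge {α β : Type} (H : Graph α β) (e : β) : Prop :=
  e ∈ H.edgeSet ∧ numComponents H < numComponents (H.deleteEdges {e})

/-- An edge of a multigraph is a loop if its two ends coincide. -/
def IsGraphLoop {α β : Type} (H : Graph α β) (e : β) : Prop := ∃ v, H.IsLoopAt e v

/-! ## Coloured ribbon graphs -/

/-- A ribbon graph with a partition of its vertices and a partition of its boundary components into
colour classes. A partition of the vertices is given by the relation "`x` and `y` lie on vertices of
the same colour class" between flags, i.e. by an equivalence relation that is coarser than lying on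
the same vertex, and similarly for boundary components. -/
structure ColouredRibbonGraph extends RibbonGraph where
  vCol : Setoid Flag
  bCol : Setoid Flag
  vertexRel_le : toRibbonGraph.vertexRel ≤ vCol
  boundaryRel_le : toRibbonGraph.boundaryRel ≤ bCol

namespace ColouredRibbonGraph

variable (G : ColouredRibbonGraph)

abbrev Edge : Type := G.toRibbonGraph.Edge

/-- The number of vertex colour classes. -/
def numVertexColours : ℕ := Nat.card (Quotient G.vCol)

/-- The number of boundary colour classes. -/
def numBoundaryColours : ℕ := Nat.card (Quotient G.bCol)

/-- The dual, whose vertex and boundary colourings are the boundary and vertex colourings of the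
given coloured ribbon graph. -/
def dual : ColouredRibbonGraph where
  toRibbonGraph := G.toRibbonGraph.dual
  vCol := G.bCol
  bCol := G.vCol
  vertexRel_le := G.boundaryRel_le
  boundaryRel_le := G.vertexRel_le

lemma vCol_endInv (x : G.Flag) : G.vCol x (G.endInv x) :=
  G.vertexRel_le (.rel _ _ (Or.inl rfl))

lemma vCol_arcInv (x : G.Flag) : G.vCol x (G.arcInv x) :=
  G.vertexRel_le (.rel _ _ (Or.inr rfl))

lemma bCol_sideInv (x : G.Flag) : G.bCol x (G.sideInv x) :=
  G.boundaryRel_le (.rel _ _ (Or.inl rfl))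

lemma bCol_arcInv (x : G.Flag) : G.bCol x (G.arcInv x) :=
  G.boundaryRel_le (.rel _ _ (Or.inr rfl))

/-- The abstract multigraph obtained by identifying the vertices in each vertex colour class: the
vertices are the vertex colour classes, and each edge joins the classes of its end vertices. -/
def vertexQuotient : Graph (Quotient G.vCol) G.Edge where
  vertexSet := Set.univ
  IsLink e u v := ∃ x ∈ e.1, u = ⟦x⟧ ∧ v = ⟦G.sideInv x⟧
  isLink_symm e _ := ⟨by
    rintro _ _ ⟨x, hx, rfl, rfl⟩
    have hx' : x ∈ G.cornersOf {e} := ⟨e, rfl, hx⟩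
    obtain ⟨_, rfl, h⟩ := RibbonGraph.cornersOf_sideInv hx'
    exact ⟨G.sideInv x, h, rfl, by rw [G.sideInv_invol]⟩⟩
  eq_or_eq_of_isLink_of_isLink := by
    rintro ⟨S, z, hz, rfl⟩ _ _ _ _ ⟨x, hx, rfl, rfl⟩ ⟨y, hy, rfl, rfl⟩
    have key : ∀ w ∈ G.corners z, (⟦w⟧ : Quotient G.vCol) = ⟦z⟧ ∧
        (⟦G.sideInv w⟧ : Quotient G.vCol) = ⟦G.sideInv z⟧ ∨
        (⟦w⟧ : Quotient G.vCol) = ⟦G.sideInv z⟧ ∧ (⟦G.sideInv w⟧ : Quotient G.vCol) = ⟦z⟧ := by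
      intro w hw
      simp only [RibbonGraph.corners, Set.mem_insert_iff, Set.mem_singleton_iff] at hw
      rcases hw with rfl | rfl | rfl | rfl
      · exact Or.inl ⟨rfl, rfl⟩
      · refine Or.inl ⟨Quotient.sound (G.vCol.symm (G.vCol_endInv z)), ?_⟩
        rw [← G.comm]
        exact Quotient.sound (G.vCol.symm (G.vCol_endInv _))
      · exact Or.inr ⟨rfl, by rw [G.sideInv_invol]⟩
      · refine Or.inr ⟨Quotient.sound (G.vCol.symm (G.vCol_endInv _)), ?_⟩
        rw [← G.comm, G.sideInv_invol]
        exact Quotient.sound (G.vCol.symm (G.vCol_endInv _))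
    rcases key x hx with ⟨h1, h2⟩ | ⟨h1, h2⟩ <;> rcases key y hy with ⟨h3, h4⟩ | ⟨h3, h4⟩ <;>
      simp [h1, h3, h4]
  left_mem_of_isLink := fun _ _ _ _ => Set.mem_univ _

/-- The abstract multigraph obtained from the dual by identifying the vertices in each of its vertex
colour classes: the vertices are the boundary colour classes, and each edge joins the classes of the
boundary components that touch it. -/
def boundaryQuotient : Graph (Quotient G.bCol) G.dual.Edge := G.dual.vertexQuotient

/-- Deletion of a set of edges: the vertex colours do not change, and the colour classes of the
boundary components that touch a deleted edge are merged. -/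
def delete (A : Set G.Edge) : ColouredRibbonGraph where
  toRibbonGraph := G.toRibbonGraph.delete A
  vCol := G.vCol
  bCol := G.bCol ⊔ Relation.EqvGen.setoid fun x y => x ∈ G.cornersOf A ∧ y = G.endInv x
  vertexRel_le := G.vertexRel_le
  boundaryRel_le := by
    refine Setoid.eqvGen_le ?_
    rintro x y (rfl | rfl)
    · by_cases h : x ∈ G.cornersOf A
      · refine (le_sup_right : _ ≤ G.bCol ⊔ _) (Relation.EqvGen.rel _ _ ⟨h, ?_⟩)
        exact if_pos h
      · refine (le_sup_left : G.bCol ≤ _) ?_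
        have h' : (G.toRibbonGraph.delete A).sideInv x = G.sideInv x := if_neg h
        rw [h']
        exact G.bCol_sideInv x
    · exact (le_sup_left : G.bCol ≤ _) (G.bCol_arcInv x)

/-- Contraction of a set of edges: the boundary colours do not change, the colour classes of the end
vertices of a contracted edge are merged, and the new vertices belong to the resulting classes. -/
def contract (A : Set G.Edge) : ColouredRibbonGraph where
  toRibbonGraph := G.toRibbonGraph.contract A
  vCol := G.vCol ⊔ Relation.EqvGen.setoid fun x y => x ∈ G.cornersOf A ∧ y = G.sideInv x
  bCol := G.bCol
  vertexRel_le := by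
    refine Setoid.eqvGen_le ?_
    rintro x y (rfl | rfl)
    · by_cases h : x ∈ G.cornersOf A
      · refine (le_sup_right : _ ≤ G.vCol ⊔ _) (Relation.EqvGen.rel _ _ ⟨h, ?_⟩)
        exact if_pos h
      · refine (le_sup_left : G.vCol ≤ _) ?_
        have h' : (G.toRibbonGraph.contract A).endInv x = G.endInv x := if_neg h
        rw [h']
        exact G.vCol_endInv x
    · exact (le_sup_left : G.vCol ≤ _) (G.vCol_arcInv x)
  boundaryRel_le := G.boundaryRel_le

/-! ### Equivalence -/

/-- `H.Subdivides G f` says that `H` is obtained from `G`, up to relabelling the flags by the map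
`f`, by marking additional arcs which carry no edge discs on the boundaries of vertices of `G`. In
particular this holds if `f` is an isomorphism of coloured ribbon graphs. -/
structure Subdivides (H G : ColouredRibbonGraph) (f : G.Flag → H.Flag) : Prop where
  injective : Function.Injective f
  map_endInv : ∀ x, f (G.endInv x) = H.endInv (f x)
  map_sideInv : ∀ x, f (G.sideInv x) = H.sideInv (f x)
  /-- the additional arcs carry no edge discs -/
  free : ∀ y, y ∉ Set.range f → H.endInv y = H.sideInv y
  /-- a gap of `G` is a gap of `H` into which some of the additional arcs have been inserted -/
  map_arcInv : ∀ x, Relation.ReflTransGen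
    (fun y z => y ∉ Set.range f ∧ z = H.arcInv (H.endInv y)) (H.arcInv (f x)) (f (G.arcInv x))
  /-- every vertex of `H` comes from a vertex of `G` -/
  vertex : ∀ y, ∃ x, H.vertexRel y (f x)
  vCol_iff : ∀ x y, G.vCol x y ↔ H.vCol (f x) (f y)
  bCol_iff : ∀ x y, G.bCol x y ↔ H.bCol (f x) (f y)

/-- Equivalence of coloured ribbon graphs: the equivalence relation generated by isomorphism and by
the marking of additional arcs which carry no edge discs. So two coloured ribbon graphs are
equivalent if and only if there is a homeomorphism between the surfaces that preserves vertex discs,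
edge discs, vertex colour classes and boundary colour classes. -/
def Equivalent : ColouredRibbonGraph → ColouredRibbonGraph → Prop :=
  Relation.EqvGen fun G H => ∃ f, H.Subdivides G f

/-! ### Edge types -/

/-- The vertex at the flag `x` is incident with an edge. -/
def NonIsolated (x : G.Flag) : Prop := ∃ y, G.vertexRel x y ∧ G.endInv y ≠ G.sideInv y

variable {G} in
lemma NonIsolated.of_rel {x y : G.Flag} (hx : G.NonIsolated x) (h : G.vertexRel x y) :
    G.NonIsolated y := by
  obtain ⟨z, hz, hz'⟩ := hx
  exact ⟨z, G.vertexRel.trans (G.vertexRel.symm h) hz, hz'⟩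

variable {G} in
lemma NonIsolated.endInv {x : G.Flag} (hx : G.NonIsolated x) : G.NonIsolated (G.endInv x) :=
  hx.of_rel (.rel _ _ (Or.inl rfl))

variable {G} in
lemma NonIsolated.arcInv {x : G.Flag} (hx : G.NonIsolated x) : G.NonIsolated (G.arcInv x) :=
  hx.of_rel (.rel _ _ (Or.inr rfl))

variable {G} in
lemma NonIsolated.sideInv {x : G.Flag} (hx : G.NonIsolated x) : G.NonIsolated (G.sideInv x) := by
  by_cases h : G.endInv x = G.sideInv x
  · exact h ▸ hx.endInv
  · refine ⟨G.sideInv x, G.vertexRel.refl _, fun h' => h ?_⟩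
    rw [G.sideInv_invol, G.comm] at h'
    rw [← G.sideInv_invol (G.endInv x), h']

/-- The coloured ribbon graph with all its isolated vertices (and their boundary components)
removed. -/
def removeIsolated : ColouredRibbonGraph where
  Flag := {x : G.Flag // G.NonIsolated x}
  finite := inferInstance
  endInv x := ⟨G.endInv x.1, x.2.endInv⟩
  sideInv x := ⟨G.sideInv x.1, x.2.sideInv⟩
  arcInv x := ⟨G.arcInv x.1, x.2.arcInv⟩
  endInv_invol x := Subtype.ext (G.endInv_invol _)
  sideInv_invol x := Subtype.ext (G.sideInv_invol _)
  arcInv_invol x := Subtype.ext (G.arcInv_invol _)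
  endInv_ne x h := G.endInv_ne x.1 (congrArg Subtype.val h)
  sideInv_ne x h := G.sideInv_ne x.1 (congrArg Subtype.val h)
  arcInv_ne x h := G.arcInv_ne x.1 (congrArg Subtype.val h)
  comm x := Subtype.ext (G.comm _)
  vCol := Setoid.comap Subtype.val G.vCol
  bCol := Setoid.comap Subtype.val G.bCol
  vertexRel_le := by
    refine Setoid.eqvGen_le ?_
    rintro x y (rfl | rfl)
    · exact G.vCol_endInv x.1
    · exact G.vCol_arcInv x.1
  boundaryRel_le := by
    refine Setoid.eqvGen_le ?_
    rintro x y (rfl | rfl)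
    · exact G.bCol_sideInv x.1
    · exact G.bCol_arcInv x.1

end ColouredRibbonGraph

/-- The five connected coloured ribbon graphs with one edge. -/
inductive OneEdgeType
  /-- a non-loop edge, its two vertices having different colours -/
  | bs
  /-- a non-loop edge, its two vertices having the same colour -/
  | bp
  /-- an orientable loop, its two boundary components having different colours -/
  | olc
  /-- an orientable loop, its two boundary components having the same colour -/
  | olh
  /-- a non-orientable loop -/
  | nl

/-- The edge disc with the corners `(i, j)`, where `i` says at which end and `j` on which side of
the edge the corner lies, glued to vertices whose gaps are given by the involution `c`. -/
def oneEdge (c : Bool × Bool → Bool × Bool) (hc : ∀ x, c (c x) = x) (hc' : ∀ x, c x ≠ x) :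
    RibbonGraph where
  Flag := Bool × Bool
  finite := inferInstance
  endInv x := (x.1, !x.2)
  sideInv x := (!x.1, x.2)
  arcInv := c
  endInv_invol := by decide
  sideInv_invol := by decide
  arcInv_invol := hc
  endInv_ne := by decide
  sideInv_ne := by decide
  arcInv_ne := hc'
  comm := by decide

/-- A single edge joining two different vertices. -/
def bridgeGraph : RibbonGraph := oneEdge (fun x => (x.1, !x.2)) (by decide) (by decide)

/-- A single orientable loop at one vertex (an annulus). -/
def orientableLoopGraph : RibbonGraph := oneEdge (fun x => (!x.1, x.2)) (by decide) (by decide)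

/-- A single non-orientable loop at one vertex (a Möbius band). -/
def nonorientableLoopGraph : RibbonGraph := oneEdge (fun x => (!x.1, !x.2)) (by decide) (by decide)

/-- The coloured ribbon graph with one edge of the given kind. -/
def OneEdgeType.graph : OneEdgeType → ColouredRibbonGraph
  | .bs =>
    { toRibbonGraph := bridgeGraph
      vCol := bridgeGraph.vertexRel
      bCol := ⊤
      vertexRel_le := le_rfl
      boundaryRel_le := le_top }
  | .bp =>
    { toRibbonGraph := bridgeGraph
      vCol := ⊤
      bCol := ⊤
      vertexRel_le := le_top
      boundaryRel_le := le_top }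
  | .olc =>
    { toRibbonGraph := orientableLoopGraph
      vCol := ⊤
      bCol := orientableLoopGraph.boundaryRel
      vertexRel_le := le_top
      boundaryRel_le := le_rfl }
  | .olh =>
    { toRibbonGraph := orientableLoopGraph
      vCol := ⊤
      bCol := ⊤
      vertexRel_le := le_top
      boundaryRel_le := le_top }
  | .nl =>
    { toRibbonGraph := nonorientableLoopGraph
      vCol := ⊤
      bCol := ⊤
      vertexRel_le := le_top
      boundaryRel_le := le_top }

namespace ColouredRibbonGraph

variable (G : ColouredRibbonGraph)

/-- The edge `e` is of type `(i, j)` if, after removing isolated vertices, contracting all the other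
edges gives `i` and deleting all the other edges gives `j`. -/
def IsOfType (e : G.Edge) (i j : OneEdgeType) : Prop :=
  (G.contract {e}ᶜ).removeIsolated.Equivalent i.graph ∧
    (G.delete {e}ᶜ).removeIsolated.Equivalent j.graph

end ColouredRibbonGraph

/-! ## The polynomial ring -/

/-- The eleven variables `α`, `β`, `γ`, `a_bs`, `a_bp^{1/2}`, `a_olc`, `a_olh^{1/2}`, `b_bs`,
`b_bp^{1/2}`, `b_olc`, `b_olh^{1/2}`. -/
inductive Var
  | α | β | γ | aBs | sqrtABp | aOlc | sqrtAOlh | bBs | sqrtBBp | bOlc | sqrtBOlh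

/-- The ring of polynomials with integer coefficients in these variables. -/
abbrev TutteRing : Type := MvPolynomial Var ℤ

open MvPolynomial (X)

/-- The coefficients `a_i`, with `a_nl = a_bp^{1/2} a_olh^{1/2}`. -/
def coeffA : OneEdgeType → TutteRing
  | .bs => X Var.aBs
  | .bp => X Var.sqrtABp ^ 2
  | .olc => X Var.aOlc
  | .olh => X Var.sqrtAOlh ^ 2
  | .nl => X Var.sqrtABp * X Var.sqrtAOlh

/-- The coefficients `b_j`, with `b_nl = b_bp^{1/2} b_olh^{1/2}`. -/
def coeffB : OneEdgeType → TutteRing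
  | .bs => X Var.bBs
  | .bp => X Var.sqrtBBp ^ 2
  | .olc => X Var.bOlc
  | .olh => X Var.sqrtBOlh ^ 2
  | .nl => X Var.sqrtBBp * X Var.sqrtBOlh

/-- The value on an edgeless coloured ribbon graph is `α ^ n * β ^ m * γ ^ v`, if it has `v`
vertices, `n` vertex colour classes and `m` boundary colour classes. -/
def EdgelessValue (U : ColouredRibbonGraph → TutteRing) : Prop :=
  ∀ G : ColouredRibbonGraph, IsEmpty G.Edge →
    U G = X Var.α ^ G.numVertexColours * X Var.β ^ G.numBoundaryColours * X Var.γ ^ G.numVertices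

/-- The recursion in terms of edge types, which defines the polynomial. -/
def TypeRecursion (U : ColouredRibbonGraph → TutteRing) : Prop :=
  (∀ (G : ColouredRibbonGraph) (e : G.Edge) (i j : OneEdgeType), G.IsOfType e i j →
    U G = coeffA i * U (G.delete {e}) + coeffB j * U (G.contract {e})) ∧ EdgelessValue U

open Classical in
/-- The coefficient `f(e)`; the last case is that of a non-orientable doop. -/
def deletionCoeff (G : ColouredRibbonGraph) (e : G.Edge) : TutteRing :=
  if G.IsOrientableDoop e ∧ IsBridge G.vertexQuotient e then X Var.aBs
  else if G.IsOrientableDoop e ∧ ¬ IsBridge G.vertexQuotient e then X Var.sqrtABp ^ 2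
  else if ¬ IsGraphLoop G.boundaryQuotient e.dual ∧ ¬ G.IsDoop e then X Var.aOlc
  else if IsGraphLoop G.boundaryQuotient e.dual ∧ ¬ G.IsDoop e then X Var.sqrtAOlh ^ 2
  else X Var.sqrtABp * X Var.sqrtAOlh

open Classical in
/-- The coefficient `g(e)`; the last case is that of a non-orientable loop. -/
def contractionCoeff (G : ColouredRibbonGraph) (e : G.Edge) : TutteRing :=
  if ¬ G.IsLoop e ∧ ¬ IsGraphLoop G.vertexQuotient e then X Var.bBs
  else if ¬ G.IsLoop e ∧ IsGraphLoop G.vertexQuotient e then X Var.sqrtBBp ^ 2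
  else if IsBridge G.boundaryQuotient e.dual ∧ G.IsOrientableLoop e then X Var.bOlc
  else if ¬ IsBridge G.boundaryQuotient e.dual ∧ G.IsOrientableLoop e then X Var.sqrtBOlh ^ 2
  else X Var.sqrtBBp * X Var.sqrtBOlh

/-- The deletion-contraction relations with the coefficients `f(e)` and `g(e)`. -/
def DeletionContraction (U : ColouredRibbonGraph → TutteRing) : Prop :=
  (∀ (G : ColouredRibbonGraph) (e : G.Edge),
    U G = deletionCoeff G e * U (G.delete {e}) + contractionCoeff G e * U (G.contract {e})) ∧
    EdgelessValue U

end

end RibbonTutte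

/-! The polynomial is an explicit sum over states. A state is a set `S` of edges, those to be
contracted, while all others are deleted; it is stored as the set of corners of its edges. What
becomes of the vertices, vertex colours and boundary colours is `curves S`, `vJoin S` and `bJoin S`.
The state contributes `α ^ numV S * β ^ numB S * γ ^ numCurves S`, times a product of
`a`-coefficients for the way from `S` up to the set `E` of all edges, times a product of
`b`-coefficients for the way from `∅` up to `S`.

These products must not depend on the order of the edges, and this is why the coefficient of `nl` is
a product of square roots. If from `X` to a larger state `Y` the vertex classes drop by `v`, the
boundary classes rise by `b`, `k` edges are added and the curves drop by `c`, the product is `p^v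
q^(k+c-2v) r^b s^(k-c-2b)`. For a single edge this is `p`, `q²`, `r`, `s²` or `qs` according to its
kind (`weight_step`), and the exponents telescope along chains of states (`weight_mul_weight`). The
topological input is `curves_step`: the arcs of the curves outside an edge pair up its four corners,
and the three possible pairings say that adding the edge merges two curves, splits one or reroutes
one.

The states without `e` are those of `G \ e`, and the states with `e` correspond to those of `G / e`.
Splitting the sum accordingly gives a recursion whose coefficients are the weights of the steps `E \
e → E` and `∅ → e` (`stateSum_eq`). Contracting all other edges isolates the first step and deleting
them isolates the second, so for an edge of type `(i, j)` the coefficients are `a_i` and `b_j`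
(`IsOfType.weightA_eq`, `IsOfType.weightB_eq`). Loops, doops and bridges are statements about the
same two steps, so the coefficients are also `f(e)` and `g(e)` (`deletionCoeff_eq`,
`contractionCoeff_eq`).

Uniqueness is an induction on the number of edges (`eq_of_recursion`); for the recursion by types it
needs that every edge has a type (`exists_isOfType`). Invariance holds because every ingredient of
the sum survives subdivision (`Subdivides.stateSum_eq`). -/

namespace RibbonTutte

/-! ## Paths along the gaps between marked arcs

For two involutions `a` and `t` of a type and a set `P`, a path starts at `a u` for some `u ∈ P` and
applies `a ∘ t` until it meets `P` again. -/

section GapPaths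

variable {F : Type*} {a t : F → F} {P : Set F}

/-- One step of a path that stops when it meets `P`. -/
def GapStep (a t : F → F) (P : Set F) (y z : F) : Prop := y ∉ P ∧ z = a (t y)

/-- Iterated steps of a path that stops when it meets `P`. -/
abbrev GapReach (a t : F → F) (P : Set F) : F → F → Prop := Relation.ReflTransGen (GapStep a t P)

lemma GapReach.eq_of_mem {y z : F} (h : GapReach a t P y z) (hy : y ∈ P) : z = y := by
  rcases h.cases_head with rfl | ⟨w, hw, -⟩
  · rfl
  · exact absurd hy hw.1

/-- Steps are deterministic, so two paths from one point are nested, and a point of `P` is never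
left. -/
lemma GapReach.reach_of_mem {y z w : F} (h : GapReach a t P y z) (h' : GapReach a t P y w)
    (hw : w ∈ P) : GapReach a t P z w := by
  have hu : Relator.RightUnique (GapStep a t P) := by
    rintro x y z ⟨-, rfl⟩ ⟨-, rfl⟩
    rfl
  rcases Relation.ReflTransGen.total_of_right_unique hu h h' with h | h
  · exact h
  · rw [GapReach.eq_of_mem h hw]

lemma GapReach.unique {y z w : F} (h : GapReach a t P y z) (h' : GapReach a t P y w)
    (hz : z ∈ P) (hw : w ∈ P) : z = w :=
  ((h.reach_of_mem h' hw).eq_of_mem hz).symm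

lemma GapReach.exists_iterate {y z : F} (h : GapReach a t P y z) :
    ∃ n : ℕ, (fun x => a (t x))^[n] y = z := by
  induction h with
  | refl => exact ⟨0, rfl⟩
  | tail _ h ih =>
    obtain ⟨n, rfl⟩ := ih
    exact ⟨n + 1, by rw [Function.iterate_succ_apply', h.2]⟩

/-! ### Reversing a path and reaching its end -/

section Reverse

variable (ha : Function.Involutive a) (ht : Function.Involutive t) (hP : ∀ x ∈ P, t x ∈ P)
include ha ht hP

/-- If `z = a (t y)`, then `a (t (t z)) = t y`, so the reversed path visits the `t`-images of the
points of the path. Stability of `P` under `t` keeps these outside `P`. -/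
lemma GapReach.reverse_aux {y w : F} (h : GapReach a t P y w) (hw : w ∈ P) (hy : y ∉ P) :
    GapReach a t P (a w) (t y) := by
  induction h using Relation.ReflTransGen.head_induction_on with
  | refl => exact absurd hw hy
  | head h' h ih =>
    rename_i y z
    obtain ⟨-, rfl⟩ := h'
    by_cases hz : a (t y) ∈ P
    · rw [GapReach.eq_of_mem h hz, ha]
    · refine (ih hz).tail ⟨fun h => hz ?_, ?_⟩
      · simpa [ht _] using hP _ h
      · rw [ht, ha]

lemma GapReach.reverse {u w : F} (h : GapReach a t P (a u) w) (hw : w ∈ P) :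
    GapReach a t P (a w) u := by
  by_cases hu' : a u ∈ P
  · rw [h.eq_of_mem hu', ha]
  · refine (h.reverse_aux ha ht hP hw hu').tail ⟨fun h => hu' ?_, ?_⟩
    · simpa [ht _] using hP _ h
    · rw [ht, ha]

lemma exists_gapReach [Finite F] {u : F} (hu : u ∈ P) : ∃ w ∈ P, GapReach a t P (a u) w := by
  by_contra! hcon
  have hreach : ∀ n : ℕ, GapReach a t P (a u) ((fun x => a (t x))^[n] (a u)) := by
    intro n
    induction n with
    | zero => exact .refl
    | succ n ih =>
      rw [Function.iterate_succ_apply']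
      exact ih.tail ⟨fun h => hcon _ h ih, rfl⟩
  -- `a u` is the image of `t u` under the permutation `a ∘ t`. By finiteness its iterates come back
  -- to `t u`, which lies in `P`.
  have hinj : Function.Injective fun x => a (t x) := ha.injective.comp ht.injective
  obtain ⟨n, hn, hper⟩ := hinj.mem_periodicPts (t u)
  obtain ⟨n, rfl⟩ := Nat.exists_eq_succ_of_ne_zero hn.ne'
  have h : (fun x => a (t x))^[n] (a u) = t u := by
    have := hper.eq
    rwa [Function.iterate_succ_apply, ht u] at this
  exact hcon _ (h ▸ hP u hu) (hreach n)

/-- The points on the paths that start from a set `C` of end points. -/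
lemma gapReach_closed {C : Set F}
    (hC : ∀ u ∈ C, ∀ w ∈ P, GapReach a t P (a u) w → w ∈ C) (hfin : ∀ u ∈ C, ∃ w ∈ P,
      GapReach a t P (a u) w) {y : F} (hy : ∃ u ∈ C, GapReach a t P (a u) y) :
    (y ∉ P → ∃ u ∈ C, GapReach a t P (a u) (t y)) ∧ ∃ u ∈ C, GapReach a t P (a u) (a y) := by
  -- `t z` lies on the same path run from its other end, which is again in `C`.
  have key : ∀ z, z ∉ P → (∃ u ∈ C, GapReach a t P (a u) z) →
      ∃ u ∈ C, GapReach a t P (a u) (t z) := by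
    rintro z hz ⟨u, hu, huz⟩
    obtain ⟨w, hw, huw⟩ := hfin u hu
    exact ⟨w, hC u hu w hw huw, (huz.reach_of_mem huw hw).reverse_aux ha ht hP hw hz⟩
  refine ⟨fun h => key y h hy, ?_⟩
  obtain ⟨u, hu, huy⟩ := hy
  rcases Relation.ReflTransGen.cases_tail huy with rfl | ⟨z, hz, hz', rfl⟩
  · obtain ⟨w, hw, huw⟩ := hfin u hu
    exact ⟨w, hC u hu w hw huw, by rw [ha]; exact huw.reverse ha ht hP hw⟩
  · rw [ha]
    exact key z hz' ⟨u, hu, hz⟩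

end Reverse

/-- A word of odd length in two involutions is conjugate to one of them, and neither has a fixed
point. The induction removes two letters at each end. -/
lemma iterate_apply_ne (ha : Function.Involutive a) (ht : Function.Involutive t)
    (ha' : ∀ x, a x ≠ x) (ht' : ∀ x, t x ≠ x) (n : ℕ) (x : F) :
    (fun x => a (t x))^[n] (t x) ≠ x := by
  induction n using Nat.twoStepInduction generalizing x with
  | zero => exact ht' x
  | one => simpa [ht x] using ha' x
  | more n ih _ =>
    intro h
    rw [Function.iterate_succ_apply, Function.iterate_succ_apply'] at h
    apply ih (t (a x))
    simp only [ht _] at h ⊢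
    conv_rhs => rw [← h, ha, ht]

lemma GapReach.ne (ha : Function.Involutive a) (ht : Function.Involutive t)
    (ha' : ∀ x, a x ≠ x) (ht' : ∀ x, t x ≠ x) {u w : F} (h : GapReach a t P (a u) w) : w ≠ u := by
  obtain ⟨n, rfl⟩ := h.exists_iterate
  have := iterate_apply_ne ha ht ha' ht' (n + 1) u
  rwa [Function.iterate_succ_apply, ht] at this

/-- Points of `P` on a common component of the union of the paths are the ends of a path. -/
lemma gapReach_of_eqvGen [Finite F] (ha : Function.Involutive a) (ht : Function.Involutive t)
    (hP : ∀ x ∈ P, t x ∈ P) {u w : F} (hu : u ∈ P) (hw : w ∈ P)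
    (h : Relation.EqvGen (fun x y => (x ∉ P ∧ y = t x) ∨ y = a x) u w) :
    w = u ∨ GapReach a t P (a u) w := by
  obtain ⟨v, hv, huv⟩ := exists_gapReach ha ht hP hu
  have hvu := huv.reverse ha ht hP hv
  -- The points on the path between its two ends `u` and `v` form a set that is closed under the
  -- generating relation and meets `P` only in `C`.
  set C : Set F := {u, v}
  have hCP : C ⊆ P := by rintro _ (rfl | rfl) <;> assumption
  have hC : ∀ x ∈ C, ∀ y ∈ P, GapReach a t P (a x) y → y ∈ C := by
    rintro _ (rfl | rfl) y hy hxy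
    · exact Or.inr (hxy.unique huv hy hv)
    · exact Or.inl (hxy.unique hvu hy hu)
  have hcl : ∀ y, (∃ x ∈ C, GapReach a t P (a x) y) →
      (y ∉ P → ∃ u ∈ C, GapReach a t P (a u) (t y)) ∧ ∃ u ∈ C, GapReach a t P (a u) (a y) :=
    fun y hy => gapReach_closed ha ht hP hC
      (fun x hx => exists_gapReach ha ht hP (hCP hx)) hy
  have hS : ∀ x y, Relation.EqvGen (fun x y => (x ∉ P ∧ y = t x) ∨ y = a x) x y →
      ((∃ u ∈ C, GapReach a t P (a u) x) ↔ ∃ u ∈ C, GapReach a t P (a u) y) := by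
    intro x y hxy
    induction hxy with
    | rel x y h =>
      rcases h with ⟨hx, rfl⟩ | rfl
      · refine ⟨fun h => (hcl _ h).1 hx, fun h => ?_⟩
        have := (hcl _ h).1 fun h' => hx (by simpa [ht _] using hP _ h')
        rwa [ht] at this
      · refine ⟨fun h => (hcl _ h).2, fun h => ?_⟩
        have := (hcl _ h).2
        rwa [ha] at this
    | refl => rfl
    | symm _ _ _ ih => exact ih.symm
    | trans _ _ _ _ _ ih ih' => exact ih.trans ih'
  obtain ⟨x, hx, hxw⟩ := (hS u w h).1 ⟨v, Or.inr rfl, hvu⟩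
  rcases hC x hx w hw hxw with rfl | rfl
  · exact Or.inl rfl
  · exact Or.inr huv

end GapPaths


noncomputable section

/-! ## Counting classes -/

section Counting

variable {F : Type*}

/-- The equivalence relation generated by a single pair. -/
def pairSetoid (u w : F) : Setoid F := Relation.EqvGen.setoid fun x y => x = u ∧ y = w

/-- Repeated passages between the classes of `u` and `w` cancel, so a chain in the join needs at
most one. -/
lemma sup_pairSetoid_rel (r : Setoid F) (u w x y : F) :
    (r ⊔ pairSetoid u w) x y ↔ r x y ∨ (r x u ∧ r w y) ∨ (r x w ∧ r u y) := by
  constructor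
  · intro h
    let s : Setoid F :=
      { r := fun x y => r x y ∨ (r x u ∧ r w y) ∨ (r x w ∧ r u y)
        iseqv :=
          { refl := fun x => Or.inl (r.refl x)
            symm := by
              rintro x y (h | ⟨h, h'⟩ | ⟨h, h'⟩)
              · exact Or.inl (r.symm h)
              · exact Or.inr (Or.inr ⟨r.symm h', r.symm h⟩)
              · exact Or.inr (Or.inl ⟨r.symm h', r.symm h⟩)
            trans := by
              rintro x y z (h | ⟨h, h'⟩ | ⟨h, h'⟩) (k | ⟨k, k'⟩ | ⟨k, k'⟩)
              · exact Or.inl (r.trans h k)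
              · exact Or.inr (Or.inl ⟨r.trans h k, k'⟩)
              · exact Or.inr (Or.inr ⟨r.trans h k, k'⟩)
              · exact Or.inr (Or.inl ⟨h, r.trans h' k⟩)
              · exact Or.inr (Or.inl ⟨h, k'⟩)
              · exact Or.inl (r.trans h k')
              · exact Or.inr (Or.inr ⟨h, r.trans h' k⟩)
              · exact Or.inl (r.trans h k')
              · exact Or.inr (Or.inr ⟨h, k'⟩) } }
    have hs : r ⊔ pairSetoid u w ≤ s := by
      refine sup_le (fun _ _ h => Or.inl h) (Setoid.eqvGen_le ?_)
      rintro x y ⟨rfl, rfl⟩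
      exact Or.inr (Or.inl ⟨r.refl _, r.refl _⟩)
    exact hs h
  · have h1 : r ≤ r ⊔ pairSetoid u w := le_sup_left
    have h2 : (r ⊔ pairSetoid u w) u w :=
      (le_sup_right : pairSetoid u w ≤ r ⊔ pairSetoid u w) (.rel _ _ ⟨rfl, rfl⟩)
    rintro (h | ⟨h, h'⟩ | ⟨h, h'⟩)
    · exact h1 h
    · exact Setoid.trans' _ (h1 h) (Setoid.trans' _ h2 (h1 h'))
    · exact Setoid.trans' _ (h1 h) (Setoid.trans' _ (Setoid.symm' _ h2) (h1 h'))

lemma pairSetoid_rel_self (u w : F) : pairSetoid u w u w := .rel _ _ ⟨rfl, rfl⟩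

lemma pairSetoid_le {r : Setoid F} {u w : F} (h : r u w) : pairSetoid u w ≤ r := by
  refine Setoid.eqvGen_le ?_
  rintro x y ⟨rfl, rfl⟩
  exact h

lemma sup_pairSetoid_of_rel {r : Setoid F} {u w : F} (h : r u w) : r ⊔ pairSetoid u w = r :=
  sup_eq_left.2 (pairSetoid_le h)

lemma card_quotient_sup_pairSetoid [Finite F] {r : Setoid F} {u w : F} (h : ¬ r u w) :
    Nat.card (Quotient r) = Nat.card (Quotient (r ⊔ pairSetoid u w)) + 1 := by
  classical
  have hle : r ≤ r ⊔ pairSetoid u w := le_sup_left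
  -- Without the class of `w`, exactly one class is left to represent the merged class.
  let φ : {q : Quotient r // q ≠ ⟦w⟧} → Quotient (r ⊔ pairSetoid u w) := fun q =>
    Quotient.map' id (fun _ _ h => hle h) q.1
  have hφ : Function.Bijective φ := by
    constructor
    · rintro ⟨q, hq⟩ ⟨q', hq'⟩ hqq
      induction q using Quotient.inductionOn with | _ x
      induction q' using Quotient.inductionOn with | _ y
      have hxy : (r ⊔ pairSetoid u w) x y := Quotient.exact hqq
      refine Subtype.ext (Quotient.sound ?_)
      rcases (sup_pairSetoid_rel r u w x y).1 hxy with h | ⟨-, h⟩ | ⟨h, -⟩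
      · exact h
      · exact absurd (Quotient.sound (r.symm h)) hq'
      · exact absurd (Quotient.sound h) hq
    · intro q
      induction q using Quotient.inductionOn with | _ x
      by_cases hx : r x w
      · refine ⟨⟨⟦u⟧, fun h' => h (Quotient.exact h')⟩, Quotient.sound ?_⟩
        exact (sup_pairSetoid_rel r u w u x).2 (Or.inr (Or.inl ⟨r.refl u, r.symm hx⟩))
      · exact ⟨⟨⟦x⟧, fun h' => hx (Quotient.exact h')⟩, rfl⟩
  rw [← Nat.card_congr (Equiv.ofBijective φ hφ), ← Finite.card_option]
  exact (Nat.card_congr (Equiv.optionSubtypeNe _)).symm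

lemma card_quotient_eq_of_comap {F' : Type*} {r : Setoid F} {r' : Setoid F'} (f : F → F')
    (hf : ∀ x y, r x y ↔ r' (f x) (f y)) (hs : ∀ y, ∃ x, r' y (f x)) :
    Nat.card (Quotient r) = Nat.card (Quotient r') := by
  refine Nat.card_congr (Equiv.ofBijective (Quotient.map' f fun x y h => (hf x y).1 h) ⟨?_, ?_⟩)
  · intro q q' h
    induction q using Quotient.inductionOn with | _ x
    induction q' using Quotient.inductionOn with | _ y
    exact Quotient.sound ((hf x y).2 (Quotient.exact h))
  · intro q
    induction q using Quotient.inductionOn with | _ y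
    obtain ⟨x, hx⟩ := hs y
    exact ⟨⟦x⟧, Quotient.sound (Setoid.symm' _ hx)⟩

/-- Adding corresponding pairs to corresponding equivalence relations preserves the
correspondence. -/
lemma sup_eqvGen_iff_of_comap {F' : Type*} {r : Setoid F} {r' : Setoid F'} {f : F → F'}
    (hf : ∀ x y, r x y ↔ r' (f x) (f y)) (hs : ∀ y, ∃ x, r' y (f x))
    {g : F → F → Prop} {g' : F' → F' → Prop} (hg : ∀ x y, g x y → g' (f x) (f y))
    (hg' : ∀ y z, g' y z → r' y z ∨ ∃ x w, y = f x ∧ z = f w ∧ g x w) (x y : F) :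
    (r ⊔ Relation.EqvGen.setoid g) x y ↔ (r' ⊔ Relation.EqvGen.setoid g') (f x) (f y) := by
  constructor
  · have h : r ⊔ Relation.EqvGen.setoid g ≤
        Setoid.comap f (r' ⊔ Relation.EqvGen.setoid g') := by
      refine sup_le (fun x y h => ?_) (Setoid.eqvGen_le fun x y h => ?_)
      · exact (le_sup_left : r' ≤ _) ((hf x y).1 h)
      · exact (le_sup_right : Relation.EqvGen.setoid g' ≤ _) (.rel _ _ (hg x y h))
    exact fun h' => h h'
  -- `k` is a section of `f` up to `r'`; pulling back along it gives the converse inclusion.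
  · choose k hk using hs
    have hk' : ∀ x, r (k (f x)) x := fun x => (hf _ _).2 (r'.symm (hk (f x)))
    have hle : r ≤ r ⊔ Relation.EqvGen.setoid g := le_sup_left
    have h : r' ⊔ Relation.EqvGen.setoid g' ≤
        Setoid.comap k (r ⊔ Relation.EqvGen.setoid g) := by
      have h1 : r' ≤ Setoid.comap k (r ⊔ Relation.EqvGen.setoid g) := fun y z h =>
        hle ((hf _ _).2 (r'.trans (r'.symm (hk y)) (r'.trans h (hk z))))
      refine sup_le h1 (Setoid.eqvGen_le fun y z h => ?_)
      rcases hg' y z h with h | ⟨x, w, rfl, rfl, hxw⟩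
      · exact h1 h
      · have h2 : (r ⊔ Relation.EqvGen.setoid g) x w :=
          (le_sup_right : Relation.EqvGen.setoid g ≤ _) (.rel _ _ hxw)
        have h3 : (r ⊔ Relation.EqvGen.setoid g) (k (f x)) (k (f w)) :=
          Setoid.trans' _ (hle (hk' x)) (Setoid.trans' _ h2 (hle (r.symm (hk' w))))
        exact h3
    intro h'
    exact Setoid.trans' _ (hle (r.symm (hk' x))) (Setoid.trans' _ (h h') (hle (hk' y)))

end Counting

/-! ## States -/

namespace RibbonGraph

variable {G : RibbonGraph}

/-- A set of flags that is a union of rectangles `x, endInv x, sideInv (endInv x), sideInv x`. -/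
structure IsStable (G : RibbonGraph) (X : Set G.Flag) : Prop where
  endInv_mem : ∀ x ∈ X, G.endInv x ∈ X
  sideInv_mem : ∀ x ∈ X, G.sideInv x ∈ X

lemma IsStable.endInv_mem_iff {X : Set G.Flag} (hX : G.IsStable X) {x : G.Flag} :
    G.endInv x ∈ X ↔ x ∈ X :=
  ⟨fun h => by simpa [G.endInv_invol] using hX.endInv_mem _ h, hX.endInv_mem x⟩

lemma IsStable.sideInv_mem_iff {X : Set G.Flag} (hX : G.IsStable X) {x : G.Flag} :
    G.sideInv x ∈ X ↔ x ∈ X :=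
  ⟨fun h => by simpa [G.sideInv_invol] using hX.sideInv_mem _ h, hX.sideInv_mem x⟩

lemma isStable_corners (x : G.Flag) : G.IsStable (G.corners x) := by
  constructor <;>
  · intro _ hy
    simp only [corners, Set.mem_insert_iff, Set.mem_singleton_iff] at hy ⊢
    rcases hy with rfl | rfl | rfl | rfl <;> simp [G.endInv_invol, G.sideInv_invol, G.comm]

lemma isStable_empty : G.IsStable ∅ := ⟨by simp, by simp⟩

lemma IsStable.union {X Y : Set G.Flag} (hX : G.IsStable X) (hY : G.IsStable Y) :
    G.IsStable (X ∪ Y) :=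
  ⟨fun x h => h.imp (hX.1 x) (hY.1 x), fun x h => h.imp (hX.2 x) (hY.2 x)⟩

lemma IsStable.compl {X : Set G.Flag} (hX : G.IsStable X) : G.IsStable Xᶜ :=
  ⟨fun _ h h' => h (hX.endInv_mem_iff.1 h'), fun _ h h' => h (hX.sideInv_mem_iff.1 h')⟩

lemma IsStable.diff {X Y : Set G.Flag} (hX : G.IsStable X) (hY : G.IsStable Y) :
    G.IsStable (X \ Y) :=
  ⟨fun x h => ⟨hX.1 x h.1, hY.compl.1 x h.2⟩, fun x h => ⟨hX.2 x h.1, hY.compl.2 x h.2⟩⟩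

lemma self_mem_corners (x : G.Flag) : x ∈ G.corners x := Or.inl rfl

lemma endInv_mem_corners (x : G.Flag) : G.endInv x ∈ G.corners x := Or.inr (Or.inl rfl)

lemma sideInv_mem_corners (x : G.Flag) : G.sideInv x ∈ G.corners x := Or.inr (Or.inr (Or.inl rfl))

lemma endInv_sideInv_mem_corners (x : G.Flag) : G.endInv (G.sideInv x) ∈ G.corners x :=
  Or.inr (Or.inr (Or.inr rfl))

lemma IsStable.corners_subset {X : Set G.Flag} (hX : G.IsStable X) {x : G.Flag} (hx : x ∈ X) :
    G.corners x ⊆ X := by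
  rintro _ (rfl | rfl | rfl | rfl)
  exacts [hx, hX.1 _ hx, hX.2 _ hx, hX.1 _ (hX.2 _ hx)]

lemma mem_corners_comm {x y : G.Flag} (h : y ∈ G.corners x) : x ∈ G.corners y := by
  rcases h with rfl | rfl | rfl | rfl
  · exact self_mem_corners _
  · simpa [G.endInv_invol] using endInv_mem_corners (G.endInv x)
  · simpa [G.sideInv_invol] using sideInv_mem_corners (G.sideInv x)
  · have := endInv_sideInv_mem_corners (G.endInv (G.sideInv x))
    rwa [← G.comm, G.endInv_invol, G.sideInv_invol] at this

lemma corners_eq_of_mem {x y : G.Flag} (h : y ∈ G.corners x) : G.corners y = G.corners x :=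
  ((isStable_corners x).corners_subset h).antisymm
    ((isStable_corners y).corners_subset (mem_corners_comm h))

open Classical in
/-- The involution which runs along the free sides of the edges in a state `X` and across the
attaching arcs of the other edges. -/
def stateInv (G : RibbonGraph) (X : Set G.Flag) (x : G.Flag) : G.Flag :=
  if x ∈ X then G.sideInv x else G.endInv x

lemma stateInv_of_mem {X : Set G.Flag} {x : G.Flag} (h : x ∈ X) :
    G.stateInv X x = G.sideInv x := if_pos h

lemma stateInv_of_notMem {X : Set G.Flag} {x : G.Flag} (h : x ∉ X) :
    G.stateInv X x = G.endInv x := if_neg h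

/-- Two flags are related if they lie on the same boundary component of the spanning ribbon
subgraph with the edges in `X`. -/
def curves (G : RibbonGraph) (X : Set G.Flag) : Setoid G.Flag :=
  Relation.EqvGen.setoid fun x y => y = G.stateInv X x ∨ y = G.arcInv x

lemma stateInv_mem {X Y : Set G.Flag} (hY : G.IsStable Y) {x : G.Flag} (hx : x ∈ Y) :
    G.stateInv X x ∈ Y := by
  by_cases h : x ∈ X
  · rw [stateInv_of_mem h]; exact hY.2 x hx
  · rw [stateInv_of_notMem h]; exact hY.1 x hx

lemma stateInv_invol {X : Set G.Flag} (hX : G.IsStable X) :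
    Function.Involutive (G.stateInv X) := by
  intro x
  by_cases h : x ∈ X
  · rw [stateInv_of_mem h, stateInv_of_mem (hX.2 x h), G.sideInv_invol]
  · rw [stateInv_of_notMem h, stateInv_of_notMem (hX.compl.1 x h), G.endInv_invol]

lemma stateInv_ne (X : Set G.Flag) (x : G.Flag) : G.stateInv X x ≠ x := by
  by_cases h : x ∈ X
  · rw [stateInv_of_mem h]; exact G.sideInv_ne x
  · rw [stateInv_of_notMem h]; exact G.endInv_ne x

lemma curves_stateInv (X : Set G.Flag) (x : G.Flag) : G.curves X x (G.stateInv X x) :=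
  .rel _ _ (Or.inl rfl)

lemma curves_arcInv (X : Set G.Flag) (x : G.Flag) : G.curves X x (G.arcInv x) :=
  .rel _ _ (Or.inr rfl)

/-- At a flag with `endInv x = sideInv x` both choices of `stateInv` agree, so a state matters only
at the corners of edges. -/
lemma curves_congr {X Y : Set G.Flag}
    (h : ∀ x, G.endInv x ≠ G.sideInv x → (x ∈ X ↔ x ∈ Y)) : G.curves X = G.curves Y := by
  have : G.stateInv X = G.stateInv Y := by
    funext x
    by_cases hx : G.endInv x = G.sideInv x
    · simp [stateInv, hx]
    · by_cases hxX : x ∈ X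
      · rw [stateInv_of_mem hxX, stateInv_of_mem ((h x hx).1 hxX)]
      · rw [stateInv_of_notMem hxX, stateInv_of_notMem fun h' => hxX ((h x hx).2 h')]
  rw [curves, curves, this]

lemma curves_empty : G.curves ∅ = G.vertexRel := by
  have : G.stateInv ∅ = G.endInv := by
    funext x
    simp [stateInv]
  rw [curves, this]
  rfl

lemma curves_univ : G.curves Set.univ = G.boundaryRel := by
  have : G.stateInv Set.univ = G.sideInv := by
    funext x
    simp [stateInv]
  rw [curves, this]
  rfl

/-- Duality swaps `endInv` and `sideInv`, which amounts to complementing the state. -/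
lemma stateInv_dual (X : Set G.Flag) (x : G.Flag) :
    G.dual.stateInv X x = G.stateInv Xᶜ x := by
  by_cases h : x ∈ X
  · exact (stateInv_of_mem (G := G.dual) h).trans
      (stateInv_of_notMem (Set.notMem_compl_iff.2 h)).symm
  · exact (stateInv_of_notMem (G := G.dual) h).trans (stateInv_of_mem h).symm

lemma curves_dual (X : Set G.Flag) : G.dual.curves X = G.curves Xᶜ := by
  have : G.dual.stateInv X = G.stateInv Xᶜ := by
    funext x
    exact stateInv_dual X x
  change (Relation.EqvGen.setoid fun x y => y = G.dual.stateInv X x ∨ y = G.arcInv x) = _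
  rw [this]
  rfl

lemma corners_dual (x : G.Flag) : G.dual.corners x = G.corners x := by
  ext y
  change y = _ ∨ y = _ ∨ y = _ ∨ y = G.sideInv (G.endInv x) ↔ y = _ ∨ y = _ ∨ y = _ ∨ y = _
  rw [G.comm]
  tauto

/-! ### The effect of one edge -/

section OneEdge

variable {X : Set G.Flag} (hX : G.IsStable X) {x : G.Flag} (hx : G.endInv x ≠ G.sideInv x)
  (hxX : x ∉ X)

/-- The corners `u` and `w` of the edge at `x` are joined by an arc of the boundary of the state `X`
that does not meet the edge. -/
def Joined (G : RibbonGraph) (X : Set G.Flag) (x u w : G.Flag) : Prop :=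
  GapReach G.arcInv (G.stateInv X) (G.corners x) (G.arcInv u) w

include hX in
lemma Joined.symm {u w : G.Flag} (h : G.Joined X x u w) (hw : w ∈ G.corners x) :
    G.Joined X x w u :=
  GapReach.reverse G.arcInv_invol (stateInv_invol hX) (fun _ => stateInv_mem (isStable_corners x))
    h hw

lemma Joined.unique {u w w' : G.Flag} (h : G.Joined X x u w) (h' : G.Joined X x u w')
    (hw : w ∈ G.corners x) (hw' : w' ∈ G.corners x) : w = w' :=
  GapReach.unique h h' hw hw'

include hX in
lemma exists_joined {u : G.Flag} (hu : u ∈ G.corners x) :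
    ∃ w ∈ G.corners x, w ≠ u ∧ G.Joined X x u w := by
  obtain ⟨w, hw, h⟩ := exists_gapReach G.arcInv_invol (stateInv_invol hX)
    (fun _ => stateInv_mem (isStable_corners x)) hu
  exact ⟨w, hw, h.ne G.arcInv_invol (stateInv_invol hX) G.arcInv_ne (stateInv_ne X), h⟩

-- Being joined pairs up the four corners without fixed points: once two are paired, so are the
-- others.
include hX in
lemma joined_other {u v w z : G.Flag} (h : ∀ y, y ∈ G.corners x ↔ y = u ∨ y = v ∨ y = w ∨ y = z)
    (huv : G.Joined X x u v) (hne : u ≠ w ∧ v ≠ w) : G.Joined X x w z := by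
  have hv : v ∈ G.corners x := (h v).2 (by simp)
  have hw : w ∈ G.corners x := (h w).2 (by simp)
  have hu : u ∈ G.corners x := (h u).2 (by simp)
  obtain ⟨y, hy, hyw, hj⟩ := exists_joined hX hw
  rcases (h y).1 hy with rfl | rfl | rfl | rfl
  · exact absurd ((hj.symm hX hy).unique huv hw hv) hne.2.symm
  · exact absurd ((hj.symm hX hy).unique (huv.symm hX hv) hw hu) hne.1.symm
  · exact absurd rfl hyw
  · exact hj

lemma endInv_sideInv_ne (hx : G.endInv x ≠ G.sideInv x) : G.endInv (G.sideInv x) ≠ x := fun h =>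
  hx (by rw [← h, G.endInv_invol, h])

include hX hx in
/-- The three ways in which the corners of an edge can be joined. -/
lemma joined_cases :
    (G.Joined X x x (G.endInv x) ∧ G.Joined X x (G.sideInv x) (G.endInv (G.sideInv x))) ∨
    (G.Joined X x x (G.sideInv x) ∧ G.Joined X x (G.endInv x) (G.endInv (G.sideInv x))) ∨
    (G.Joined X x x (G.endInv (G.sideInv x)) ∧ G.Joined X x (G.endInv x) (G.sideInv x)) := by
  obtain ⟨y, hy, hyx, hj⟩ := exists_joined hX (self_mem_corners x)
  rcases hy with rfl | rfl | rfl | rfl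
  · exact absurd rfl hyx
  · exact Or.inl ⟨hj, joined_other hX (fun y => Iff.rfl) hj ⟨(G.sideInv_ne x).symm, hx⟩⟩
  · refine Or.inr (Or.inl ⟨hj, joined_other hX (fun y => ?_) hj ⟨(G.endInv_ne x).symm, hx.symm⟩⟩)
    change y = _ ∨ y = _ ∨ y = _ ∨ y = _ ↔ _
    tauto
  · refine Or.inr (Or.inr ⟨hj, joined_other hX (fun y => ?_) hj ⟨(G.endInv_ne x).symm, ?_⟩⟩)
    · change y = _ ∨ y = _ ∨ y = _ ∨ y = _ ↔ _
      tauto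
    · exact fun h => G.sideInv_ne x (by simpa [G.endInv_invol] using congrArg G.endInv h)

/-- Two flags are related if they are joined by an arc of the boundary of the state `X` that does
not meet the edge at `x`. -/
def outside (G : RibbonGraph) (X : Set G.Flag) (x : G.Flag) : Setoid G.Flag :=
  Relation.EqvGen.setoid fun y z => (y ∉ G.corners x ∧ z = G.stateInv X y) ∨ z = G.arcInv y

lemma Joined.outside {u w : G.Flag} (h : G.Joined X x u w) : G.outside X x u w := by
  have h1 : G.outside X x u (G.arcInv u) := .rel _ _ (Or.inr rfl)
  have h2 : G.outside X x (G.arcInv u) w := by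
    unfold Joined at h
    induction h with
    | refl => exact (G.outside X x).refl _
    | tail _ h ih =>
      obtain ⟨h, rfl⟩ := h
      exact (G.outside X x).trans ih ((G.outside X x).trans
        (.rel _ _ (Or.inl ⟨h, rfl⟩)) (.rel _ _ (Or.inr rfl)))
  exact (G.outside X x).trans h1 h2

include hX in
lemma not_outside {u v w : G.Flag} (h : G.Joined X x u v) (hu : u ∈ G.corners x)
    (hv : v ∈ G.corners x) (hw : w ∈ G.corners x) (hne : w ≠ u ∧ w ≠ v) :
    ¬ G.outside X x u w := by
  intro h'
  rcases gapReach_of_eqvGen G.arcInv_invol (stateInv_invol hX)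
    (fun _ => stateInv_mem (isStable_corners x)) hu hw h' with rfl | h'
  · exact hne.1 rfl
  · exact hne.2 (Joined.unique h' h hw hv)

lemma outside_congr {Y : Set G.Flag} (h : ∀ y, y ∉ G.corners x → (y ∈ X ↔ y ∈ Y)) :
    G.outside X x = G.outside Y x := by
  refine le_antisymm (Setoid.eqvGen_le ?_) (Setoid.eqvGen_le ?_) <;>
  · rintro y z (⟨hy, rfl⟩ | rfl)
    · refine .rel _ _ (Or.inl ⟨hy, ?_⟩)
      by_cases hyX : y ∈ X
      · rw [stateInv_of_mem hyX, stateInv_of_mem ((h y hy).1 hyX)]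
      · rw [stateInv_of_notMem hyX, stateInv_of_notMem fun h' => hyX ((h y hy).2 h')]
    · exact .rel _ _ (Or.inr rfl)

-- As `X` does not contain the edge, its curves are made of the arcs outside the edge and the two
-- attaching arcs.
include hX hxX in
lemma curves_eq_outside : G.curves X = G.outside X x ⊔ pairSetoid x (G.endInv x) ⊔
    pairSetoid (G.sideInv x) (G.endInv (G.sideInv x)) := by
  have h1 : ∀ y ∈ G.corners x, y ∉ X := fun y hy h =>
    hxX (hX.corners_subset h (mem_corners_comm hy))
  apply le_antisymm
  · set s := G.outside X x ⊔ pairSetoid x (G.endInv x) ⊔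
      pairSetoid (G.sideInv x) (G.endInv (G.sideInv x)) with hs
    have hO : G.outside X x ≤ s := le_sup_left.trans le_sup_left
    have hp : s x (G.endInv x) :=
      (le_sup_right.trans le_sup_left : pairSetoid x (G.endInv x) ≤ s) (pairSetoid_rel_self _ _)
    have hq : s (G.sideInv x) (G.endInv (G.sideInv x)) :=
      (le_sup_right : pairSetoid (G.sideInv x) _ ≤ s) (pairSetoid_rel_self _ _)
    refine Setoid.eqvGen_le ?_
    rintro y z (rfl | rfl)
    · by_cases hy : y ∈ G.corners x
      · rw [stateInv_of_notMem (h1 y hy)]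
        rcases hy with rfl | rfl | rfl | rfl
        · exact hp
        · rw [G.endInv_invol]; exact s.symm hp
        · exact hq
        · rw [G.endInv_invol]; exact s.symm hq
      · exact hO (.rel _ _ (Or.inl ⟨hy, rfl⟩))
    · exact hO (.rel _ _ (Or.inr rfl))
  · refine sup_le (sup_le (Setoid.eqvGen_le ?_) (pairSetoid_le ?_)) (pairSetoid_le ?_)
    · rintro y z (⟨-, rfl⟩ | rfl)
      · exact curves_stateInv X y
      · exact curves_arcInv X y
    · have := curves_stateInv X x
      rwa [stateInv_of_notMem hxX] at this
    · have := curves_stateInv X (G.sideInv x)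
      rwa [stateInv_of_notMem (h1 _ (sideInv_mem_corners x))] at this

-- This is `curves_eq_outside` for the dual: there the complementary state omits the edge, and the
-- free sides play the part of the attaching arcs.
include hX in
lemma curves_union_eq_outside : G.curves (X ∪ G.corners x) =
    G.outside X x ⊔ pairSetoid x (G.sideInv x) ⊔
    pairSetoid (G.endInv x) (G.endInv (G.sideInv x)) := by
  have hY : G.dual.IsStable (X ∪ G.corners x)ᶜ :=
    ⟨(hX.union (isStable_corners x)).compl.2, (hX.union (isStable_corners x)).compl.1⟩
  have hc := corners_dual x
  have hxY : x ∉ (X ∪ G.corners x)ᶜ := fun h => h (Or.inr (self_mem_corners x))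
  have h := (curves_dual (X ∪ G.corners x)ᶜ).symm.trans (curves_eq_outside hY hxY)
  rw [compl_compl] at h
  rw [h]
  have ho : G.dual.outside (X ∪ G.corners x)ᶜ x = G.outside X x := by
    have : G.dual.stateInv (X ∪ G.corners x)ᶜ = G.stateInv (X ∪ G.corners x) := by
      funext y
      exact (stateInv_dual (X ∪ G.corners x)ᶜ y).trans (by rw [compl_compl])
    rw [outside_congr (X := X) (Y := X ∪ G.corners x) fun y hy => by simp [hy]]
    change (Relation.EqvGen.setoid fun y z => (y ∉ G.dual.corners x ∧
      z = G.dual.stateInv (X ∪ G.corners x)ᶜ y) ∨ z = G.arcInv y) = _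
    rw [this, hc]
    rfl
  rw [ho, G.comm]
  rfl

/-- The number of boundary components of the spanning ribbon subgraph with the edges in `X`. -/
def numCurves (G : RibbonGraph) (X : Set G.Flag) : ℕ := Nat.card (Quotient (G.curves X))

include hX hx hxX in
/-- Adding an edge to a state merges two curves, or splits a curve, or reconnects a curve. -/
theorem curves_step :
    (¬ G.curves X x (G.sideInv x) ∧ G.curves (X ∪ G.corners x) x (G.endInv x) ∧
      G.numCurves X = G.numCurves (X ∪ G.corners x) + 1 ∧ G.Joined X x x (G.endInv x) ∧
      G.Joined X x (G.sideInv x) (G.endInv (G.sideInv x))) ∨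
    (G.curves X x (G.sideInv x) ∧ ¬ G.curves (X ∪ G.corners x) x (G.endInv x) ∧
      G.numCurves (X ∪ G.corners x) = G.numCurves X + 1 ∧ G.Joined X x x (G.sideInv x) ∧
      G.Joined X x (G.endInv x) (G.endInv (G.sideInv x))) ∨
    (G.curves X x (G.sideInv x) ∧ G.curves (X ∪ G.corners x) x (G.endInv x) ∧
      G.numCurves X = G.numCurves (X ∪ G.corners x) ∧
      G.Joined X x x (G.endInv (G.sideInv x)) ∧ G.Joined X x (G.endInv x) (G.sideInv x)) := by
  have hp := self_mem_corners x
  have hq := endInv_mem_corners x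
  have hr := sideInv_mem_corners x
  have ht := endInv_sideInv_mem_corners x
  have hrt := endInv_sideInv_ne hx
  have eX := curves_eq_outside hX hxX
  have eX' := curves_union_eq_outside hX (x := x)
  unfold numCurves
  rw [eX, eX']
  set O := G.outside X x with hO
  have tr : ∀ (s : Setoid G.Flag) {a b c : G.Flag}, s a b → s b c → s a c :=
    fun s _ _ _ h h' => s.trans h h'
  have hpair : ∀ (u w : G.Flag), (O ⊔ pairSetoid u w) u w := fun u w =>
    (le_sup_right : pairSetoid u w ≤ _) (pairSetoid_rel_self u w)
  have hl : ∀ (u w : G.Flag), O ≤ O ⊔ pairSetoid u w := fun u w => le_sup_left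
  rcases joined_cases hX hx with ⟨h1, h2⟩ | ⟨h1, h2⟩ | ⟨h1, h2⟩
  -- Each end of the edge closes up to a curve of its own, and the free sides merge these two
  -- curves.
  · have hn := not_outside hX h1 hp hq hr ⟨G.sideInv_ne x, hx.symm⟩
    have o1 := h1.outside
    have o2 := h2.outside
    rw [sup_pairSetoid_of_rel o1, sup_pairSetoid_of_rel o2, sup_pairSetoid_of_rel
      (tr _ (hl _ _ (O.symm o1)) (tr _ (hpair x (G.sideInv x)) (hl _ _ o2)))]
    exact Or.inl ⟨hn, hl _ _ o1, card_quotient_sup_pairSetoid hn, h1, h2⟩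
  -- The mirror case: each free side closes up to a curve of its own, and the attaching arcs join
  -- them to one.
  · have hn := not_outside hX h1 hp hr hq ⟨G.endInv_ne x, hx⟩
    have o1 := h1.outside
    have o2 := h2.outside
    rw [sup_pairSetoid_of_rel o1, sup_pairSetoid_of_rel o2, sup_pairSetoid_of_rel
      (tr _ (hl _ _ (O.symm o1)) (tr _ (hpair x (G.endInv x)) (hl _ _ o2)))]
    exact Or.inr (Or.inl ⟨hl _ _ o1, hn, card_quotient_sup_pairSetoid hn, h1, h2⟩)
  -- The diagonal pairing: there is one curve at the edge both before and after, and either count is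
  -- one less than the number of classes of `O`.
  · have hqt : G.endInv x ≠ G.endInv (G.sideInv x) := fun h =>
      G.sideInv_ne x (by simpa [G.endInv_invol] using (congrArg G.endInv h).symm)
    have hn : ¬ O _ _ := not_outside hX h1 hp ht hq ⟨G.endInv_ne x, hqt⟩
    have hn' : ¬ O _ _ := not_outside hX h1 hp ht hr ⟨G.sideInv_ne x, (G.endInv_ne _).symm⟩
    have o1 := h1.outside
    have o2 := h2.outside
    have e1 : (O ⊔ pairSetoid x (G.endInv x)) (G.sideInv x) (G.endInv (G.sideInv x)) :=
      tr _ (hl _ _ (O.symm o2)) (tr _ (Setoid.symm' _ (hpair _ _)) (hl _ _ o1))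
    have e2 : (O ⊔ pairSetoid x (G.sideInv x)) (G.endInv x) (G.endInv (G.sideInv x)) :=
      tr _ (hl _ _ o2) (tr _ (Setoid.symm' _ (hpair _ _)) (hl _ _ o1))
    rw [sup_pairSetoid_of_rel e1, sup_pairSetoid_of_rel e2]
    refine Or.inr (Or.inr ⟨tr _ (hpair _ _) (hl _ _ o2), tr _ (hpair _ _) (hl _ _ (O.symm o2)),
      ?_, h1, h2⟩)
    have c1 := card_quotient_sup_pairSetoid hn
    have c2 := card_quotient_sup_pairSetoid hn'
    omega

end OneEdge

end RibbonGraph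


/-! ### Twisted edges -/

namespace RibbonGraph

variable {G : RibbonGraph}

lemma curves_iterate (X : Set G.Flag) (n : ℕ) (x : G.Flag) :
    G.curves X x ((fun y => G.arcInv (G.stateInv X y))^[n] x) := by
  induction n with
  | zero => exact (G.curves X).refl x
  | succ n ih =>
    rw [Function.iterate_succ_apply']
    exact (G.curves X).trans ih
      ((G.curves X).trans (curves_stateInv X _) (curves_arcInv X _))

lemma IsStable.notMem_of_mem_corners {X : Set G.Flag} (hX : G.IsStable X) {x y : G.Flag}
    (hxX : x ∉ X) (hy : y ∈ G.corners x) : y ∉ X := fun h =>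
  hxX (hX.corners_subset h (mem_corners_comm hy))

/-- The traversal criterion for a twisted edge in terms of the curves on both of its sides. -/
theorem exists_iterate_iff {X : Set G.Flag} (hX : G.IsStable X) {x : G.Flag}
    (hx : G.endInv x ≠ G.sideInv x) (hxX : x ∉ X) :
    (∃ n : ℕ, (fun y => G.arcInv (G.stateInv X y))^[n] x = G.sideInv x) ↔
      G.curves X x (G.sideInv x) ∧ G.curves (X ∪ G.corners x) x (G.endInv x) := by
  have hp := self_mem_corners x
  have hr := sideInv_mem_corners x
  have ht := endInv_sideInv_mem_corners x
  rcases curves_step hX hx hxX with ⟨h1, -, -⟩ | ⟨-, h2, -, h3, h4⟩ | ⟨h1, h2, -, -, h4⟩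
  · refine iff_of_false ?_ fun h => h1 h.1
    rintro ⟨n, hn⟩
    exact h1 (hn ▸ curves_iterate X n x)
  · refine iff_of_false ?_ fun h => h2 h.2
    -- From `x` the traversal next meets the edge at the diagonally opposite corner, and from there
    -- at `x` again. It never enters the edge at `sideInv x`.
    have hC : ∀ y, (y = x ∨ y = G.endInv (G.sideInv x)) → ∀ z ∈ G.corners x,
        GapReach G.arcInv (G.stateInv X) (G.corners x) (G.arcInv (G.stateInv X y)) z →
        (z = x ∨ z = G.endInv (G.sideInv x)) := by
      rintro _ (rfl | rfl) z hz h
      · rw [stateInv_of_notMem hxX] at h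
        exact Or.inr (Joined.unique h h4 hz ht)
      · rw [stateInv_of_notMem (hX.notMem_of_mem_corners hxX ht), G.endInv_invol] at h
        exact Or.inl (Joined.unique h (h3.symm hX hr) hz hp)
    have key : ∀ n : ℕ, ∃ y, (y = x ∨ y = G.endInv (G.sideInv x)) ∧
        ((fun y => G.arcInv (G.stateInv X y))^[n] x = y ∨
        GapReach G.arcInv (G.stateInv X) (G.corners x) (G.arcInv (G.stateInv X y))
          ((fun y => G.arcInv (G.stateInv X y))^[n] x)) := by
      intro n
      induction n with
      | zero => exact ⟨x, Or.inl rfl, Or.inl rfl⟩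
      | succ n ih =>
        rw [Function.iterate_succ_apply']
        obtain ⟨y, hy, h | h⟩ := ih
        · exact ⟨y, hy, Or.inr (by rw [h])⟩
        · by_cases hz : (fun y => G.arcInv (G.stateInv X y))^[n] x ∈ G.corners x
          · exact ⟨_, hC y hy _ hz h, Or.inr .refl⟩
          · exact ⟨y, hy, Or.inr (h.tail ⟨hz, rfl⟩)⟩
    rintro ⟨n, hn⟩
    obtain ⟨y, hy, h⟩ := key n
    rw [hn] at h
    have : G.sideInv x = x ∨ G.sideInv x = G.endInv (G.sideInv x) := by
      rcases h with h | h
      · exact hy.imp h.trans h.trans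
      · exact hC y hy _ hr h
    rcases this with h | h
    · exact G.sideInv_ne x h
    · exact G.endInv_ne _ h.symm
  · refine iff_of_true ?_ ⟨h1, h2⟩
    -- The outside arc from `endInv x` ends at `sideInv x`; the additional iteration crosses the
    -- attaching arc at `x`.
    obtain ⟨n, hn⟩ := GapReach.exists_iterate h4
    refine ⟨n + 1, ?_⟩
    rw [Function.iterate_succ_apply, stateInv_of_notMem hxX]
    exact hn

/-- Lets any corner stand for its edge: `r` identifies the two corners at each end, so all four
compare the same two classes. -/
lemma rel_sideInv_iff_of_mem_corners {r : Setoid G.Flag} {x y : G.Flag}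
    (hr : ∀ z ∈ G.corners x, r z (G.endInv z)) (hy : y ∈ G.corners x) :
    r y (G.sideInv y) ↔ r x (G.sideInv x) := by
  have h1 := hr _ (self_mem_corners x)
  have h2 := hr _ (sideInv_mem_corners x)
  rcases hy with rfl | rfl | rfl | rfl
  · rfl
  · rw [← G.comm]
    exact ⟨fun h => r.trans h1 (r.trans h (r.symm h2)),
      fun h => r.trans (r.symm h1) (r.trans h h2)⟩
  · rw [G.sideInv_invol]
    exact ⟨fun h => r.symm h, fun h => r.symm h⟩
  · rw [← G.comm, G.sideInv_invol]
    exact ⟨fun h => r.symm (r.trans h2 (r.trans h (r.symm h1))),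
      fun h => r.symm (r.trans (r.symm h1) (r.trans h h2))⟩

lemma rel_endInv_iff_of_mem_corners {r : Setoid G.Flag} {x y : G.Flag}
    (hr : ∀ z ∈ G.corners x, r z (G.sideInv z)) (hy : y ∈ G.corners x) :
    r y (G.endInv y) ↔ r x (G.endInv x) :=
  rel_sideInv_iff_of_mem_corners (G := G.dual) (r := r)
    (fun z hz => hr z ((corners_dual x) ▸ hz)) ((corners_dual x).symm ▸ hy)

/-! ### Edges and sets of edges in terms of corners -/

/-- The corners of all edges. -/
def edgeFlags (G : RibbonGraph) : Set G.Flag := {x | G.endInv x ≠ G.sideInv x}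

lemma isStable_edgeFlags : G.IsStable G.edgeFlags := by
  constructor
  · intro x hx h
    refine hx ?_
    rw [G.endInv_invol, ← G.comm] at h
    rw [h, G.endInv_invol, ← h]
  · intro x hx h
    refine hx ?_
    rw [G.sideInv_invol] at h
    rw [← h, G.endInv_invol, h]

lemma Edge.exists_eq_corners (e : G.Edge) : ∃ x ∈ G.edgeFlags, e.1 = G.corners x := by
  obtain ⟨S, x, hx, rfl⟩ := e
  exact ⟨x, hx, rfl⟩

/-- The edge with a given corner. -/
def edgeAt (x : G.Flag) (hx : x ∈ G.edgeFlags) : G.Edge := ⟨G.corners x, x, hx, rfl⟩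

lemma Edge.eq_corners (e : G.Edge) {x : G.Flag} (hx : x ∈ e.1) : e.1 = G.corners x := by
  obtain ⟨S, y, hy, rfl⟩ := e
  exact (corners_eq_of_mem hx).symm

lemma Edge.mem_edgeFlags (e : G.Edge) {x : G.Flag} (hx : x ∈ e.1) : x ∈ G.edgeFlags := by
  obtain ⟨S, y, hy, rfl⟩ := e
  exact isStable_edgeFlags.corners_subset hy hx

lemma cornersOf_singleton (e : G.Edge) : G.cornersOf {e} = e.1 := by
  ext x
  exact ⟨by rintro ⟨_, rfl, h⟩; exact h, fun h => ⟨e, rfl, h⟩⟩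

lemma cornersOf_compl_singleton (e : G.Edge) : G.cornersOf {e}ᶜ = G.edgeFlags \ e.1 := by
  ext x
  constructor
  · rintro ⟨f, hf, hx⟩
    refine ⟨f.mem_edgeFlags hx, fun h => hf (Subtype.ext ?_)⟩
    rw [f.eq_corners hx, e.eq_corners h]
  · rintro ⟨hx, hxe⟩
    refine ⟨edgeAt x hx, fun h => hxe ?_, self_mem_corners x⟩
    rw [← h]
    exact self_mem_corners x

lemma isStable_cornersOf (A : Set G.Edge) : G.IsStable (G.cornersOf A) :=
  ⟨fun _ => cornersOf_endInv, fun _ => cornersOf_sideInv⟩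

lemma isEmpty_edge_iff : IsEmpty G.Edge ↔ G.edgeFlags = ∅ := by
  rw [Set.eq_empty_iff_forall_notMem]
  constructor
  · exact fun h x hx => h.false (edgeAt x hx)
  · refine fun h => ⟨fun e => ?_⟩
    obtain ⟨x, hx, -⟩ := e.exists_eq_corners
    exact h x hx

/-- This is why the number of edges in a state is its cardinality divided by `4`. -/
lemma ncard_corners {x : G.Flag} (hx : x ∈ G.edgeFlags) : (G.corners x).ncard = 4 := by
  have h1 : x ≠ G.endInv x := (G.endInv_ne x).symm
  have h2 : x ≠ G.sideInv x := (G.sideInv_ne x).symm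
  have h3 : x ≠ G.endInv (G.sideInv x) := (endInv_sideInv_ne hx).symm
  have h4 : G.endInv x ≠ G.endInv (G.sideInv x) := fun h =>
    h2 (by simpa [G.endInv_invol] using congrArg G.endInv h)
  have h5 : G.sideInv x ≠ G.endInv (G.sideInv x) := (G.endInv_ne _).symm
  unfold corners
  rw [Set.ncard_insert_of_notMem (by simp [h1, h2, h3]),
    Set.ncard_insert_of_notMem (by simp [h4]; exact hx), Set.ncard_pair h5]

/-- The sets of corners of the sets of edges. -/
structure IsState (G : RibbonGraph) (X : Set G.Flag) : Prop extends G.IsStable X where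
  subset : X ⊆ G.edgeFlags

lemma isState_empty : G.IsState ∅ := ⟨isStable_empty, by simp⟩

lemma isState_edgeFlags : G.IsState G.edgeFlags := ⟨isStable_edgeFlags, subset_rfl⟩

lemma Edge.isStable (e : G.Edge) : G.IsStable e.1 := by
  obtain ⟨x, -, h⟩ := e.exists_eq_corners
  rw [h]
  exact isStable_corners x

lemma Edge.isState (e : G.Edge) : G.IsState e.1 := ⟨e.isStable, fun _ => e.mem_edgeFlags⟩

lemma IsState.union {X Y : Set G.Flag} (hX : G.IsState X) (hY : G.IsState Y) :
    G.IsState (X ∪ Y) :=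
  ⟨hX.toIsStable.union hY.toIsStable, Set.union_subset hX.subset hY.subset⟩

lemma IsState.diff {X Y : Set G.Flag} (hX : G.IsState X) (hY : G.IsState Y) :
    G.IsState (X \ Y) :=
  ⟨hX.toIsStable.diff hY.toIsStable, Set.sdiff_subset.trans hX.subset⟩

/-! ### Curves in minors -/

/-- At a deleted edge both involutions cross the attaching arc, as if the edge were absent from the
state. Dually, a contracted edge behaves as if it were present. -/
lemma stateInv_delete (A : Set G.Edge) (X : Set G.Flag) (x : G.Flag) :
    (G.delete A).stateInv X x = G.stateInv (X \ G.cornersOf A) x := by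
  by_cases hx : x ∈ X
  · refine (stateInv_of_mem (G := G.delete A) hx).trans ?_
    by_cases hA : x ∈ G.cornersOf A
    · rw [stateInv_of_notMem fun h : x ∈ X \ G.cornersOf A => h.2 hA]
      exact if_pos hA
    · rw [stateInv_of_mem (show x ∈ X \ G.cornersOf A from ⟨hx, hA⟩)]
      exact if_neg hA
  · refine (stateInv_of_notMem (G := G.delete A) hx).trans ?_
    rw [stateInv_of_notMem fun h : x ∈ X \ G.cornersOf A => hx h.1]
    rfl

lemma stateInv_contract (A : Set G.Edge) (X : Set G.Flag) (x : G.Flag) :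
    (G.contract A).stateInv X x = G.stateInv (X ∪ G.cornersOf A) x := by
  by_cases hx : x ∈ X
  · refine (stateInv_of_mem (G := G.contract A) hx).trans ?_
    rw [stateInv_of_mem (Or.inl hx)]
    rfl
  · refine (stateInv_of_notMem (G := G.contract A) hx).trans ?_
    by_cases hA : x ∈ G.cornersOf A
    · rw [stateInv_of_mem (Or.inr hA)]
      exact if_pos hA
    · rw [stateInv_of_notMem fun h => h.elim hx hA]
      exact if_neg hA

lemma curves_delete (A : Set G.Edge) (X : Set G.Flag) :
    (G.delete A).curves X = G.curves (X \ G.cornersOf A) := by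
  have : (G.delete A).stateInv X = G.stateInv (X \ G.cornersOf A) :=
    funext (stateInv_delete A X)
  change (Relation.EqvGen.setoid fun x y => y = (G.delete A).stateInv X x ∨ y = G.arcInv x) = _
  rw [this]
  rfl

lemma curves_contract (A : Set G.Edge) (X : Set G.Flag) :
    (G.contract A).curves X = G.curves (X ∪ G.cornersOf A) := by
  have : (G.contract A).stateInv X = G.stateInv (X ∪ G.cornersOf A) :=
    funext (stateInv_contract A X)
  change (Relation.EqvGen.setoid fun x y => y = (G.contract A).stateInv X x ∨ y = G.arcInv x) = _
  rw [this]
  rfl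

open Classical in
lemma edgeFlags_delete (A : Set G.Edge) :
    (G.delete A).edgeFlags = G.edgeFlags \ G.cornersOf A := by
  refine Set.ext fun (x : G.Flag) => (?_ :
    (G.endInv x ≠ if x ∈ G.cornersOf A then G.endInv x else G.sideInv x) ↔
      G.endInv x ≠ G.sideInv x ∧ x ∉ G.cornersOf A)
  by_cases hA : x ∈ G.cornersOf A <;> simp [hA]

open Classical in
lemma edgeFlags_contract (A : Set G.Edge) :
    (G.contract A).edgeFlags = G.edgeFlags \ G.cornersOf A := by
  refine Set.ext fun (x : G.Flag) => (?_ :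
    (if x ∈ G.cornersOf A then G.sideInv x else G.endInv x) ≠ G.sideInv x ↔
      G.endInv x ≠ G.sideInv x ∧ x ∉ G.cornersOf A)
  by_cases hA : x ∈ G.cornersOf A <;> simp [hA]

open Classical in
lemma isState_delete (A : Set G.Edge) (X : Set G.Flag) :
    (G.delete A).IsState X ↔ G.IsState X ∧ Disjoint X (G.cornersOf A) := by
  constructor
  · rintro ⟨⟨h1, h2⟩, h3⟩
    rw [edgeFlags_delete] at h3
    refine ⟨⟨⟨h1, fun x hx => ?_⟩, h3.trans Set.sdiff_subset⟩,
      Set.disjoint_left.2 fun x hx => (h3 hx).2⟩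
    have : (if x ∈ G.cornersOf A then G.endInv x else G.sideInv x) ∈ X := h2 x hx
    rwa [if_neg (h3 hx).2] at this
  · rintro ⟨h, hd⟩
    refine ⟨⟨h.1.1, fun (x : G.Flag) hx => ?_⟩, ?_⟩
    · change (if x ∈ G.cornersOf A then G.endInv x else G.sideInv x) ∈ X
      rw [if_neg (Set.disjoint_left.1 hd hx)]
      exact h.1.2 x hx
    · rw [edgeFlags_delete]
      exact fun x hx => ⟨h.2 hx, Set.disjoint_left.1 hd hx⟩

open Classical in
lemma isState_contract (A : Set G.Edge) (X : Set G.Flag) :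
    (G.contract A).IsState X ↔ G.IsState X ∧ Disjoint X (G.cornersOf A) := by
  constructor
  · rintro ⟨⟨h1, h2⟩, h3⟩
    rw [edgeFlags_contract] at h3
    refine ⟨⟨⟨fun x hx => ?_, h2⟩, h3.trans Set.sdiff_subset⟩,
      Set.disjoint_left.2 fun x hx => (h3 hx).2⟩
    have : (if x ∈ G.cornersOf A then G.sideInv x else G.endInv x) ∈ X := h1 x hx
    rwa [if_neg (h3 hx).2] at this
  · rintro ⟨h, hd⟩
    refine ⟨⟨fun (x : G.Flag) hx => ?_, h.1.2⟩, ?_⟩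
    · change (if x ∈ G.cornersOf A then G.sideInv x else G.endInv x) ∈ X
      rw [if_neg (Set.disjoint_left.1 hd hx)]
      exact h.1.1 x hx
    · rw [edgeFlags_contract]
      exact fun x hx => ⟨h.2 hx, Set.disjoint_left.1 hd hx⟩

end RibbonGraph

/-! ### Colour classes of a state -/

namespace ColouredRibbonGraph

open RibbonGraph

variable {G : ColouredRibbonGraph}

/-- The vertex colour classes after merging the classes of the ends of the edges in `X`. -/
def vJoin (G : ColouredRibbonGraph) (X : Set G.Flag) : Setoid G.Flag :=
  G.vCol ⊔ Relation.EqvGen.setoid fun x y => x ∈ X ∧ y = G.sideInv x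

/-- The boundary colour classes after merging the classes touching the edges outside of `X`. -/
def bJoin (G : ColouredRibbonGraph) (X : Set G.Flag) : Setoid G.Flag :=
  G.bCol ⊔ Relation.EqvGen.setoid fun x y => x ∉ X ∧ y = G.endInv x

/-- The number of vertex colour classes in the state `X`. -/
def numV (G : ColouredRibbonGraph) (X : Set G.Flag) : ℕ := Nat.card (Quotient (G.vJoin X))

/-- The number of boundary colour classes in the state `X`. -/
def numB (G : ColouredRibbonGraph) (X : Set G.Flag) : ℕ := Nat.card (Quotient (G.bJoin X))

lemma vCol_le_vJoin (X : Set G.Flag) : G.vCol ≤ G.vJoin X := le_sup_left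

lemma bCol_le_bJoin (X : Set G.Flag) : G.bCol ≤ G.bJoin X := le_sup_left

lemma vJoin_sideInv {X : Set G.Flag} {x : G.Flag} (hx : x ∈ X) : G.vJoin X x (G.sideInv x) :=
  (le_sup_right : Relation.EqvGen.setoid _ ≤ G.vJoin X) (.rel _ _ ⟨hx, rfl⟩)

lemma bJoin_endInv {X : Set G.Flag} {x : G.Flag} (hx : x ∉ X) : G.bJoin X x (G.endInv x) :=
  (le_sup_right : Relation.EqvGen.setoid _ ≤ G.bJoin X) (.rel _ _ ⟨hx, rfl⟩)

lemma vJoin_le {X : Set G.Flag} {s : Setoid G.Flag} (h : G.vCol ≤ s)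
    (h' : ∀ x ∈ X, s x (G.sideInv x)) : G.vJoin X ≤ s := by
  refine sup_le h (Setoid.eqvGen_le ?_)
  rintro x y ⟨hx, rfl⟩
  exact h' x hx

lemma bJoin_le {X : Set G.Flag} {s : Setoid G.Flag} (h : G.bCol ≤ s)
    (h' : ∀ x ∉ X, s x (G.endInv x)) : G.bJoin X ≤ s := by
  refine sup_le h (Setoid.eqvGen_le ?_)
  rintro x y ⟨hx, rfl⟩
  exact h' x hx

lemma vJoin_empty : G.vJoin ∅ = G.vCol :=
  le_antisymm (vJoin_le le_rfl (by simp)) (vCol_le_vJoin _)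

/-- A flag outside `X` lies on no edge, so there `endInv` is `sideInv`, which respects `bCol`. -/
lemma bJoin_of_edgeFlags_subset {X : Set G.Flag} (h : G.edgeFlags ⊆ X) : G.bJoin X = G.bCol := by
  refine le_antisymm (bJoin_le le_rfl fun x hx => ?_) (bCol_le_bJoin _)
  have : G.endInv x = G.sideInv x := by
    by_contra h'
    exact hx (h h')
  rw [this]
  exact G.bCol_sideInv x

/-- A free side used by the state is a merging in `vJoin`. Together with `curves_le_bJoin` this
leaves only five kinds of steps: splitting or rerouting a curve merges no vertex classes, and
merging or rerouting curves separates no boundary classes. -/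
lemma curves_le_vJoin (X : Set G.Flag) : G.curves X ≤ G.vJoin X := by
  refine Setoid.eqvGen_le ?_
  rintro x y (rfl | rfl)
  · by_cases hx : x ∈ X
    · rw [stateInv_of_mem hx]; exact vJoin_sideInv hx
    · rw [stateInv_of_notMem hx]; exact vCol_le_vJoin X (G.vCol_endInv x)
  · exact vCol_le_vJoin X (G.vCol_arcInv x)

lemma curves_le_bJoin (X : Set G.Flag) : G.curves X ≤ G.bJoin X := by
  refine Setoid.eqvGen_le ?_
  rintro x y (rfl | rfl)
  · by_cases hx : x ∈ X
    · rw [stateInv_of_mem hx]; exact bCol_le_bJoin X (G.bCol_sideInv x)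
    · rw [stateInv_of_notMem hx]; exact bJoin_endInv hx
  · exact bCol_le_bJoin X (G.bCol_arcInv x)

/-- One pair accounts for the whole edge, because corners at the same end already share a class. -/
lemma vJoin_union_corners (X : Set G.Flag) (x : G.Flag) :
    G.vJoin (X ∪ G.corners x) = G.vJoin X ⊔ pairSetoid x (G.sideInv x) := by
  apply le_antisymm
  · set s := G.vJoin X ⊔ pairSetoid x (G.sideInv x)
    have hle : G.vJoin X ≤ s := le_sup_left
    have hs : s x (G.sideInv x) :=
      (le_sup_right : pairSetoid x (G.sideInv x) ≤ s) (pairSetoid_rel_self _ _)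
    refine vJoin_le ((vCol_le_vJoin X).trans hle) ?_
    rintro y (hy | hy)
    · exact hle (vJoin_sideInv hy)
    · exact (rel_sideInv_iff_of_mem_corners
        (fun z _ => hle (vCol_le_vJoin X (G.vCol_endInv z))) hy).2 hs
  · refine sup_le (vJoin_le (vCol_le_vJoin _) fun y hy => vJoin_sideInv (Or.inl hy))
      (pairSetoid_le (vJoin_sideInv (Or.inr (self_mem_corners x))))

/-- Edges outside the state are the ones that merge boundary classes, so here the smaller state has
the coarser relation. -/
lemma bJoin_eq_union_corners {X : Set G.Flag} {x : G.Flag} (hx : x ∉ X) :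
    G.bJoin X = G.bJoin (X ∪ G.corners x) ⊔ pairSetoid x (G.endInv x) := by
  apply le_antisymm
  · set s := G.bJoin (X ∪ G.corners x) ⊔ pairSetoid x (G.endInv x)
    have hle : G.bJoin (X ∪ G.corners x) ≤ s := le_sup_left
    have hs : s x (G.endInv x) :=
      (le_sup_right : pairSetoid x (G.endInv x) ≤ s) (pairSetoid_rel_self _ _)
    refine bJoin_le ((bCol_le_bJoin _).trans hle) fun y hy => ?_
    by_cases hy' : y ∈ G.corners x
    · exact (rel_endInv_iff_of_mem_corners
        (fun z _ => hle (bCol_le_bJoin _ (G.bCol_sideInv z))) hy').2 hs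
    · exact hle (bJoin_endInv fun h => h.elim hy hy')
  · exact sup_le (bJoin_le (bCol_le_bJoin _) fun y hy => bJoin_endInv fun h => hy (Or.inl h))
      (pairSetoid_le (bJoin_endInv hx))

open Classical in
lemma numV_step (X : Set G.Flag) (x : G.Flag) :
    G.numV X = G.numV (X ∪ G.corners x) + if G.vJoin X x (G.sideInv x) then 0 else 1 := by
  unfold numV
  rw [vJoin_union_corners]
  split_ifs with h
  · rw [sup_pairSetoid_of_rel h, add_zero]
  · exact card_quotient_sup_pairSetoid h

open Classical in
lemma numB_step {X : Set G.Flag} {x : G.Flag} (hx : x ∉ X) :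
    G.numB (X ∪ G.corners x) =
      G.numB X + if G.bJoin (X ∪ G.corners x) x (G.endInv x) then 0 else 1 := by
  unfold numB
  rw [bJoin_eq_union_corners hx]
  split_ifs with h
  · rw [sup_pairSetoid_of_rel h, add_zero]
  · exact card_quotient_sup_pairSetoid h

/-! ### Weights -/

/-- A monomial in four elements of a ring, with exponents given by the change of the numbers of
vertex colours, boundary colours, edges and curves between two states. -/
def monomialWeight {R : Type*} [CommRing R] (p q r s : R) (v b k c : ℤ) : R :=
  -- For a single edge (`k = 1`) the triples `(v, b, c)` equal to `(1,0,1)`, `(0,0,1)`, `(0,1,-1)`,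
  -- `(0,0,-1)`, `(0,0,0)` give `p`, `q²`, `r`, `s²`, `qs`.
  p ^ v.toNat * q ^ (k + c - 2 * v).toNat * r ^ b.toNat * s ^ (k - c - 2 * b).toNat

/-- The conditions under which the exponents in a monomial weight are natural numbers. -/
def Admissible (v b k c : ℤ) : Prop := 0 ≤ v ∧ 0 ≤ b ∧ 0 ≤ k + c - 2 * v ∧ 0 ≤ k - c - 2 * b

/-- The exponents are linear in the four numbers; admissibility makes them nonnegative, where
`toNat` is additive. -/
lemma monomialWeight_add {R : Type*} [CommRing R] (p q r s : R) {v b k c v' b' k' c' : ℤ}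
    (h : Admissible v b k c) (h' : Admissible v' b' k' c') :
    monomialWeight p q r s (v + v') (b + b') (k + k') (c + c') =
      monomialWeight p q r s v b k c * monomialWeight p q r s v' b' k' c' := by
  obtain ⟨h1, h2, h3, h4⟩ := h
  obtain ⟨h1', h2', h3', h4'⟩ := h'
  unfold monomialWeight
  have e3 : k + k' + (c + c') - 2 * (v + v') = (k + c - 2 * v) + (k' + c' - 2 * v') := by ring
  have e4 : k + k' - (c + c') - 2 * (b + b') = (k - c - 2 * b) + (k' - c' - 2 * b') := by ring
  rw [e3, e4, Int.toNat_add h1 h1', Int.toNat_add h2 h2', Int.toNat_add h3 h3',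
    Int.toNat_add h4 h4']
  ring

/-- The numbers of vertex colours, boundary colours, edges and curves change from the state `X` to
the state `Y` in the way in which they do by adding edges. -/
def AdmissiblePair (G : ColouredRibbonGraph) (X Y : Set G.Flag) : Prop :=
  4 ∣ (Y \ X).ncard ∧ Admissible ((G.numV X : ℤ) - G.numV Y) ((G.numB Y : ℤ) - G.numB X)
    (((Y \ X).ncard / 4 : ℕ) : ℤ) ((G.numCurves X : ℤ) - G.numCurves Y)

/-- The product of the weights of the edges that are added from the state `X` to the state `Y`. -/
def weight (G : ColouredRibbonGraph) {R : Type*} [CommRing R] (p q r s : R) (X Y : Set G.Flag) :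
    R :=
  monomialWeight p q r s ((G.numV X : ℤ) - G.numV Y) ((G.numB Y : ℤ) - G.numB X)
    (((Y \ X).ncard / 4 : ℕ) : ℤ) ((G.numCurves X : ℤ) - G.numCurves Y)

lemma ncard_diff_add {X Y Z : Set G.Flag} (hXY : X ⊆ Y) (hYZ : Y ⊆ Z) :
    (Z \ X).ncard = (Y \ X).ncard + (Z \ Y).ncard := by
  rw [← Set.ncard_union_eq (Set.disjoint_left.2 fun x h h' => h'.2 h.1)]
  congr 1
  ext x
  by_cases h : x ∈ Y
  · simp [h, hYZ h]
  · simp [h, show x ∉ X from fun h' => h (hXY h')]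

lemma AdmissiblePair.trans {X Y Z : Set G.Flag} (h : G.AdmissiblePair X Y)
    (h' : G.AdmissiblePair Y Z) (hXY : X ⊆ Y) (hYZ : Y ⊆ Z) : G.AdmissiblePair X Z := by
  unfold AdmissiblePair Admissible at *
  rw [ncard_diff_add hXY hYZ]
  omega

/-- All four differences telescope. Hence the product of edge weights along a chain depends on its
two ends only. -/
lemma weight_mul_weight {R : Type*} [CommRing R] (p q r s : R) {X Y Z : Set G.Flag}
    (h : G.AdmissiblePair X Y) (h' : G.AdmissiblePair Y Z) (hXY : X ⊆ Y) (hYZ : Y ⊆ Z) :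
    G.weight p q r s X Z = G.weight p q r s X Y * G.weight p q r s Y Z := by
  unfold weight
  rw [← monomialWeight_add p q r s h.2 h'.2, ncard_diff_add hXY hYZ]
  have := h.1
  congr 1
  · ring
  · ring
  -- The number of edges is a quotient by `4`; it splits because the first summand is divisible by
  -- `4`.
  · omega
  · ring

lemma union_corners_diff {X : Set G.Flag} (hX : G.IsStable X) {x : G.Flag} (hxX : x ∉ X) :
    (X ∪ G.corners x) \ X = G.corners x := by
  rw [Set.union_sdiff_left]
  exact sdiff_eq_left.2 (Set.disjoint_left.2 fun y hy => hX.notMem_of_mem_corners hxX hy)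

open Classical in
/-- The numbers of vertex colours, boundary colours, edges and curves of a single edge determine and
are determined by its kind. -/
lemma weight_step {R : Type*} [CommRing R] (p q r s : R) {X : Set G.Flag} (hX : G.IsStable X)
    {x : G.Flag} (hx : x ∈ G.edgeFlags) (hxX : x ∉ X) :
    G.AdmissiblePair X (X ∪ G.corners x) ∧ G.weight p q r s X (X ∪ G.corners x) =
      if ¬ G.vJoin X x (G.sideInv x) then p
      else if ¬ G.curves X x (G.sideInv x) then q ^ 2
      else if ¬ G.bJoin (X ∪ G.corners x) x (G.endInv x) then r
      else if ¬ G.curves (X ∪ G.corners x) x (G.endInv x) then s ^ 2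
      else q * s := by
  have hV := numV_step X x
  have hB := numB_step hxX
  unfold AdmissiblePair weight
  rw [union_corners_diff hX hxX, ncard_corners hx, hV, hB]
  rcases curves_step hX hx hxX with ⟨h1, h2, h3, -⟩ | ⟨h1, h2, h3, -⟩ | ⟨h1, h2, h3, -⟩
  -- Merging: the boundary classes do not change, and `vJoin` decides between `p` and `q ^ 2`. In
  -- the next case, splitting, `bJoin` decides between `r` and `s ^ 2`; rerouting changes no classes
  -- at all.
  · have h4 := curves_le_bJoin _ h2
    rw [h3]
    by_cases h5 : G.vJoin X x (G.sideInv x) <;>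
      simp [h1, h4, h5, Admissible, monomialWeight]
  · have h4 := curves_le_vJoin _ h1
    rw [h3]
    by_cases h5 : G.bJoin (X ∪ G.corners x) x (G.endInv x) <;>
      simp [h1, h2, h4, h5, Admissible, monomialWeight]
  · have h4 := curves_le_bJoin _ h2
    have h5 := curves_le_vJoin _ h1
    rw [h3]
    simp [h1, h2, h4, h5, Admissible, monomialWeight]

/-- The edges of `Y \ X` are added one at a time, and admissibility is transitive. -/
lemma admissiblePair_of_subset {X Y : Set G.Flag} (hX : G.IsState X) (hY : G.IsState Y)
    (hXY : X ⊆ Y) : G.AdmissiblePair X Y := by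
  induction hn : (Y \ X).ncard using Nat.strong_induction_on generalizing X with
  | _ n ih =>
    by_cases h : Y \ X = ∅
    · obtain rfl : X = Y := hXY.antisymm (Set.sdiff_eq_empty.1 h)
      simp [AdmissiblePair, Admissible]
    · obtain ⟨x, hx⟩ := Set.nonempty_iff_ne_empty.2 h
      have hxE := hY.subset hx.1
      have hc : G.corners x ⊆ Y := hY.corners_subset hx.1
      -- Admissibility does not involve the four ring elements, so any will do.
      have h1 := (weight_step (0 : ℤ) 0 0 0 hX.toIsStable hxE hx.2).1
      have hsub : X ∪ G.corners x ⊆ Y := Set.union_subset hXY hc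
      refine h1.trans (ih _ ?_ (hX.union (edgeAt x hxE).isState) hsub rfl)
        Set.subset_union_left hsub
      rw [← hn]
      refine Set.ncard_lt_ncard ⟨fun y hy => ⟨hy.1, fun h => hy.2 (Or.inl h)⟩, fun h => ?_⟩
      exact (h hx).2 (Or.inr (self_mem_corners x))

end ColouredRibbonGraph


namespace ColouredRibbonGraph

open RibbonGraph

variable {G : ColouredRibbonGraph}

/-! ### States of minors -/

-- A deleted edge merges no vertex classes, since its `sideInv` has become `endInv`, which stays on
-- a vertex.
open Classical in
lemma vJoin_delete (A : Set G.Edge) (S : Set G.Flag) :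
    (G.delete A).vJoin S = G.vJoin (S \ G.cornersOf A) := by
  apply le_antisymm
  · refine vJoin_le (G := G.delete A) (vCol_le_vJoin (G := G) _) fun (x : G.Flag) hx => ?_
    by_cases hA : x ∈ G.cornersOf A
    · have : (G.delete A).sideInv x = G.endInv x := if_pos hA
      rw [this]
      exact vCol_le_vJoin (G := G) _ (G.vCol_endInv x)
    · have : (G.delete A).sideInv x = G.sideInv x := if_neg hA
      rw [this]
      exact vJoin_sideInv (G := G) ⟨hx, hA⟩
  · refine vJoin_le (vCol_le_vJoin (G := G.delete A) S) fun x hx => ?_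
    have h : (G.delete A).sideInv x = G.sideInv x := if_neg hx.2
    rw [← h]
    exact vJoin_sideInv (G := G.delete A) hx.1

-- The classes that the deletion of `A` merges are those that `bJoin` merges for edges outside the
-- state.
open Classical in
lemma bJoin_delete (A : Set G.Edge) (S : Set G.Flag) :
    (G.delete A).bJoin S = G.bJoin (S \ G.cornersOf A) := by
  apply le_antisymm
  · refine bJoin_le (G := G.delete A) (sup_le (bCol_le_bJoin (G := G) _)
      (Setoid.eqvGen_le ?_)) fun (x : G.Flag) hx => ?_
    · rintro x y ⟨hx, rfl⟩
      exact bJoin_endInv (G := G) fun h => h.2 hx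
    · exact bJoin_endInv (G := G) fun h => hx h.1
  · refine bJoin_le ((le_sup_left : G.bCol ≤ (G.delete A).bCol).trans
      (bCol_le_bJoin (G := G.delete A) S)) fun x hx => ?_
    by_cases hA : x ∈ G.cornersOf A
    · exact bCol_le_bJoin (G := G.delete A) S
        ((le_sup_right : Relation.EqvGen.setoid _ ≤ (G.delete A).bCol) (.rel _ _ ⟨hA, rfl⟩))
    · exact bJoin_endInv (G := G.delete A) fun h => hx ⟨h, hA⟩

open Classical in
lemma vJoin_contract (A : Set G.Edge) (S : Set G.Flag) :
    (G.contract A).vJoin S = G.vJoin (S ∪ G.cornersOf A) := by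
  apply le_antisymm
  · refine vJoin_le (G := G.contract A) (sup_le (vCol_le_vJoin (G := G) _)
      (Setoid.eqvGen_le ?_)) fun (x : G.Flag) hx => ?_
    · rintro x y ⟨hx, rfl⟩
      exact vJoin_sideInv (G := G) (Or.inr hx)
    · exact vJoin_sideInv (G := G) (Or.inl hx)
  · refine vJoin_le ((le_sup_left : G.vCol ≤ (G.contract A).vCol).trans
      (vCol_le_vJoin (G := G.contract A) S)) fun x hx => ?_
    rcases hx with hx | hA
    · exact vJoin_sideInv (G := G.contract A) hx
    · exact vCol_le_vJoin (G := G.contract A) S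
        ((le_sup_right : Relation.EqvGen.setoid _ ≤ (G.contract A).vCol) (.rel _ _ ⟨hA, rfl⟩))

open Classical in
lemma bJoin_contract (A : Set G.Edge) (S : Set G.Flag) :
    (G.contract A).bJoin S = G.bJoin (S ∪ G.cornersOf A) := by
  apply le_antisymm
  · refine bJoin_le (G := G.contract A) (bCol_le_bJoin (G := G) _) fun (x : G.Flag) hx => ?_
    by_cases hA : x ∈ G.cornersOf A
    · have : (G.contract A).endInv x = G.sideInv x := if_pos hA
      rw [this]
      exact bCol_le_bJoin (G := G) _ (G.bCol_sideInv x)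
    · have : (G.contract A).endInv x = G.endInv x := if_neg hA
      rw [this]
      exact bJoin_endInv (G := G) fun h => h.elim hx hA
  · refine bJoin_le (bCol_le_bJoin (G := G.contract A) S) fun x hx => ?_
    have h : (G.contract A).endInv x = G.endInv x := if_neg fun h => hx (Or.inr h)
    rw [← h]
    exact bJoin_endInv (G := G.contract A) fun h => hx (Or.inl h)

lemma numV_delete (A : Set G.Edge) (S : Set G.Flag) :
    (G.delete A).numV S = G.numV (S \ G.cornersOf A) := by
  unfold numV; rw [vJoin_delete]; rfl

lemma numB_delete (A : Set G.Edge) (S : Set G.Flag) :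
    (G.delete A).numB S = G.numB (S \ G.cornersOf A) := by
  unfold numB; rw [bJoin_delete]; rfl

lemma numCurves_delete (A : Set G.Edge) (S : Set G.Flag) :
    (G.delete A).numCurves S = G.numCurves (S \ G.cornersOf A) := by
  have h : (G.delete A).curves S = G.curves (S \ G.cornersOf A) := curves_delete A S
  unfold numCurves; rw [h]; rfl

lemma numV_contract (A : Set G.Edge) (S : Set G.Flag) :
    (G.contract A).numV S = G.numV (S ∪ G.cornersOf A) := by
  unfold numV; rw [vJoin_contract]; rfl

lemma numB_contract (A : Set G.Edge) (S : Set G.Flag) :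
    (G.contract A).numB S = G.numB (S ∪ G.cornersOf A) := by
  unfold numB; rw [bJoin_contract]; rfl

lemma numCurves_contract (A : Set G.Edge) (S : Set G.Flag) :
    (G.contract A).numCurves S = G.numCurves (S ∪ G.cornersOf A) := by
  have h : (G.contract A).curves S = G.curves (S ∪ G.cornersOf A) := curves_contract A S
  unfold numCurves; rw [h]; rfl

lemma weight_delete {R : Type*} [CommRing R] (p q r s : R) {A : Set G.Edge} {S T : Set G.Flag}
    (hS : Disjoint S (G.cornersOf A)) (hT : Disjoint T (G.cornersOf A)) :
    (G.delete A).weight p q r s S T = G.weight p q r s S T := by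
  unfold weight
  rw [numV_delete, numV_delete, numB_delete, numB_delete, numCurves_delete, numCurves_delete,
    sdiff_eq_left.2 hS, sdiff_eq_left.2 hT]
  rfl

/-- The edges of `A` enter both states, so they cancel in the number of added edges. -/
lemma weight_contract {R : Type*} [CommRing R] (p q r s : R) {A : Set G.Edge} {S T : Set G.Flag}
    (hT : Disjoint T (G.cornersOf A)) :
    (G.contract A).weight p q r s S T =
      G.weight p q r s (S ∪ G.cornersOf A) (T ∪ G.cornersOf A) := by
  unfold weight
  rw [numV_contract, numV_contract, numB_contract, numB_contract, numCurves_contract,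
    numCurves_contract]
  have : (T ∪ G.cornersOf A) \ (S ∪ G.cornersOf A) = T \ S := by
    ext x
    by_cases h : x ∈ G.cornersOf A
    · simp [h, Set.disjoint_right.1 hT h]
    · simp [h]
  rw [this]
  rfl

/-! ### The state sum -/

/-- The finite set of states of a ribbon graph. -/
def states (G : ColouredRibbonGraph) : Finset (Set G.Flag) :=
  (Set.toFinite {S | G.IsState S}).toFinset

lemma mem_states {S : Set G.Flag} : S ∈ G.states ↔ G.IsState S := by simp [states]

/-- The product of the deletion coefficients of the edges that lead from the state `T` down to the
state `S`. -/
def weightA (G : ColouredRibbonGraph) (S T : Set G.Flag) : TutteRing :=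
  G.weight (MvPolynomial.X Var.aBs) (MvPolynomial.X Var.sqrtABp) (MvPolynomial.X Var.aOlc)
    (MvPolynomial.X Var.sqrtAOlh) S T

/-- The product of the contraction coefficients of the edges that lead from the state `S` up to the
state `T`. -/
def weightB (G : ColouredRibbonGraph) (S T : Set G.Flag) : TutteRing :=
  G.weight (MvPolynomial.X Var.bBs) (MvPolynomial.X Var.sqrtBBp) (MvPolynomial.X Var.bOlc)
    (MvPolynomial.X Var.sqrtBOlh) S T

/-- The contribution of a state: the edges in it are contracted, the others are deleted. -/
def stateTerm (G : ColouredRibbonGraph) (S : Set G.Flag) : TutteRing :=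
  MvPolynomial.X Var.α ^ G.numV S * MvPolynomial.X Var.β ^ G.numB S *
    MvPolynomial.X Var.γ ^ G.numCurves S * G.weightA S G.edgeFlags * G.weightB ∅ S

/-- The polynomial of a coloured ribbon graph, as a sum over all sets of edges. -/
def stateSum (G : ColouredRibbonGraph) : TutteRing := ∑ S ∈ G.states, G.stateTerm S

/-- The way from `S` up to all edges is chosen to add `e` last, which splits off the weight of that
last step. -/
lemma stateTerm_delete (e : G.Edge) {S : Set G.Flag} (hS : G.IsState S) (hd : Disjoint S e.1) :
    G.stateTerm S = G.weightA (G.edgeFlags \ e.1) G.edgeFlags * (G.delete {e}).stateTerm S := by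
  have hE : (G.delete {e}).edgeFlags = G.edgeFlags \ e.1 := by
    rw [← cornersOf_singleton e]
    exact edgeFlags_delete {e}
  have hd' : Disjoint S (G.cornersOf {e}) := by rwa [cornersOf_singleton]
  have hsub : S ⊆ G.edgeFlags \ e.1 := Set.subset_sdiff.2 ⟨hS.subset, hd⟩
  have hE' : G.IsState (G.edgeFlags \ e.1) := isState_edgeFlags.diff e.isState
  have hA : (G.delete {e}).weightA S (G.delete {e}).edgeFlags =
      G.weightA S (G.edgeFlags \ e.1) := by
    rw [hE]
    exact weight_delete _ _ _ _ hd' (by rw [cornersOf_singleton]; exact Set.disjoint_sdiff_left)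
  have hB : (G.delete {e}).weightB ∅ S = G.weightB ∅ S :=
    weight_delete _ _ _ _ (Set.empty_disjoint _) hd'
  have hA' : G.weightA S G.edgeFlags =
      G.weightA S (G.edgeFlags \ e.1) * G.weightA (G.edgeFlags \ e.1) G.edgeFlags :=
    weight_mul_weight _ _ _ _ (admissiblePair_of_subset hS hE' hsub)
      (admissiblePair_of_subset hE' isState_edgeFlags Set.sdiff_subset) hsub Set.sdiff_subset
  unfold stateTerm
  rw [hA, hB, numV_delete, numB_delete, numCurves_delete, sdiff_eq_left.2 hd', hA']
  ring

/-- The way from `∅` up to `S ∪ e` is chosen to add `e` first. -/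
lemma stateTerm_contract (e : G.Edge) {S : Set G.Flag} (hS : G.IsState S) (hd : Disjoint S e.1) :
    G.stateTerm (S ∪ e.1) = G.weightB ∅ e.1 * (G.contract {e}).stateTerm S := by
  have hE : (G.contract {e}).edgeFlags = G.edgeFlags \ e.1 := by
    rw [← cornersOf_singleton e]
    exact edgeFlags_contract {e}
  have hd' : Disjoint S (G.cornersOf {e}) := by rwa [cornersOf_singleton]
  have hA : (G.contract {e}).weightA S (G.contract {e}).edgeFlags =
      G.weightA (S ∪ e.1) G.edgeFlags := by
    rw [hE]
    refine (weight_contract _ _ _ _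
      (by rw [cornersOf_singleton]; exact Set.disjoint_sdiff_left)).trans ?_
    rw [cornersOf_singleton, Set.sdiff_union_of_subset e.isState.subset]
    rfl
  have hB : (G.contract {e}).weightB ∅ S = G.weightB e.1 (S ∪ e.1) := by
    refine (weight_contract (S := (∅ : Set G.Flag)) _ _ _ _ hd').trans ?_
    rw [cornersOf_singleton, Set.empty_union]
    rfl
  have hB' : G.weightB ∅ (S ∪ e.1) = G.weightB ∅ e.1 * G.weightB e.1 (S ∪ e.1) :=
    weight_mul_weight _ _ _ _
      (admissiblePair_of_subset isState_empty e.isState (Set.empty_subset _))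
      (admissiblePair_of_subset e.isState (hS.union e.isState) Set.subset_union_right)
      (Set.empty_subset _) Set.subset_union_right
  unfold stateTerm
  rw [hA, hB, numV_contract, numB_contract, numCurves_contract, cornersOf_singleton, hB']
  ring

lemma IsState.disjoint_or_subset {S : Set G.Flag} (hS : G.IsState S) (e : G.Edge) :
    Disjoint S e.1 ∨ e.1 ⊆ S := by
  by_cases h : Disjoint S e.1
  · exact Or.inl h
  · obtain ⟨x, hx, hxe⟩ := Set.not_disjoint_iff.1 h
    rw [e.eq_corners hxe]
    exact Or.inr (hS.corners_subset hx)

open Classical in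
/-- The states that do not contain a given edge. -/
def statesWithout (G : ColouredRibbonGraph) (e : G.Edge) : Finset (Set G.Flag) :=
  G.states.filter fun S => Disjoint S e.1

open Classical in
lemma mem_statesWithout {e : G.Edge} {S : Set G.Flag} :
    S ∈ G.statesWithout e ↔ G.IsState S ∧ Disjoint S e.1 := by
  unfold statesWithout
  rw [Finset.mem_filter, mem_states]

lemma states_delete (e : G.Edge) : (G.delete {e}).states = G.statesWithout e := by
  refine Finset.ext fun (S : Set G.Flag) => ?_
  refine (mem_states.trans (isState_delete {e} S)).trans (Iff.trans ?_ mem_statesWithout.symm)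
  rw [cornersOf_singleton]

lemma states_contract (e : G.Edge) : (G.contract {e}).states = G.statesWithout e := by
  refine Finset.ext fun (S : Set G.Flag) => ?_
  refine (mem_states.trans (isState_contract {e} S)).trans (Iff.trans ?_ mem_statesWithout.symm)
  rw [cornersOf_singleton]

/-- A sum over all states, split according to whether they contain a given edge. -/
lemma sum_states_eq {R : Type*} [CommRing R] (e : G.Edge) {a b : R} {t t' t'' : Set G.Flag → R}
    (h : ∀ S, G.IsState S → Disjoint S e.1 → t S = a * t' S)
    (h' : ∀ S, G.IsState S → Disjoint S e.1 → t (S ∪ e.1) = b * t'' S) :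
    ∑ S ∈ G.states, t S =
      a * ∑ S ∈ G.statesWithout e, t' S + b * ∑ S ∈ G.statesWithout e, t'' S := by
  classical
  obtain ⟨x, -, hx⟩ := e.exists_eq_corners
  have hne : x ∈ e.1 := hx ▸ self_mem_corners x
  rw [← Finset.sum_filter_add_sum_filter_not _ (fun S => Disjoint S e.1), Finset.mul_sum,
    Finset.mul_sum]
  congr 1
  · refine Finset.sum_congr (by unfold statesWithout; congr) fun S hS => ?_
    have h1 := mem_statesWithout.1 hS
    exact h S h1.1 h1.2
  · refine Finset.sum_nbij' (fun S => S \ e.1) (fun S => S ∪ e.1) ?_ ?_ ?_ ?_ ?_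
    · intro S hS
      rw [Finset.mem_filter, mem_states] at hS
      exact mem_statesWithout.2 ⟨hS.1.diff e.isState, Set.disjoint_sdiff_left⟩
    · intro S hS
      have h := mem_statesWithout.1 hS
      rw [Finset.mem_filter, mem_states]
      exact ⟨h.1.union e.isState, fun h' => Set.disjoint_left.1 h' (Or.inr hne) hne⟩
    · intro S hS
      rw [Finset.mem_filter, mem_states] at hS
      exact Set.sdiff_union_of_subset ((IsState.disjoint_or_subset hS.1 e).resolve_left hS.2)
    · intro S hS
      exact (Set.union_sdiff_right).trans (sdiff_eq_left.2 (mem_statesWithout.1 hS).2)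
    · intro S hS
      rw [Finset.mem_filter, mem_states] at hS
      have h1 := h' _ (hS.1.diff e.isState) Set.disjoint_sdiff_left
      rwa [Set.sdiff_union_of_subset
        ((IsState.disjoint_or_subset hS.1 e).resolve_left hS.2)] at h1

/-- The recursion before any analysis of kinds: its coefficients are the weights of adding `e` as
the last and as the first edge. -/
theorem stateSum_eq (e : G.Edge) : G.stateSum =
    G.weightA (G.edgeFlags \ e.1) G.edgeFlags * (G.delete {e}).stateSum +
      G.weightB ∅ e.1 * (G.contract {e}).stateSum := by
  have h1 : (G.delete {e}).stateSum =
      ∑ S ∈ G.statesWithout e, stateTerm (G.delete {e}) S :=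
    Finset.sum_congr (states_delete e) fun _ _ => rfl
  have h2 : (G.contract {e}).stateSum =
      ∑ S ∈ G.statesWithout e, stateTerm (G.contract {e}) S :=
    Finset.sum_congr (states_contract e) fun _ _ => rfl
  rw [h1, h2]
  exact sum_states_eq e (fun _ => stateTerm_delete e) (fun _ => stateTerm_contract e)

lemma stateSum_of_isEmpty (h : IsEmpty G.Edge) : G.stateSum = MvPolynomial.X Var.α ^
    G.numVertexColours * MvPolynomial.X Var.β ^ G.numBoundaryColours *
    MvPolynomial.X Var.γ ^ G.numVertices := by
  have hE := isEmpty_edge_iff.1 h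
  have hs : G.states = {∅} := by
    ext S
    rw [mem_states, Finset.mem_singleton]
    exact ⟨fun hS => Set.subset_empty_iff.1 (hE ▸ hS.subset), fun hS => hS ▸ isState_empty⟩
  have hV : G.numV ∅ = G.numVertexColours := by rw [numV, vJoin_empty]; rfl
  have hB : G.numB ∅ = G.numBoundaryColours := by
    rw [numB, bJoin_of_edgeFlags_subset hE.subset]; rfl
  have hC : G.numCurves ∅ = G.numVertices := by rw [numCurves, curves_empty]; rfl
  rw [stateSum, hs, Finset.sum_singleton, stateTerm, hE, hV, hB, hC]
  simp [weightA, weightB, weight, monomialWeight]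

end ColouredRibbonGraph


/-! ## Invariance under subdivision -/

section Generated

variable {F : Type*}

lemma iff_of_eqvGen {r : F → F → Prop} {p : F → Prop} (hp : ∀ x y, r x y → (p x ↔ p y)) {x y : F}
    (h : Relation.EqvGen r x y) : p x ↔ p y := by
  induction h with
  | rel x y h => exact hp x y h
  | refl => rfl
  | symm _ _ _ ih => exact ih.symm
  | trans _ _ _ _ _ ih ih' => exact ih.trans ih'

lemma mem_of_eqvGen {a t : F → F} (ha : Function.Involutive a) (ht : Function.Involutive t)
    {p : F → Prop} (hpt : ∀ x, p x → p (t x)) (hpa : ∀ x, p x → p (a x)) {x y : F}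
    (h : Relation.EqvGen (fun x y => y = t x ∨ y = a x) x y) (hx : p x) : p y := by
  refine (iff_of_eqvGen (p := p) ?_ h).1 hx
  rintro x y (rfl | rfl)
  · exact ⟨hpt x, fun h => by simpa [ht x] using hpt _ h⟩
  · exact ⟨hpa x, fun h => by simpa [ha x] using hpa _ h⟩

/-- A chain that starts in `p` never leaves it. This serves the removal of isolated vertices. -/
lemma eqvGen_subtype {r : F → F → Prop} {p : F → Prop} (hp : ∀ x y, r x y → (p x ↔ p y))
    {x y : F} (hx : p x) (hy : p y) (h : Relation.EqvGen r x y) :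
    Relation.EqvGen (fun u w : Subtype p => r u.1 w.1) ⟨x, hx⟩ ⟨y, hy⟩ := by
  induction h with
  | rel x y h => exact .rel _ _ h
  | refl => exact .refl _
  | symm _ _ _ ih => exact (ih hy hx).symm
  | trans _ _ _ h _ ih ih' =>
    have hz := (iff_of_eqvGen hp h).1 hx
    exact (ih hx hz).trans _ _ _ (ih' hz hy)

end Generated

namespace ColouredRibbonGraph

open RibbonGraph

namespace Subdivides

variable {G H : ColouredRibbonGraph} {f : G.Flag → H.Flag} (h : H.Subdivides G f)
include h

lemma mem_edgeFlags_iff (x : G.Flag) : f x ∈ H.edgeFlags ↔ x ∈ G.edgeFlags := by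
  change H.endInv (f x) ≠ H.sideInv (f x) ↔ G.endInv x ≠ G.sideInv x
  rw [← h.map_endInv, ← h.map_sideInv, h.injective.ne_iff]

lemma exists_of_mem_edgeFlags {y : H.Flag} (hy : y ∈ H.edgeFlags) : ∃ x ∈ G.edgeFlags, f x = y := by
  by_contra hcon
  have hy' : y ∉ Set.range f := by
    rintro ⟨x, rfl⟩
    exact hcon ⟨x, (h.mem_edgeFlags_iff x).1 hy, rfl⟩
  exact hy (h.free y hy')

lemma isStable_image {S : Set G.Flag} (hS : G.IsStable S) : H.IsStable (f '' S) := by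
  constructor
  · rintro _ ⟨x, hx, rfl⟩
    exact ⟨_, hS.1 x hx, h.map_endInv x⟩
  · rintro _ ⟨x, hx, rfl⟩
    exact ⟨_, hS.2 x hx, h.map_sideInv x⟩

lemma map_stateInv (S : Set G.Flag) (x : G.Flag) :
    f (G.stateInv S x) = H.stateInv (f '' S) (f x) := by
  by_cases hx : x ∈ S
  · rw [stateInv_of_mem hx, stateInv_of_mem (Set.mem_image_of_mem f hx), h.map_sideInv]
  · rw [stateInv_of_notMem hx, stateInv_of_notMem ((h.injective.mem_set_image).not.2 hx),
      h.map_endInv]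

omit h in
lemma stateInv_of_notMem_range (S : Set G.Flag) {y : H.Flag} (hy : y ∉ Set.range f) :
    H.stateInv (f '' S) y = H.endInv y :=
  stateInv_of_notMem fun h' => hy (Set.image_subset_range f S h')

/-- Additional arcs belong to no state, so any state crosses them by `endInv`, as in the definition
of a subdivision. -/
lemma gapReach (S : Set G.Flag) (x : G.Flag) :
    GapReach H.arcInv (H.stateInv (f '' S)) (Set.range f) (H.arcInv (f x)) (f (G.arcInv x)) := by
  refine Relation.ReflTransGen.mono ?_ _ _ (h.map_arcInv x)
  rintro y z ⟨hy, rfl⟩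
  exact ⟨hy, by rw [stateInv_of_notMem_range S hy]⟩

lemma curves_iff {S : Set G.Flag} (hS : G.IsStable S) (x y : G.Flag) :
    G.curves S x y ↔ H.curves (f '' S) (f x) (f y) := by
  have hS' := h.isStable_image hS
  constructor
  · have hle : G.curves S ≤ Setoid.comap f (H.curves (f '' S)) := by
      refine Setoid.eqvGen_le ?_
      rintro x y (rfl | rfl)
      · change H.curves (f '' S) (f x) (f (G.stateInv S x))
        rw [h.map_stateInv]
        exact curves_stateInv _ _
      · change H.curves (f '' S) (f x) (f (G.arcInv x))
        have hr := h.gapReach S x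
        refine (H.curves (f '' S)).trans (curves_arcInv _ _) ?_
        generalize f (G.arcInv x) = z at hr
        induction hr with
        | refl => exact (H.curves (f '' S)).refl _
        | tail _ hs ih =>
          obtain ⟨-, rfl⟩ := hs
          exact (H.curves (f '' S)).trans ih
            ((H.curves (f '' S)).trans (curves_stateInv _ _) (curves_arcInv _ _))
    exact fun hxy => hle hxy
  · intro hxy
    have hP : ∀ y ∈ Set.range f, H.stateInv (f '' S) y ∈ Set.range f := by
      rintro _ ⟨z, rfl⟩
      exact ⟨_, h.map_stateInv S z⟩
    -- The points on the paths that start in the image `C` of the curve of `x` form a set closed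
    -- under both involutions of `H`, which meets the range of `f` only in `C`.
    set C : Set H.Flag := f '' {z | G.curves S x z}
    have hCa : ∀ z, G.curves S x z → G.curves S x (G.arcInv z) := fun z hz =>
      (G.curves S).trans hz (curves_arcInv S z)
    have hfin : ∀ u ∈ C, ∃ w ∈ Set.range f,
        GapReach H.arcInv (H.stateInv (f '' S)) (Set.range f) (H.arcInv u) w := by
      rintro _ ⟨z, -, rfl⟩
      exact ⟨_, ⟨_, rfl⟩, h.gapReach S z⟩
    have hC : ∀ u ∈ C, ∀ w ∈ Set.range f,
        GapReach H.arcInv (H.stateInv (f '' S)) (Set.range f) (H.arcInv u) w → w ∈ C := by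
      rintro _ ⟨z, hz, rfl⟩ w hw hzw
      rw [hzw.unique (h.gapReach S z) hw ⟨_, rfl⟩]
      exact ⟨_, hCa z hz, rfl⟩
    have hCr : ∀ z, G.curves S x z → ∃ u ∈ C,
        GapReach H.arcInv (H.stateInv (f '' S)) (Set.range f) (H.arcInv u) (f z) := by
      intro z hz
      have := h.gapReach S (G.arcInv z)
      rw [G.arcInv_invol] at this
      exact ⟨_, ⟨_, hCa z hz, rfl⟩, this⟩
    have hcl := fun y hy => gapReach_closed (y := y) H.arcInv_invol (stateInv_invol hS') hP hC
      hfin hy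
    have hrange : ∀ y, (∃ u ∈ C, GapReach H.arcInv (H.stateInv (f '' S)) (Set.range f)
        (H.arcInv u) y) → y ∈ Set.range f → y ∈ C := by
      rintro y ⟨u, hu, huy⟩ hy
      exact hC u hu y hy huy
    have hy := mem_of_eqvGen H.arcInv_invol (stateInv_invol hS') (p := fun y => ∃ u ∈ C,
      GapReach H.arcInv (H.stateInv (f '' S)) (Set.range f) (H.arcInv u) y) ?_
      (fun y hy => (hcl y hy).2) hxy (hCr x ((G.curves S).refl x))
    · obtain ⟨z, hz, hzy⟩ := hrange _ hy ⟨y, rfl⟩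
      rwa [← h.injective hzy]
    · intro y hy
      by_cases hy' : y ∈ Set.range f
      · obtain ⟨z, hz, rfl⟩ := hrange y hy hy'
        rw [← h.map_stateInv]
        exact hCr _ ((G.curves S).trans hz (curves_stateInv S z))
      · exact (hcl y hy).1 hy'

/-- The property spreads over the vertex of `y` from the flag provided by `vertex`: off the range of
`f` the state follows the vertex boundary, and on the range `endInv` stays in the range. -/
lemma exists_curves (S : Set G.Flag) (y : H.Flag) : ∃ x, H.curves (f '' S) y (f x) := by
  obtain ⟨x, hx⟩ := h.vertex y
  refine mem_of_eqvGen H.arcInv_invol H.endInv_invol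
    (p := fun y => ∃ x, H.curves (f '' S) y (f x)) ?_ ?_ (H.vertexRel.symm hx)
    ⟨x, (H.curves _).refl _⟩
  · rintro y ⟨x, hx⟩
    by_cases hy : y ∈ Set.range f
    · obtain ⟨z, rfl⟩ := hy
      exact ⟨G.endInv z, by rw [h.map_endInv]⟩
    · refine ⟨x, (H.curves _).trans ((H.curves _).symm ?_) hx⟩
      rw [← stateInv_of_notMem_range S hy]
      exact curves_stateInv _ _
  · rintro y ⟨x, hx⟩
    exact ⟨x, (H.curves _).trans ((H.curves _).symm (curves_arcInv _ _)) hx⟩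

lemma curves_range : H.curves (Set.range f) = H.boundaryRel := by
  rw [← curves_univ]
  refine curves_congr fun y hy => ?_
  obtain ⟨x, -, rfl⟩ := h.exists_of_mem_edgeFlags hy
  simp

lemma vertexRel_iff (x y : G.Flag) : G.vertexRel x y ↔ H.vertexRel (f x) (f y) := by
  have := h.curves_iff isStable_empty x y
  rwa [Set.image_empty, curves_empty, curves_empty] at this

lemma boundaryRel_iff (x y : G.Flag) : G.boundaryRel x y ↔ H.boundaryRel (f x) (f y) := by
  have := h.curves_iff (S := Set.univ) ⟨by simp, by simp⟩ x y
  rwa [Set.image_univ, curves_univ, h.curves_range] at this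

lemma exists_boundaryRel (y : H.Flag) : ∃ x, H.boundaryRel y (f x) := by
  have := h.exists_curves Set.univ y
  rwa [Set.image_univ, h.curves_range] at this

lemma vJoin_iff (S : Set G.Flag) (x y : G.Flag) :
    G.vJoin S x y ↔ H.vJoin (f '' S) (f x) (f y) := by
  refine sup_eqvGen_iff_of_comap h.vCol_iff
    (fun y => (h.vertex y).imp fun x hx => H.vertexRel_le hx) ?_ ?_ x y
  · rintro x y ⟨hx, rfl⟩
    exact ⟨⟨x, hx, rfl⟩, h.map_sideInv x⟩
  · rintro _ _ ⟨⟨x, hx, rfl⟩, rfl⟩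
    exact Or.inr ⟨x, _, rfl, (h.map_sideInv x).symm, hx, rfl⟩

lemma bJoin_iff (S : Set G.Flag) (x y : G.Flag) :
    G.bJoin S x y ↔ H.bJoin (f '' S) (f x) (f y) := by
  refine sup_eqvGen_iff_of_comap h.bCol_iff
    (fun y => (h.exists_boundaryRel y).imp fun x hx => H.boundaryRel_le hx) ?_ ?_ x y
  · rintro x y ⟨hx, rfl⟩
    exact ⟨(h.injective.mem_set_image).not.2 hx, h.map_endInv x⟩
  · rintro y _ ⟨hy, rfl⟩
    by_cases hr : y ∈ Set.range f
    · obtain ⟨x, rfl⟩ := hr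
      exact Or.inr ⟨x, _, rfl, (h.map_endInv x).symm, (h.injective.mem_set_image).not.1 hy, rfl⟩
    · rw [h.free y hr]
      exact Or.inl (H.bCol_sideInv y)

lemma numCurves_eq {S : Set G.Flag} (hS : G.IsStable S) :
    G.numCurves S = H.numCurves (f '' S) :=
  card_quotient_eq_of_comap f (h.curves_iff hS) (h.exists_curves S)

lemma numV_eq (S : Set G.Flag) : G.numV S = H.numV (f '' S) :=
  card_quotient_eq_of_comap f (h.vJoin_iff S)
    fun y => (h.vertex y).imp fun _ hx => vCol_le_vJoin _ (H.vertexRel_le hx)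

lemma numB_eq (S : Set G.Flag) : G.numB S = H.numB (f '' S) :=
  card_quotient_eq_of_comap f (h.bJoin_iff S)
    fun y => (h.exists_boundaryRel y).imp fun _ hx => bCol_le_bJoin _ (H.boundaryRel_le hx)

lemma weight_eq {R : Type*} [CommRing R] (p q r s : R) {S T : Set G.Flag} (hS : G.IsStable S)
    (hT : G.IsStable T) : G.weight p q r s S T = H.weight p q r s (f '' S) (f '' T) := by
  unfold weight
  rw [h.numV_eq, h.numV_eq, h.numB_eq, h.numB_eq, h.numCurves_eq hS, h.numCurves_eq hT,
    ← Set.image_sdiff h.injective, Set.ncard_image_of_injective _ h.injective]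

lemma image_edgeFlags : f '' G.edgeFlags = H.edgeFlags := by
  ext y
  constructor
  · rintro ⟨x, hx, rfl⟩
    exact (h.mem_edgeFlags_iff x).2 hx
  · exact h.exists_of_mem_edgeFlags

lemma stateTerm_eq {S : Set G.Flag} (hS : G.IsState S) :
    G.stateTerm S = H.stateTerm (f '' S) := by
  unfold stateTerm weightA weightB
  rw [h.weight_eq _ _ _ _ hS.toIsStable isStable_edgeFlags,
    h.weight_eq _ _ _ _ isStable_empty hS.toIsStable, h.numV_eq, h.numB_eq,
    h.numCurves_eq hS.toIsStable, h.image_edgeFlags, Set.image_empty]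

lemma isState_image {S : Set G.Flag} (hS : G.IsState S) : H.IsState (f '' S) :=
  ⟨h.isStable_image hS.toIsStable, h.image_edgeFlags ▸ Set.image_mono hS.subset⟩

lemma isState_preimage {T : Set H.Flag} (hT : H.IsState T) : G.IsState (f ⁻¹' T) := by
  refine ⟨⟨fun x hx => ?_, fun x hx => ?_⟩, fun x hx => (h.mem_edgeFlags_iff x).1 (hT.subset hx)⟩
  · rw [Set.mem_preimage, h.map_endInv]
    exact hT.endInv_mem _ hx
  · rw [Set.mem_preimage, h.map_sideInv]
    exact hT.sideInv_mem _ hx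

lemma stateSum_eq : G.stateSum = H.stateSum := by
  refine Finset.sum_nbij' (fun S => f '' S) (fun T => f ⁻¹' T) ?_ ?_ ?_ ?_ ?_
  · exact fun S hS => mem_states.2 (h.isState_image (mem_states.1 hS))
  · exact fun T hT => mem_states.2 (h.isState_preimage (mem_states.1 hT))
  · exact fun S _ => Set.preimage_image_eq S h.injective
  · intro T hT
    refine Set.image_preimage_eq_of_subset ((mem_states.1 hT).subset.trans ?_)
    rw [← h.image_edgeFlags]
    exact Set.image_subset_range _ _
  · exact fun S hS => h.stateTerm_eq (mem_states.1 hS)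

end Subdivides

theorem Equivalent.stateSum_eq {G H : ColouredRibbonGraph} (h : G.Equivalent H) :
    G.stateSum = H.stateSum := by
  unfold Equivalent at h
  induction h with
  | rel _ _ h => exact h.choose_spec.stateSum_eq
  | refl => rfl
  | symm _ _ _ ih => exact ih.symm
  | trans _ _ _ _ _ ih ih' => exact ih.trans ih'

/-! ## Kinds of edges -/

/-- An edge of the given kind is a loop after identifying vertices of the same colour, is a loop,
is a doop after identifying boundary components of the same colour, or is a doop, if the
respective proposition holds. -/
def _root_.RibbonTutte.OneEdgeType.Describes : OneEdgeType → Prop → Prop → Prop → Prop → Prop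
  | .bs, cl, l, cd, d => ¬ cl ∧ ¬ l ∧ cd ∧ d
  | .bp, cl, l, cd, d => cl ∧ ¬ l ∧ cd ∧ d
  | .olc, cl, l, cd, d => cl ∧ l ∧ ¬ cd ∧ ¬ d
  | .olh, cl, l, cd, d => cl ∧ l ∧ cd ∧ ¬ d
  | .nl, cl, l, cd, d => cl ∧ l ∧ cd ∧ d

/-- Some edge joins two vertices of the same colour. -/
def HasColourLoop (G : ColouredRibbonGraph) : Prop := ∃ x ∈ G.edgeFlags, G.vCol x (G.sideInv x)

/-- Some edge is a loop. -/
def HasLoop (G : ColouredRibbonGraph) : Prop := ∃ x ∈ G.edgeFlags, G.vertexRel x (G.sideInv x)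

/-- Some edge touches only boundary components of the same colour. -/
def HasColourDoop (G : ColouredRibbonGraph) : Prop := ∃ x ∈ G.edgeFlags, G.bCol x (G.endInv x)

/-- Some edge is a doop. -/
def HasDoop (G : ColouredRibbonGraph) : Prop := ∃ x ∈ G.edgeFlags, G.boundaryRel x (G.endInv x)

/-- The graph has a colour loop, loop, colour doop and doop in the way in which the graph with a
single edge of the given kind does. -/
def HasKind (G : ColouredRibbonGraph) (t : OneEdgeType) : Prop :=
  t.Describes G.HasColourLoop G.HasLoop G.HasColourDoop G.HasDoop

lemma hasKind_congr {G H : ColouredRibbonGraph} (h1 : G.HasColourLoop ↔ H.HasColourLoop)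
    (h2 : G.HasLoop ↔ H.HasLoop) (h3 : G.HasColourDoop ↔ H.HasColourDoop)
    (h4 : G.HasDoop ↔ H.HasDoop) (t : OneEdgeType) : G.HasKind t ↔ H.HasKind t := by
  simp only [HasKind, h1, h2, h3, h4]

/-- The four properties quantify over edges, and `f` matches the edges of `G` with those of `H`.
This is how the kind of a graph known only up to equivalence is read off. -/
lemma Subdivides.hasKind_iff {G H : ColouredRibbonGraph} {f : G.Flag → H.Flag}
    (h : H.Subdivides G f) (t : OneEdgeType) : G.HasKind t ↔ H.HasKind t := by
  have key : ∀ {p : G.Flag → Prop} {q : H.Flag → Prop}, (∀ x, p x ↔ q (f x)) →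
      ((∃ x ∈ G.edgeFlags, p x) ↔ ∃ y ∈ H.edgeFlags, q y) := by
    intro p q hpq
    constructor
    · rintro ⟨x, hx, hp⟩
      exact ⟨f x, (h.mem_edgeFlags_iff x).2 hx, (hpq x).1 hp⟩
    · rintro ⟨y, hy, hq⟩
      obtain ⟨x, hx, rfl⟩ := h.exists_of_mem_edgeFlags hy
      exact ⟨x, hx, (hpq x).2 hq⟩
  refine hasKind_congr (key fun x => ?_) (key fun x => ?_) (key fun x => ?_) (key fun x => ?_) t
  · rw [← h.map_sideInv]; exact h.vCol_iff _ _
  · rw [← h.map_sideInv]; exact h.vertexRel_iff _ _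
  · rw [← h.map_endInv]; exact h.bCol_iff _ _
  · rw [← h.map_endInv]; exact h.boundaryRel_iff _ _

lemma Equivalent.hasKind_iff {G H : ColouredRibbonGraph} (h : G.Equivalent H) (t : OneEdgeType) :
    G.HasKind t ↔ H.HasKind t := by
  unfold Equivalent at h
  induction h with
  | rel _ _ h => exact h.choose_spec.hasKind_iff t
  | refl => rfl
  | symm _ _ _ ih => exact ih.symm
  | trans _ _ _ _ _ ih ih' => exact ih.trans ih'

/-! ### Kinds after the removal of isolated vertices -/

lemma nonIsolated_of_mem_edgeFlags {G : ColouredRibbonGraph} {x : G.Flag} (hx : x ∈ G.edgeFlags) :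
    G.NonIsolated x := ⟨x, G.vertexRel.refl x, hx⟩

lemma nonIsolated_iff {G : ColouredRibbonGraph} {m : G.Flag → G.Flag} (hm : Function.Involutive m)
    (h : ∀ x, G.NonIsolated x → G.NonIsolated (m x)) (x y : G.Flag)
    (hxy : y = m x ∨ y = G.arcInv x) : G.NonIsolated x ↔ G.NonIsolated y := by
  rcases hxy with rfl | rfl
  · exact ⟨h x, fun h' => by simpa [hm x] using h _ h'⟩
  · exact ⟨fun h' => h'.arcInv, fun h' => by simpa [G.arcInv_invol] using h'.arcInv⟩

lemma removeIsolated_vertexRel (G : ColouredRibbonGraph) (x y : G.removeIsolated.Flag) :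
    G.removeIsolated.vertexRel x y ↔ G.vertexRel x.1 y.1 := by
  constructor
  · have h : G.removeIsolated.vertexRel ≤ Setoid.comap Subtype.val G.vertexRel := by
      refine Setoid.eqvGen_le ?_
      rintro x y (rfl | rfl)
      · exact .rel _ _ (Or.inl rfl)
      · exact .rel _ _ (Or.inr rfl)
    exact fun h' => h h'
  · intro h
    refine (eqvGen_subtype (nonIsolated_iff G.endInv_invol fun _ => NonIsolated.endInv)
      x.2 y.2 h).mono ?_
    rintro u w (h | h)
    · exact Or.inl (Subtype.ext h)
    · exact Or.inr (Subtype.ext h)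

lemma removeIsolated_boundaryRel (G : ColouredRibbonGraph) (x y : G.removeIsolated.Flag) :
    G.removeIsolated.boundaryRel x y ↔ G.boundaryRel x.1 y.1 := by
  constructor
  · have h : G.removeIsolated.boundaryRel ≤ Setoid.comap Subtype.val G.boundaryRel := by
      refine Setoid.eqvGen_le ?_
      rintro x y (rfl | rfl)
      · exact .rel _ _ (Or.inl rfl)
      · exact .rel _ _ (Or.inr rfl)
    exact fun h' => h h'
  · intro h
    refine (eqvGen_subtype (nonIsolated_iff G.sideInv_invol fun _ => NonIsolated.sideInv)
      x.2 y.2 h).mono ?_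
    rintro u w (h | h)
    · exact Or.inl (Subtype.ext h)
    · exact Or.inr (Subtype.ext h)

lemma mem_removeIsolated_edgeFlags (G : ColouredRibbonGraph) (x : G.removeIsolated.Flag) :
    x ∈ G.removeIsolated.edgeFlags ↔ x.1 ∈ G.edgeFlags :=
  (Subtype.ext_iff (a1 := G.removeIsolated.endInv x) (a2 := G.removeIsolated.sideInv x)).not

lemma removeIsolated_hasKind_iff (G : ColouredRibbonGraph) (t : OneEdgeType) :
    G.removeIsolated.HasKind t ↔ G.HasKind t := by
  have key : ∀ {p : G.removeIsolated.Flag → Prop} {q : G.Flag → Prop}, (∀ x, p x ↔ q x.1) →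
      ((∃ x ∈ G.removeIsolated.edgeFlags, p x) ↔ ∃ y ∈ G.edgeFlags, q y) := by
    intro p q hpq
    constructor
    · rintro ⟨x, hx, hp⟩
      exact ⟨x.1, (G.mem_removeIsolated_edgeFlags x).1 hx, (hpq x).1 hp⟩
    · rintro ⟨y, hy, hq⟩
      exact ⟨⟨y, nonIsolated_of_mem_edgeFlags hy⟩, (G.mem_removeIsolated_edgeFlags _).2 hy,
        (hpq _).2 hq⟩
  exact hasKind_congr (key fun x => Iff.rfl) (key fun x => G.removeIsolated_vertexRel _ _)
    (key fun x => Iff.rfl) (key fun x => G.removeIsolated_boundaryRel _ _) t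

end ColouredRibbonGraph


open RibbonGraph

/-! ## The graphs with one edge -/

lemma bridgeGraph_vertexRel (x y : Bool × Bool) : bridgeGraph.vertexRel x y ↔ x.1 = y.1 := by
  constructor
  · have h : bridgeGraph.vertexRel ≤ Setoid.ker (Prod.fst : Bool × Bool → Bool) := by
      refine Setoid.eqvGen_le ?_
      rintro x y (rfl | rfl) <;> rfl
    exact fun h' => h h'
  · obtain ⟨i, j⟩ := x
    obtain ⟨i', j'⟩ := y
    rintro rfl
    by_cases h : j' = j
    · subst h
      exact bridgeGraph.vertexRel.refl _
    · obtain rfl : j' = !j := by revert h; cases j <;> cases j' <;> simp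
      exact .rel _ _ (Or.inl rfl)

lemma orientableLoopGraph_boundaryRel (x y : Bool × Bool) :
    orientableLoopGraph.boundaryRel x y ↔ x.2 = y.2 := by
  constructor
  · have h : orientableLoopGraph.boundaryRel ≤ Setoid.ker (Prod.snd : Bool × Bool → Bool) := by
      refine Setoid.eqvGen_le ?_
      rintro x y (rfl | rfl) <;> rfl
    exact fun h' => h h'
  · obtain ⟨i, j⟩ := x
    obtain ⟨i', j'⟩ := y
    rintro rfl
    by_cases h : i' = i
    · subst h
      exact orientableLoopGraph.boundaryRel.refl _
    · obtain rfl : i' = !i := by revert h; cases i <;> cases i' <;> simp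
      exact .rel _ _ (Or.inl rfl)

namespace ColouredRibbonGraph

variable {G : ColouredRibbonGraph}

lemma graph_hasKind (t : OneEdgeType) : t.graph.HasKind t := by
  have ne : ∀ x : Bool × Bool, (x.1, !x.2) ≠ (!x.1, x.2) := by decide
  have hv : ∀ x : Bool × Bool, ¬ bridgeGraph.vertexRel x (!x.1, x.2) := fun x h => by
    have := (bridgeGraph_vertexRel _ _).1 h
    simp at this
  have hb : ∀ x : Bool × Bool, ¬ orientableLoopGraph.boundaryRel x (x.1, !x.2) := fun x h => by
    have := (orientableLoopGraph_boundaryRel _ _).1 h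
    simp at this
  have hd : bridgeGraph.boundaryRel (false, false) (false, true) := .rel _ _ (Or.inr rfl)
  have hl : orientableLoopGraph.vertexRel (false, false) (true, false) := .rel _ _ (Or.inr rfl)
  have hnv : nonorientableLoopGraph.vertexRel (false, false) (true, false) :=
    .trans _ (false, true) _ (.rel _ _ (Or.inl rfl)) (.rel _ _ (Or.inr rfl))
  have hnb : nonorientableLoopGraph.boundaryRel (false, false) (false, true) :=
    .trans _ (true, false) _ (.rel _ _ (Or.inl rfl)) (.rel _ _ (Or.inr rfl))
  cases t
  · exact ⟨fun ⟨x, _, h⟩ => hv x h, fun ⟨x, _, h⟩ => hv x h, ⟨(false, false), ne _, trivial⟩,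
      ⟨(false, false), ne _, hd⟩⟩
  · exact ⟨⟨(false, false), ne _, trivial⟩, fun ⟨x, _, h⟩ => hv x h,
      ⟨(false, false), ne _, trivial⟩, ⟨(false, false), ne _, hd⟩⟩
  · exact ⟨⟨(false, false), ne _, trivial⟩, ⟨(false, false), ne _, hl⟩,
      fun ⟨x, _, h⟩ => hb x h, fun ⟨x, _, h⟩ => hb x h⟩
  · exact ⟨⟨(false, false), ne _, trivial⟩, ⟨(false, false), ne _, hl⟩,
      ⟨(false, false), ne _, trivial⟩, fun ⟨x, _, h⟩ => hb x h⟩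
  · exact ⟨⟨(false, false), ne _, trivial⟩, ⟨(false, false), ne _, hnv⟩,
      ⟨(false, false), ne _, trivial⟩, ⟨(false, false), ne _, hnb⟩⟩

/-! ### Recognizing a graph with a single edge -/

/-- The corners of the edge at a flag, labelled by their end and side. -/
def corner (G : ColouredRibbonGraph) (x : G.Flag) : Bool × Bool → G.Flag
  | (false, false) => x
  | (false, true) => G.endInv x
  | (true, false) => G.sideInv x
  | (true, true) => G.endInv (G.sideInv x)

lemma corner_endInv (x : G.Flag) (i j : Bool) :
    G.corner x (i, !j) = G.endInv (G.corner x (i, j)) := by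
  cases i <;> cases j <;> simp [corner, G.endInv_invol]

lemma corner_sideInv (x : G.Flag) (i j : Bool) :
    G.corner x (!i, j) = G.sideInv (G.corner x (i, j)) := by
  cases i <;> cases j <;> simp [corner, G.sideInv_invol, ← G.comm]

lemma range_corner (x : G.Flag) : Set.range (G.corner x) = G.corners x := by
  ext y
  constructor
  · rintro ⟨⟨i, j⟩, rfl⟩
    cases i <;> cases j <;> simp [corner, corners]
  · rintro (rfl | rfl | rfl | rfl)
    exacts [⟨(false, false), rfl⟩, ⟨(false, true), rfl⟩, ⟨(true, false), rfl⟩, ⟨(true, true), rfl⟩]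

lemma corner_injective {x : G.Flag} (hx : x ∈ G.edgeFlags) : Function.Injective (G.corner x) := by
  have h1 : G.endInv x ≠ G.sideInv x := hx
  have h2 := endInv_sideInv_ne hx
  have h3 : G.endInv x ≠ G.endInv (G.sideInv x) := fun h =>
    G.sideInv_ne x (by simpa [G.endInv_invol] using (congrArg G.endInv h).symm)
  have h4 := G.endInv_ne x
  have h5 := G.sideInv_ne x
  have h6 := G.endInv_ne (G.sideInv x)
  rintro ⟨i, j⟩ ⟨i', j'⟩ h
  cases i <;> cases j <;> cases i' <;> cases j' <;>
    simp_all [corner, eq_comm]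

/-- A coloured ribbon graph with a single edge subdivides the graph with one edge whose corners are
joined in the same way. -/
lemma subdivides_oneEdge {x : G.Flag} (hx : x ∈ G.edgeFlags) (hG : G.edgeFlags = G.corners x)
    (hiso : ∀ y, G.NonIsolated y) {c : Bool × Bool → Bool × Bool} (hc : ∀ i, c (c i) = i)
    (hc' : ∀ i, c i ≠ i) (hj : ∀ i, G.Joined ∅ x (G.corner x i) (G.corner x (c i)))
    (V B : Setoid (Bool × Bool)) (hV : (oneEdge c hc hc').vertexRel ≤ V)
    (hB : (oneEdge c hc hc').boundaryRel ≤ B)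
    (hVG : ∀ i j, V i j ↔ G.vCol (G.corner x i) (G.corner x j))
    (hBG : ∀ i j, B i j ↔ G.bCol (G.corner x i) (G.corner x j)) :
    G.Subdivides ⟨oneEdge c hc hc', V, B, hV, hB⟩ (G.corner x) where
  injective := corner_injective hx
  map_endInv i := corner_endInv x i.1 i.2
  map_sideInv i := corner_sideInv x i.1 i.2
  free y hy := by
    have h : y ∉ G.edgeFlags := by
      rw [hG, ← range_corner]
      exact hy
    exact not_not.1 h
  map_arcInv i := by
    -- In the state `∅` the involution is `endInv`, so being joined is the path condition of a
    -- subdivision.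
    refine Relation.ReflTransGen.mono ?_ _ _ (hj i)
    rintro y z ⟨hy, rfl⟩
    exact ⟨by rwa [← range_corner] at hy, by rw [stateInv_of_notMem (Set.notMem_empty y)]⟩
  vertex y := by
    obtain ⟨z, hz, hze⟩ := hiso y
    have : z ∈ Set.range (G.corner x) := by
      rw [range_corner, ← hG]
      exact hze
    obtain ⟨i, rfl⟩ := this
    exact ⟨i, hz⟩
  vCol_iff := hVG
  bCol_iff := hBG

lemma vCol_corner (x : G.Flag) (i j j' : Bool) :
    G.vCol (G.corner x (i, j)) (G.corner x (i, j')) := by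
  by_cases h : j' = j
  · rw [h]
  · obtain rfl : j' = !j := by revert h; cases j <;> cases j' <;> simp
    rw [corner_endInv]
    exact G.vCol_endInv _

lemma bCol_corner (x : G.Flag) (i i' j : Bool) :
    G.bCol (G.corner x (i, j)) (G.corner x (i', j)) := by
  by_cases h : i' = i
  · rw [h]
  · obtain rfl : i' = !i := by revert h; cases i <;> cases i' <;> simp
    rw [corner_sideInv]
    exact G.bCol_sideInv _

lemma vCol_corner_of_rel {x : G.Flag} (h : G.vCol x (G.sideInv x)) (i j : Bool × Bool) :
    G.vCol (G.corner x i) (G.corner x j) := by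
  have key : ∀ a b : Bool, G.vCol (G.corner x (a, false)) (G.corner x (b, false)) := by
    intro a b
    cases a <;> cases b
    exacts [G.vCol.refl _, h, G.vCol.symm h, G.vCol.refl _]
  exact G.vCol.trans (vCol_corner x i.1 i.2 false)
    (G.vCol.trans (key i.1 j.1) (vCol_corner x j.1 false j.2))

lemma bCol_corner_of_rel {x : G.Flag} (h : G.bCol x (G.endInv x)) (i j : Bool × Bool) :
    G.bCol (G.corner x i) (G.corner x j) := by
  have key : ∀ a b : Bool, G.bCol (G.corner x (false, a)) (G.corner x (false, b)) := by
    intro a b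
    cases a <;> cases b
    exacts [G.bCol.refl _, h, G.bCol.symm h, G.bCol.refl _]
  exact G.bCol.trans (bCol_corner x i.1 false i.2)
    (G.bCol.trans (key i.2 j.2) (bCol_corner x false j.1 j.2))

lemma vCol_corner_iff {x : G.Flag} (h : ¬ G.vCol x (G.sideInv x)) (i j : Bool × Bool) :
    i.1 = j.1 ↔ G.vCol (G.corner x i) (G.corner x j) := by
  obtain ⟨a, i⟩ := i
  obtain ⟨b, j⟩ := j
  constructor
  · rintro rfl
    exact vCol_corner x _ _ _
  · intro h'
    have h2 := G.vCol.trans (vCol_corner x a false i) (G.vCol.trans h' (vCol_corner x b j false))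
    cases a <;> cases b
    exacts [rfl, absurd h2 h, absurd (G.vCol.symm h2) h, rfl]

lemma bCol_corner_iff {x : G.Flag} (h : ¬ G.bCol x (G.endInv x)) (i j : Bool × Bool) :
    i.2 = j.2 ↔ G.bCol (G.corner x i) (G.corner x j) := by
  obtain ⟨i, a⟩ := i
  obtain ⟨j, b⟩ := j
  constructor
  · rintro rfl
    exact bCol_corner x _ _ _
  · intro h'
    have h2 := G.bCol.trans (bCol_corner x false i a) (G.bCol.trans h' (bCol_corner x j false b))
    cases a <;> cases b
    exacts [rfl, absurd h2 h, absurd (G.bCol.symm h2) h, rfl]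

/-- Every coloured ribbon graph with a single edge and without isolated vertices is equivalent to
one of the five graphs with one edge. -/
lemma exists_equivalent_graph {x : G.Flag} (hx : x ∈ G.edgeFlags)
    (hG : G.edgeFlags = G.corners x) (hiso : ∀ y, G.NonIsolated y) :
    ∃ t : OneEdgeType, G.Equivalent t.graph := by
  suffices ∃ t : OneEdgeType, ∃ f, G.Subdivides t.graph f by
    obtain ⟨t, h⟩ := this
    exact ⟨t, .symm _ _ (.rel _ _ h)⟩
  have hempty : G.IsStable ∅ := isStable_empty
  have hb : G.curves (∅ ∪ G.corners x) = G.boundaryRel := by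
    rw [← curves_univ]
    exact curves_congr fun y hy => by
      rw [← hG, Set.empty_union]
      exact iff_of_true hy trivial
  have hstep := curves_step hempty hx (Set.notMem_empty x)
  rw [hb, curves_empty] at hstep
  have hsymm : ∀ {i j : Bool × Bool}, G.Joined ∅ x (G.corner x i) (G.corner x j) →
      G.Joined ∅ x (G.corner x j) (G.corner x i) := fun h =>
    h.symm hempty (range_corner (G := G) x ▸ ⟨_, rfl⟩)
  -- The pairing of the corners is the gap involution of one of the three uncoloured one-edge
  -- graphs. The colours then separate `bs` from `bp` and `olc` from `olh`.
  rcases hstep with ⟨-, h2, -, h3, h4⟩ | ⟨h1, -, -, h3, h4⟩ | ⟨h1, h2, -, h3, h4⟩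
  · have hj : ∀ i : Bool × Bool, G.Joined ∅ x (G.corner x i) (G.corner x (i.1, !i.2)) := by
      rintro ⟨_ | _, _ | _⟩
      exacts [h3, hsymm (i := (false, false)) (j := (false, true)) h3, h4,
        hsymm (i := (true, false)) (j := (true, true)) h4]
    have hB := bCol_corner_of_rel (G.boundaryRel_le h2)
    by_cases hc : G.vCol x (G.sideInv x)
    · exact ⟨.bp, _, subdivides_oneEdge hx hG hiso _ _ hj ⊤ ⊤ le_top le_top
        (fun i j => iff_of_true trivial (vCol_corner_of_rel hc i j))
        (fun i j => iff_of_true trivial (hB i j))⟩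
    · exact ⟨.bs, _, subdivides_oneEdge hx hG hiso _ _ hj bridgeGraph.vertexRel ⊤ le_rfl le_top
        (fun i j => (bridgeGraph_vertexRel i j).trans (vCol_corner_iff hc i j))
        (fun i j => iff_of_true trivial (hB i j))⟩
  · have hj : ∀ i : Bool × Bool, G.Joined ∅ x (G.corner x i) (G.corner x (!i.1, i.2)) := by
      rintro ⟨_ | _, _ | _⟩
      exacts [h3, h4, hsymm (i := (false, false)) (j := (true, false)) h3,
        hsymm (i := (false, true)) (j := (true, true)) h4]
    have hV := vCol_corner_of_rel (G.vertexRel_le h1)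
    by_cases hc : G.bCol x (G.endInv x)
    · exact ⟨.olh, _, subdivides_oneEdge hx hG hiso _ _ hj ⊤ ⊤ le_top le_top
        (fun i j => iff_of_true trivial (hV i j))
        (fun i j => iff_of_true trivial (bCol_corner_of_rel hc i j))⟩
    · exact ⟨.olc, _, subdivides_oneEdge hx hG hiso _ _ hj ⊤ orientableLoopGraph.boundaryRel
        le_top le_rfl (fun i j => iff_of_true trivial (hV i j))
        (fun i j => (orientableLoopGraph_boundaryRel i j).trans (bCol_corner_iff hc i j))⟩
  · have hj : ∀ i : Bool × Bool, G.Joined ∅ x (G.corner x i) (G.corner x (!i.1, !i.2)) := by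
      rintro ⟨_ | _, _ | _⟩
      exacts [h3, h4, hsymm (i := (false, true)) (j := (true, false)) h4,
        hsymm (i := (false, false)) (j := (true, true)) h3]
    exact ⟨.nl, _, subdivides_oneEdge hx hG hiso _ _ hj ⊤ ⊤ le_top le_top
      (fun i j => iff_of_true trivial (vCol_corner_of_rel (G.vertexRel_le h1) i j))
      (fun i j => iff_of_true trivial (bCol_corner_of_rel (G.boundaryRel_le h2) i j))⟩

lemma exists_removeIsolated_equivalent_graph {x : G.Flag} (hx : x ∈ G.edgeFlags)
    (hG : G.edgeFlags = G.corners x) : ∃ t : OneEdgeType, G.removeIsolated.Equivalent t.graph := by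
  have hx' := nonIsolated_of_mem_edgeFlags hx
  refine exists_equivalent_graph (x := ⟨x, hx'⟩)
    ((G.mem_removeIsolated_edgeFlags _).2 hx) ?_ ?_
  · ext y
    rw [mem_removeIsolated_edgeFlags, hG]
    have e : ∀ z : G.removeIsolated.Flag, (y.1 = z.1 ↔ y = z) := fun z => Subtype.ext_iff.symm
    exact or_congr (e ⟨x, hx'⟩) (or_congr (e (G.removeIsolated.endInv ⟨x, hx'⟩))
      (or_congr (e (G.removeIsolated.sideInv ⟨x, hx'⟩))
        (e (G.removeIsolated.endInv (G.removeIsolated.sideInv ⟨x, hx'⟩)))))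
  · rintro ⟨y, hy⟩
    obtain ⟨z, hz, hze⟩ := hy
    exact ⟨⟨z, nonIsolated_of_mem_edgeFlags hze⟩, (G.removeIsolated_vertexRel _ _).2 hz,
      (G.mem_removeIsolated_edgeFlags _).2 hze⟩

/-! ## The kind of an edge and the coefficients -/

lemma hasKind_iff_of_edgeFlags_eq {x : G.Flag} (hG : G.edgeFlags = G.corners x)
    (t : OneEdgeType) : G.HasKind t ↔ t.Describes (G.vCol x (G.sideInv x))
      (G.vertexRel x (G.sideInv x)) (G.bCol x (G.endInv x)) (G.boundaryRel x (G.endInv x)) := by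
  have key : ∀ {p : G.Flag → Prop}, (∀ y ∈ G.corners x, p y ↔ p x) →
      ((∃ y ∈ G.edgeFlags, p y) ↔ p x) := by
    intro p hp
    rw [hG]
    exact ⟨fun ⟨y, hy, h⟩ => (hp y hy).1 h, fun h => ⟨x, self_mem_corners x, h⟩⟩
  have h1 : G.HasColourLoop ↔ G.vCol x (G.sideInv x) := key fun y hy =>
    rel_sideInv_iff_of_mem_corners (fun z _ => G.vCol_endInv z) hy
  have h2 : G.HasLoop ↔ G.vertexRel x (G.sideInv x) := key fun y hy =>
    rel_sideInv_iff_of_mem_corners (fun z _ => .rel _ _ (Or.inl rfl)) hy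
  have h3 : G.HasColourDoop ↔ G.bCol x (G.endInv x) := key fun y hy =>
    rel_endInv_iff_of_mem_corners (fun z _ => G.bCol_sideInv z) hy
  have h4 : G.HasDoop ↔ G.boundaryRel x (G.endInv x) := key fun y hy =>
    rel_endInv_iff_of_mem_corners (fun z _ => .rel _ _ (Or.inl rfl)) hy
  rw [HasKind, h1, h2, h3, h4]

/-! ### Joins depend on edges only, and their duality -/

lemma vJoin_congr {S T : Set G.Flag} (h : ∀ x ∈ G.edgeFlags, (x ∈ S ↔ x ∈ T)) :
    G.vJoin S = G.vJoin T := by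
  have key : ∀ {S T : Set G.Flag}, (∀ x ∈ G.edgeFlags, (x ∈ S → x ∈ T)) →
      G.vJoin S ≤ G.vJoin T := by
    intro S T h
    refine vJoin_le (vCol_le_vJoin T) fun x hx => ?_
    by_cases hE : G.endInv x = G.sideInv x
    · rw [← hE]
      exact vCol_le_vJoin T (G.vCol_endInv x)
    · exact vJoin_sideInv (h x hE hx)
  exact le_antisymm (key fun x hx => (h x hx).1) (key fun x hx => (h x hx).2)

/-- The dual exchanges the colourings as well as the two involutions; an edge in a state of the dual
is an edge outside the complementary state. -/
lemma vJoin_dual (S : Set G.Flag) : G.dual.vJoin S = G.bJoin Sᶜ := by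
  refine le_antisymm (vJoin_le (G := G.dual) (bCol_le_bJoin (G := G) _) fun x hx => ?_)
    (bJoin_le (vCol_le_vJoin (G := G.dual) S) fun x hx => ?_)
  · exact bJoin_endInv (G := G) (Set.notMem_compl_iff.2 hx)
  · exact vJoin_sideInv (G := G.dual) (Set.notMem_compl_iff.1 hx)

lemma edgeFlags_dual : G.dual.edgeFlags = G.edgeFlags :=
  Set.ext fun _ => ne_comm

lemma bJoin_congr {S T : Set G.Flag} (h : ∀ x ∈ G.edgeFlags, (x ∈ S ↔ x ∈ T)) :
    G.bJoin S = G.bJoin T := by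
  have h' : G.dual.vJoin Sᶜ = G.dual.vJoin Tᶜ := by
    refine vJoin_congr (G := G.dual) fun x hx => ?_
    rw [edgeFlags_dual] at hx
    exact (h x hx).not
  have h2 := (vJoin_dual Sᶜ).symm.trans (h'.trans (vJoin_dual Tᶜ))
  rwa [compl_compl, compl_compl] at h2

end ColouredRibbonGraph


open RibbonGraph

namespace ColouredRibbonGraph

variable {G : ColouredRibbonGraph}

/-! ### Kinds in the minors with one edge -/

-- Deleting all edges but `e` leaves the vertices of the state `∅` and the boundary of the state
-- `e`, so the remaining graph records the step from `∅` to `e`.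
open Classical in
lemma delete_hasKind_iff (e : G.Edge) {x : G.Flag} (hx : x ∈ e.1) (t : OneEdgeType) :
    ((G.delete {e}ᶜ).edgeFlags = (G.delete {e}ᶜ).corners x ∧ x ∈ (G.delete {e}ᶜ).edgeFlags) ∧
    ((G.delete {e}ᶜ).HasKind t ↔ t.Describes (G.vJoin ∅ x (G.sideInv x))
      (G.curves ∅ x (G.sideInv x)) (G.bJoin (∅ ∪ G.corners x) x (G.endInv x))
      (G.curves (∅ ∪ G.corners x) x (G.endInv x))) := by
  have hxA : x ∉ G.cornersOf {e}ᶜ := by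
    rw [cornersOf_compl_singleton]
    exact fun h => h.2 hx
  have hs : (G.delete {e}ᶜ).sideInv x = G.sideInv x := if_neg hxA
  have hE : (G.delete {e}ᶜ).edgeFlags = G.corners x := by
    refine (edgeFlags_delete ({e}ᶜ : Set G.Edge)).trans ?_
    rw [cornersOf_compl_singleton, sdiff_sdiff_right_self, ← e.eq_corners hx]
    exact Set.inter_eq_right.2 e.isState.subset
  have hc : (G.delete {e}ᶜ).corners x = G.corners x := by
    unfold corners
    rw [hs]
    rfl
  have hEc := hE.trans hc.symm
  refine ⟨⟨hEc, hE ▸ self_mem_corners x⟩, (hasKind_iff_of_edgeFlags_eq hEc t).trans ?_⟩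
  have hmem : ∀ y ∈ G.edgeFlags, (y ∈ Set.univ \ G.cornersOf {e}ᶜ ↔ y ∈ ∅ ∪ G.corners x) := by
    intro y hy
    rw [cornersOf_compl_singleton, ← e.eq_corners hx, Set.empty_union]
    simp [hy]
  have h1 : (G.delete {e}ᶜ).vCol = G.vJoin ∅ := (vJoin_empty (G := G)).symm
  have h2 : (G.delete {e}ᶜ).vertexRel = G.curves ∅ :=
    (curves_empty (G := G.toRibbonGraph)).symm
  have h3 : (G.delete {e}ᶜ).bCol = G.bJoin (∅ ∪ G.corners x) :=
    (bJoin_of_edgeFlags_subset (Set.subset_univ _)).symm.trans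
      ((bJoin_delete _ Set.univ).trans (bJoin_congr hmem))
  have h4 : (G.delete {e}ᶜ).boundaryRel = G.curves (∅ ∪ G.corners x) :=
    curves_univ.symm.trans ((curves_delete _ Set.univ).trans (curves_congr hmem))
  rw [h1, h2, h3, h4, hs]
  rfl

-- Contracting all edges but `e` leaves the vertices of the state `E \ e` and the boundary of the
-- state `E`, so the remaining graph records the last step.
open Classical in
lemma contract_hasKind_iff (e : G.Edge) {x : G.Flag} (hx : x ∈ e.1) (t : OneEdgeType) :
    ((G.contract {e}ᶜ).edgeFlags = (G.contract {e}ᶜ).corners x ∧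
      x ∈ (G.contract {e}ᶜ).edgeFlags) ∧
    ((G.contract {e}ᶜ).HasKind t ↔ t.Describes
      (G.vJoin (G.edgeFlags \ G.corners x) x (G.sideInv x))
      (G.curves (G.edgeFlags \ G.corners x) x (G.sideInv x))
      (G.bJoin (G.edgeFlags \ G.corners x ∪ G.corners x) x (G.endInv x))
      (G.curves (G.edgeFlags \ G.corners x ∪ G.corners x) x (G.endInv x))) := by
  have hxA : x ∉ G.cornersOf {e}ᶜ := by
    rw [cornersOf_compl_singleton]
    exact fun h => h.2 hx
  have he : (G.contract {e}ᶜ).endInv x = G.endInv x := if_neg hxA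
  have hes : (G.contract {e}ᶜ).endInv (G.sideInv x) = G.endInv (G.sideInv x) :=
    if_neg ((isStable_cornersOf _).sideInv_mem_iff.not.2 hxA)
  have hE : (G.contract {e}ᶜ).edgeFlags = G.corners x := by
    refine (edgeFlags_contract ({e}ᶜ : Set G.Edge)).trans ?_
    rw [cornersOf_compl_singleton, sdiff_sdiff_right_self, ← e.eq_corners hx]
    exact Set.inter_eq_right.2 e.isState.subset
  have hc : (G.contract {e}ᶜ).corners x = G.corners x := by
    change ({x, (G.contract {e}ᶜ).endInv x, G.sideInv x,
      (G.contract {e}ᶜ).endInv (G.sideInv x)} : Set G.Flag) = _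
    rw [he, hes]
    rfl
  have hEc := hE.trans hc.symm
  refine ⟨⟨hEc, hE ▸ self_mem_corners x⟩, (hasKind_iff_of_edgeFlags_eq hEc t).trans ?_⟩
  have hE' : G.edgeFlags \ G.corners x ∪ G.corners x = G.edgeFlags := by
    rw [← e.eq_corners hx]
    exact Set.sdiff_union_of_subset e.isState.subset
  have hA : G.cornersOf {e}ᶜ = G.edgeFlags \ G.corners x := by
    rw [cornersOf_compl_singleton, e.eq_corners hx]
  have hmem : ∀ y ∈ G.edgeFlags, (y ∈ Set.univ ∪ G.cornersOf {e}ᶜ ↔ y ∈ G.edgeFlags) :=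
    fun y hy => iff_of_true (Or.inl trivial) hy
  have h1 : (G.contract {e}ᶜ).vCol = G.vJoin (G.edgeFlags \ G.corners x) := by
    refine vJoin_empty.symm.trans ((vJoin_contract _ ∅).trans ?_)
    rw [Set.empty_union, hA]
  have h2 : (G.contract {e}ᶜ).vertexRel = G.curves (G.edgeFlags \ G.corners x) := by
    refine curves_empty.symm.trans ((curves_contract _ ∅).trans ?_)
    rw [Set.empty_union, hA]
  have h3 : (G.contract {e}ᶜ).bCol = G.bJoin G.edgeFlags :=
    (bJoin_of_edgeFlags_subset (Set.subset_univ _)).symm.trans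
      ((bJoin_contract _ Set.univ).trans (bJoin_congr hmem))
  have h4 : (G.contract {e}ᶜ).boundaryRel = G.curves G.edgeFlags :=
    curves_univ.symm.trans ((curves_contract _ Set.univ).trans (curves_congr hmem))
  rw [h1, h2, h3, h4, he, hE']
  rfl

/-- The kind of `i` passes through the equivalence and the removal of isolated vertices to the step
that adds `e` last; its four truth values select the branch of `weight_step`. -/
lemma IsOfType.weightA_eq {e : G.Edge} {i j : OneEdgeType} (h : G.IsOfType e i j) :
    G.weightA (G.edgeFlags \ e.1) G.edgeFlags = coeffA i := by
  obtain ⟨x, hxE, hx⟩ := e.exists_eq_corners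
  have hxe : x ∈ e.1 := hx ▸ self_mem_corners x
  have hk : (G.contract {e}ᶜ).HasKind i := (removeIsolated_hasKind_iff _ _).1
    ((h.1.hasKind_iff i).2 (graph_hasKind i))
  rw [(contract_hasKind_iff e hxe i).2] at hk
  have hE' : G.edgeFlags \ G.corners x ∪ G.corners x = G.edgeFlags :=
    Set.sdiff_union_of_subset (isStable_edgeFlags.corners_subset hxE)
  have hw := (weight_step (MvPolynomial.X Var.aBs : TutteRing) (MvPolynomial.X Var.sqrtABp)
    (MvPolynomial.X Var.aOlc) (MvPolynomial.X Var.sqrtAOlh)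
    (isStable_edgeFlags.diff (isStable_corners x)) hxE
    (fun h => h.2 (self_mem_corners x))).2
  rw [hE'] at hw hk
  rw [hx, weightA, hw]
  cases i <;> simp only [OneEdgeType.Describes] at hk <;> simp [hk, coeffA]

lemma IsOfType.weightB_eq {e : G.Edge} {i j : OneEdgeType} (h : G.IsOfType e i j) :
    G.weightB ∅ e.1 = coeffB j := by
  obtain ⟨x, hxE, hx⟩ := e.exists_eq_corners
  have hxe : x ∈ e.1 := hx ▸ self_mem_corners x
  have hk : (G.delete {e}ᶜ).HasKind j := (removeIsolated_hasKind_iff _ _).1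
    ((h.2.hasKind_iff j).2 (graph_hasKind j))
  rw [(delete_hasKind_iff e hxe j).2] at hk
  have hw := (weight_step (MvPolynomial.X Var.bBs : TutteRing) (MvPolynomial.X Var.sqrtBBp)
    (MvPolynomial.X Var.bOlc) (MvPolynomial.X Var.sqrtBOlh)
    (isStable_empty (G := G.toRibbonGraph)) hxE (Set.notMem_empty x)).2
  rw [Set.empty_union] at hw hk
  rw [hx, weightB, hw]
  cases j <;> simp only [OneEdgeType.Describes] at hk <;> simp [hk, coeffB]

/-- Every edge has a type. -/
lemma exists_isOfType (e : G.Edge) : ∃ i j, G.IsOfType e i j := by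
  obtain ⟨x, hxE, hx⟩ := e.exists_eq_corners
  have hxe : x ∈ e.1 := hx ▸ self_mem_corners x
  have h1 := (contract_hasKind_iff e hxe .bs).1
  have h2 := (delete_hasKind_iff e hxe .bs).1
  obtain ⟨i, hi⟩ := exists_removeIsolated_equivalent_graph h1.2 h1.1
  obtain ⟨j, hj⟩ := exists_removeIsolated_equivalent_graph h2.2 h2.1
  exact ⟨i, j, hi, hj⟩

/-! ### Loops and bridges -/

lemma isLoop_iff {e : G.Edge} {x : G.Flag} (hx : x ∈ e.1) :
    G.IsLoop e ↔ G.curves ∅ x (G.sideInv x) := by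
  rw [curves_empty]
  have h : ∀ y ∈ e.1, (G.vertexRel y (G.sideInv y) ↔ G.vertexRel x (G.sideInv x)) := by
    intro y hy
    rw [e.eq_corners hx] at hy
    exact rel_sideInv_iff_of_mem_corners (fun z _ => .rel _ _ (Or.inl rfl)) hy
  exact ⟨fun ⟨y, hy, h'⟩ => (h y hy).1 h', fun h' => ⟨x, hx, h'⟩⟩

/-- Walking around the vertex is the traversal of the state `∅`, so `exists_iterate_iff` applies. -/
lemma isNonorientableLoop_iff {e : G.Edge} {x : G.Flag} (hx : x ∈ e.1) :
    G.IsNonorientableLoop e ↔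
      G.curves ∅ x (G.sideInv x) ∧ G.curves (G.corners x) x (G.endInv x) := by
  have h : ∀ y ∈ e.1, ((∃ n : ℕ, (fun y => G.arcInv (G.endInv y))^[n] y = G.sideInv y) ↔
      G.curves ∅ y (G.sideInv y) ∧ G.curves (G.corners x) y (G.endInv y)) := by
    intro y hy
    have h' := exists_iterate_iff (isStable_empty (G := G.toRibbonGraph)) (e.mem_edgeFlags hy)
      (Set.notMem_empty y)
    rw [Set.empty_union, ← e.eq_corners hy, e.eq_corners hx] at h'
    rw [← h']
    have : G.stateInv ∅ = G.endInv := funext fun z => stateInv_of_notMem (Set.notMem_empty z)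
    rw [this]
  have h2 : ∀ y ∈ e.1, (G.curves (G.corners x) y (G.endInv y) ↔
      G.curves (G.corners x) x (G.endInv x)) := by
    intro y hy
    rw [e.eq_corners hx] at hy
    refine rel_endInv_iff_of_mem_corners (fun z hz => ?_) hy
    rw [← stateInv_of_mem hz]
    exact curves_stateInv _ z
  constructor
  · rintro ⟨y, hy, hn⟩
    have h3 := (h y hy).1 hn
    exact ⟨(isLoop_iff hx).1 (by rw [isLoop_iff hy]; exact h3.1), (h2 y hy).1 h3.2⟩
  · exact fun h' => ⟨x, hx, (h x hx).2 h'⟩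

lemma isGraphLoop_iff {e : G.Edge} {x : G.Flag} (hx : x ∈ e.1) :
    IsGraphLoop G.vertexQuotient e ↔ G.vJoin ∅ x (G.sideInv x) := by
  rw [vJoin_empty]
  have h : ∀ y ∈ e.1, (G.vCol y (G.sideInv y) ↔ G.vCol x (G.sideInv x)) := by
    intro y hy
    rw [e.eq_corners hx] at hy
    exact rel_sideInv_iff_of_mem_corners (fun z _ => G.vCol_endInv z) hy
  constructor
  · rintro ⟨v, y, hy, h1, h2⟩
    exact (h y hy).1 (Quotient.exact (h1.symm.trans h2))
  · exact fun h' => ⟨⟦x⟧, x, hx, rfl, Quotient.sound h'⟩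

/-- The components of a graph on the vertex colour classes whose edges are those in a state. -/
lemma numComponents_eq {H : Graph (Quotient G.vCol) G.Edge} {S : Set G.Flag}
    (hv : H.vertexSet = Set.univ)
    (hadj : ∀ u v, H.Adj u v ↔ ∃ x ∈ S, u = ⟦x⟧ ∧ v = ⟦G.sideInv x⟧) :
    numComponents H = G.numV S := by
  -- Adjacency generates its relation over equality of colour classes, and `vJoin S` is generated
  -- over `vCol`; the map `f` matches the two.
  let f : G.Flag → H.vertexSet := fun x => ⟨⟦x⟧, hv ▸ Set.mem_univ _⟩
  have hf : ∀ x y, G.vCol x y ↔ (⊥ : Setoid H.vertexSet) (f x) (f y) := fun x y =>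
    ⟨fun h => Subtype.ext (Quotient.sound h), fun h => Quotient.exact (congrArg Subtype.val h)⟩
  have hs : ∀ u, ∃ x, (⊥ : Setoid H.vertexSet) u (f x) := by
    rintro ⟨q, hq⟩
    induction q using Quotient.inductionOn with | _ x
    exact ⟨x, rfl⟩
  have key := sup_eqvGen_iff_of_comap (g := fun x y => x ∈ S ∧ y = G.sideInv x)
    (g' := fun u v : H.vertexSet => H.Adj u.1 v.1) hf hs ?_ ?_
  · rw [bot_sup_eq] at key
    exact (card_quotient_eq_of_comap f key fun u => by
      obtain ⟨x, hx⟩ := hs u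
      exact ⟨x, (bot_le : ⊥ ≤ Relation.EqvGen.setoid _) hx⟩).symm
  · rintro x _ ⟨hx, rfl⟩
    exact (hadj _ _).2 ⟨x, hx, rfl, rfl⟩
  · rintro ⟨u, hu⟩ ⟨v, hv⟩ h
    obtain ⟨x, hx, rfl, rfl⟩ := (hadj _ _).1 h
    exact Or.inr ⟨x, _, rfl, rfl, hx, rfl⟩

/-- The numbers of components with and without `e` are `numV` of the states `E` and `E \ e`, which
`numV_step` compares. -/
lemma isBridge_iff {e : G.Edge} {x : G.Flag} (hx : x ∈ e.1) :
    IsBridge G.vertexQuotient e ↔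
      ¬ G.vJoin (G.edgeFlags \ G.corners x) x (G.sideInv x) := by
  classical
  have h1 : numComponents G.vertexQuotient = G.numV G.edgeFlags := by
    refine numComponents_eq rfl fun u v => ?_
    constructor
    · rintro ⟨f, y, hy, rfl, rfl⟩
      exact ⟨y, f.mem_edgeFlags hy, rfl, rfl⟩
    · rintro ⟨y, hy, rfl, rfl⟩
      exact ⟨edgeAt y hy, y, self_mem_corners y, rfl, rfl⟩
  have h2 : numComponents (G.vertexQuotient.deleteEdges {e}) =
      G.numV (G.edgeFlags \ G.corners x) := by
    refine numComponents_eq rfl fun u v => ?_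
    rw [← e.eq_corners hx]
    constructor
    · rintro ⟨f, hf⟩
      rw [Graph.deleteEdges_isLink] at hf
      obtain ⟨⟨y, hy, rfl, rfl⟩, hfe⟩ := hf
      refine ⟨y, ⟨f.mem_edgeFlags hy, fun h => hfe (Subtype.ext ?_)⟩, rfl, rfl⟩
      rw [f.eq_corners hy, e.eq_corners h]
    · rintro ⟨y, ⟨hy, hye⟩, rfl, rfl⟩
      refine ⟨edgeAt y hy, ?_⟩
      rw [Graph.deleteEdges_isLink]
      refine ⟨⟨y, self_mem_corners y, rfl, rfl⟩, fun h => hye ?_⟩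
      rw [← Set.mem_singleton_iff.1 h]
      exact self_mem_corners y
  have h3 := numV_step (G.edgeFlags \ G.corners x) x
  rw [Set.sdiff_union_of_subset
    (isStable_edgeFlags.corners_subset (e.mem_edgeFlags hx))] at h3
  have h4 : e ∈ G.vertexQuotient.edgeSet := by
    rw [Graph.edgeSet_eq_setOfPred_exists_isLink]
    exact ⟨_, _, x, hx, rfl, rfl⟩
  unfold IsBridge
  rw [h1, h2, h3]
  by_cases h : G.vJoin (G.edgeFlags \ G.corners x) x (G.sideInv x) <;> simp [h, h4]

/-- This is the criterion for loops in the dual, whose empty state corresponds to the state of all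
edges. -/
lemma isDoop_iff {e : G.Edge} {x : G.Flag} (hx : x ∈ e.1) :
    G.IsDoop e ↔ G.curves G.edgeFlags x (G.endInv x) := by
  have h : G.dual.curves ∅ = G.curves G.edgeFlags :=
    (curves_dual (G := G.toRibbonGraph) ∅).trans
      (curves_congr fun y hy => iff_of_true (Set.notMem_empty y) hy)
  rw [← h]
  exact isLoop_iff (G := G.dual) (e := e.dual) hx

lemma isNonorientableDoop_iff {e : G.Edge} {x : G.Flag} (hx : x ∈ e.1) :
    G.IsNonorientableDoop e ↔ G.curves G.edgeFlags x (G.endInv x) ∧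
      G.curves (G.edgeFlags \ G.corners x) x (G.sideInv x) := by
  have h : G.dual.curves ∅ = G.curves G.edgeFlags :=
    (curves_dual (G := G.toRibbonGraph) ∅).trans
      (curves_congr fun y hy => iff_of_true (Set.notMem_empty y) hy)
  have h' : G.dual.curves (G.dual.corners x) = G.curves (G.edgeFlags \ G.corners x) := by
    refine (curves_dual (G := G.toRibbonGraph) _).trans (curves_congr fun y hy => ?_)
    have hc : G.dual.corners x = G.corners x := corners_dual x
    rw [hc]
    exact ⟨fun h => ⟨hy, h⟩, fun h => h.2⟩
  rw [← h, ← h']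
  exact isNonorientableLoop_iff (G := G.dual) (e := e.dual) hx

lemma isGraphLoop_boundaryQuotient_iff {e : G.Edge} {x : G.Flag} (hx : x ∈ e.1) :
    IsGraphLoop G.boundaryQuotient e.dual ↔ G.bJoin G.edgeFlags x (G.endInv x) := by
  have h : G.dual.vJoin ∅ = G.bJoin G.edgeFlags :=
    (vJoin_dual ∅).trans (bJoin_congr fun y hy => iff_of_true (Set.notMem_empty y) hy)
  rw [← h]
  exact isGraphLoop_iff (G := G.dual) (e := e.dual) hx

/-- In the dual the state of all edges but `e` corresponds to the state `e`. So bridges for the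
boundary colours concern the first step, while doops concern the last one. -/
lemma isBridge_boundaryQuotient_iff {e : G.Edge} {x : G.Flag} (hx : x ∈ e.1) :
    IsBridge G.boundaryQuotient e.dual ↔ ¬ G.bJoin (G.corners x) x (G.endInv x) := by
  have h : G.dual.vJoin (G.dual.edgeFlags \ G.dual.corners x) = G.bJoin (G.corners x) := by
    refine (vJoin_dual _).trans (bJoin_congr fun y hy => ?_)
    have hc : G.dual.corners x = G.corners x := corners_dual x
    rw [hc, edgeFlags_dual]
    exact ⟨fun h => not_not.1 fun h' => h ⟨hy, h'⟩, fun h h' => h'.2 h⟩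
  rw [← h]
  exact isBridge_iff (G := G.dual) (e := e.dual) hx

end ColouredRibbonGraph

/-! ### The coefficients `f(e)` and `g(e)` as weights -/

open ColouredRibbonGraph

/-- Every condition in `f(e)` is about the step from `E \ e` to `E`, so both sides are case
distinctions on the same four propositions. -/
lemma deletionCoeff_eq (G : ColouredRibbonGraph) (e : G.Edge) :
    deletionCoeff G e = G.weightA (G.edgeFlags \ e.1) G.edgeFlags := by
  classical
  obtain ⟨x, hxE, hx⟩ := e.exists_eq_corners
  have hxe : x ∈ e.1 := hx ▸ self_mem_corners x
  have hE' : G.edgeFlags \ G.corners x ∪ G.corners x = G.edgeFlags :=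
    Set.sdiff_union_of_subset (isStable_edgeFlags.corners_subset hxE)
  have hst := isStable_edgeFlags.diff (isStable_corners (G := G.toRibbonGraph) x)
  have hxS : x ∉ G.edgeFlags \ G.corners x := fun h => h.2 (self_mem_corners x)
  have hw := (weight_step (MvPolynomial.X Var.aBs : TutteRing) (MvPolynomial.X Var.sqrtABp)
    (MvPolynomial.X Var.aOlc) (MvPolynomial.X Var.sqrtAOlh) hst hxE hxS).2
  have hstep := curves_step hst hxE hxS
  rw [hE'] at hw hstep
  rw [hx, weightA, hw]
  have ho : G.IsOrientableDoop e ↔ G.IsDoop e ∧ ¬ G.IsNonorientableDoop e := Iff.rfl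
  unfold deletionCoeff
  simp only [ho, isDoop_iff hxe, isNonorientableDoop_iff hxe, isBridge_iff hxe,
    isGraphLoop_boundaryQuotient_iff hxe]
  have h1 := curves_le_vJoin (G := G) (G.edgeFlags \ G.corners x) (x := x) (y := G.sideInv x)
  have h2 := curves_le_bJoin (G := G) G.edgeFlags (x := x) (y := G.endInv x)
  -- In each case of `curves_step` one of the two holds. Together with `h1` and `h2` this excludes
  -- every combination that is not one of the five kinds.
  have h3 : G.curves (G.edgeFlags \ G.corners x) x (G.sideInv x) ∨
      G.curves G.edgeFlags x (G.endInv x) := by tauto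
  clear hstep hw
  by_cases i1 : G.vJoin (G.edgeFlags \ G.corners x) x (G.sideInv x) <;>
  by_cases i2 : G.curves (G.edgeFlags \ G.corners x) x (G.sideInv x) <;>
  by_cases i3 : G.bJoin G.edgeFlags x (G.endInv x) <;>
  by_cases i4 : G.curves G.edgeFlags x (G.endInv x) <;>
  simp_all

/-- Here all conditions are about the step from `∅` to `e`. -/
lemma contractionCoeff_eq (G : ColouredRibbonGraph) (e : G.Edge) :
    contractionCoeff G e = G.weightB ∅ e.1 := by
  classical
  obtain ⟨x, hxE, hx⟩ := e.exists_eq_corners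
  have hxe : x ∈ e.1 := hx ▸ self_mem_corners x
  have hst := isStable_empty (G := G.toRibbonGraph)
  have hxS : x ∉ (∅ : Set G.Flag) := Set.notMem_empty x
  have hw := (weight_step (MvPolynomial.X Var.bBs : TutteRing) (MvPolynomial.X Var.sqrtBBp)
    (MvPolynomial.X Var.bOlc) (MvPolynomial.X Var.sqrtBOlh) hst hxE hxS).2
  have hstep := curves_step hst hxE hxS
  rw [Set.empty_union] at hw hstep
  rw [hx, weightB, hw]
  have ho : G.IsOrientableLoop e ↔ G.IsLoop e ∧ ¬ G.IsNonorientableLoop e := Iff.rfl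
  unfold contractionCoeff
  simp only [ho, isLoop_iff hxe, isNonorientableLoop_iff hxe, isGraphLoop_iff hxe,
    isBridge_boundaryQuotient_iff hxe]
  have h1 := curves_le_vJoin (G := G) ∅ (x := x) (y := G.sideInv x)
  have h2 := curves_le_bJoin (G := G) (G.corners x) (x := x) (y := G.endInv x)
  have h3 : G.curves ∅ x (G.sideInv x) ∨ G.curves (G.corners x) x (G.endInv x) := by tauto
  clear hstep hw
  by_cases i1 : G.vJoin ∅ x (G.sideInv x) <;>
  by_cases i2 : G.curves ∅ x (G.sideInv x) <;>
  by_cases i3 : G.bJoin (G.corners x) x (G.endInv x) <;>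
  by_cases i4 : G.curves (G.corners x) x (G.endInv x) <;>
  simp_all

/-! ## The two recursions -/

lemma typeRecursion_stateSum : TypeRecursion stateSum := by
  refine ⟨fun G e i j h => ?_, fun G h => stateSum_of_isEmpty h⟩
  rw [stateSum_eq e, h.weightA_eq, h.weightB_eq]

lemma deletionContraction_stateSum : DeletionContraction stateSum := by
  refine ⟨fun G e => ?_, fun G h => stateSum_of_isEmpty h⟩
  rw [stateSum_eq e, deletionCoeff_eq, contractionCoeff_eq]

/-- Two functions with the same values on edgeless graphs coincide if at every edge they satisfy
a common linear relation with the deletion and the contraction. -/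
lemma eq_of_recursion {U U' : ColouredRibbonGraph → TutteRing} (h : EdgelessValue U)
    (h' : EdgelessValue U') (hrec : ∀ (G : ColouredRibbonGraph) (e : G.Edge), ∃ a b : TutteRing,
      U G = a * U (G.delete {e}) + b * U (G.contract {e}) ∧
      U' G = a * U' (G.delete {e}) + b * U' (G.contract {e})) : U = U' := by
  funext G
  induction hn : G.edgeFlags.ncard using Nat.strong_induction_on generalizing G with
  | _ n ih =>
    rcases isEmpty_or_nonempty G.Edge with hG | ⟨⟨e⟩⟩
    · rw [h G hG, h' G hG]
    · obtain ⟨a, b, h1, h2⟩ := hrec G e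
      -- Deletion and contraction leave the same set of corners, so one inequality serves both.
      have hlt : (G.edgeFlags \ G.cornersOf {e}).ncard < n := by
        obtain ⟨x, hxE, hx⟩ := e.exists_eq_corners
        rw [← hn, cornersOf_singleton, hx]
        exact Set.ncard_lt_ncard ⟨Set.sdiff_subset, fun h => (h hxE).2 (self_mem_corners x)⟩
      have hd : (G.delete {e}).edgeFlags = G.edgeFlags \ G.cornersOf {e} := edgeFlags_delete {e}
      have hc : (G.contract {e}).edgeFlags = G.edgeFlags \ G.cornersOf {e} :=
        edgeFlags_contract {e}
      rw [h1, h2, ih _ hlt (G.delete {e}) (congrArg Set.ncard hd),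
        ih _ hlt (G.contract {e}) (congrArg Set.ncard hc)]

end

end RibbonTutte

/-! ### The theorem -/

open RibbonTutte ColouredRibbonGraph

/-- There is a function `U` on coloured ribbon graphs, invariant under equivalence, which is the one
and only function given by the recursion in terms of edge types, and which is also the one and only
function satisfying the deletion-contraction relations with the coefficients `f(e)` and `g(e)`. -/
theorem theorem3p6 :
    ∃ U : RibbonTutte.ColouredRibbonGraph → RibbonTutte.TutteRing,
      (∀ G H : RibbonTutte.ColouredRibbonGraph, G.Equivalent H → U G = U H) ∧
      (∀ U' : RibbonTutte.ColouredRibbonGraph → RibbonTutte.TutteRing,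
        RibbonTutte.TypeRecursion U' ↔ U' = U) ∧
      (∀ U' : RibbonTutte.ColouredRibbonGraph → RibbonTutte.TutteRing,
        RibbonTutte.DeletionContraction U' ↔ U' = U) := by
  refine ⟨stateSum, fun G H h => h.stateSum_eq, fun U' => ⟨fun h => ?_, ?_⟩,
    fun U' => ⟨fun h => ?_, ?_⟩⟩
  · refine eq_of_recursion h.2 typeRecursion_stateSum.2 fun G e => ?_
    -- The recursion by types constrains `U'` only at edges that have a type; this supplies one at
    -- every edge.
    obtain ⟨i, j, hij⟩ := exists_isOfType e
    exact ⟨_, _, h.1 G e i j hij, typeRecursion_stateSum.1 G e i j hij⟩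
  · rintro rfl
    exact typeRecursion_stateSum
  · exact eq_of_recursion h.2 deletionContraction_stateSum.2 fun G e =>
      ⟨_, _, h.1 G e, deletionContraction_stateSum.1 G e⟩
  · rintro rfl
    exact deletionContraction_stateSum
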